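/- Let $m\ge 2$, $\alpha\in(0,1)$, and let $W\in C^{2,\alpha}_{\rm loc}(\mathbb R^m;\mathbb R)$ be nonnegative with exactly two zeros $a^-\neq a^+$. Assume that there are $r,c>0$ with $D^2W(u)(\nu,\nu)\ge c$ whenever $|\nu|=1$ and $|u-a^-|\le r$ or $|u-a^+|\le r$, and that $\liminf_{|u|\to\infty}W(u)>0$. **Notation.** For $v\in H^1_{\rm loc}(\mathbb R;\mathbb R^m)$ let $J(v)=\int_{\mathbb R}\big[\tfrac12|v'|^2+W(v)\big]\in[0,\infty]$, let $A$ be the set of $v\in H^1_{\rm loc}(\mathbb R;\mathbb R^m)$ with $\lim_{x\to\pm\infty}v(x)=a^\pm$, and let $J_{\min}=\inf_A J$. A minimal heteroclinic is a solution $e\in C^2(\mathbb R;\mathbb R^m)$ of $e''=\nabla W(e)$ with $\lim_{x\to\pm\infty}e(x)=a^\pm$ and $J(e)=J_{\min}$. Let $e_0(x)=a^-$ for $x\le-1$, $e_0(x)=a^-+\frac{x+1}{2}(a^+-a^-)$ for $-1\le x\le 1$, and $e_0(x)=a^+$ for $x\ge1$. Let $\tilde{\mathcal H}=e_0+H^1(\mathbb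 R;\mathbb R^m)$, with the Hilbert structure of $H^1(\mathbb R;\mathbb R^m)$ (carried over by $h\mapsto e_0+h$) and the distance $d(u,v)=\|u-v\|_{H^1}$. Let $F\subset\tilde{\mathcal H}$ be the set of minimal heteroclinics, and let $\mathcal W(u)=J(u)-J_{\min}$ for $u\in\tilde{\mathcal H}$. Assume that $F=F^-\cup F^+$ with $F^\pm\ne\varnothing$ and $d_{\min}:=\inf\{\|e^--e^+\|_{H^1}:e^\pm\in F^\pm\}>0$. Let $\tilde{\mathcal A}$ be the set of all $V\in H^1_{\rm loc}(\mathbb R;\tilde{\mathcal H})$ for which there are $t_V^-<t_V^+$ with $d(V(t),F^-)\le d_{\min}/4$ for all $t\le t_V^-$ and $d(V(t),F^+)\le d_{\min}/4$ for all $t\ge t_V^+$, and let $$\tilde{\mathcal J}(V)=\int_{\mathbb R}\Big[\tfrac12\|V'(t)\|_{H^1}^2+\mathcal W(V(t))\Big]\,dt .$$ **Theorem.** There is $\tilde U\in\tilde{\mathcal A}$ with $\tilde{\mathcal J}(\tilde U)=\min_{\tilde{\mathcal A}}\tilde{\mathcal J}<\infty$ such that the following hold. (i) $\mathcal W$ is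 finite and nonnegative on $\tilde{\mathcal H}$ and $\mathcal W\in C^1(\tilde{\mathcal H};[0,\infty))$; moreover $\tilde U\in C^2(\mathbb R;\tilde{\mathcal H})$ and $\tilde U''(t)=\nabla\mathcal W(\tilde U(t))$ for all $t\in\mathbb R$, where $\nabla\mathcal W$ is the gradient with respect to the $H^1$ inner product. (ii) The function $\tilde u(t,x)=[\tilde U(t)](x)$ (with the continuous representative of $\tilde U(t)$) satisfies $\tilde u\in H^1_{\rm loc}(\mathbb R^2;\mathbb R^m)$, $\tilde u_t,\tilde u_{tx}\in L^2(\mathbb R^2;\mathbb R^m)$ and $\tilde u_x\in L^2((\beta,\gamma)\times\mathbb R;\mathbb R^m)$ for all $\beta<\gamma$. It is a weak solution of $\tilde u_{ttxx}=\Delta\tilde u-\nabla W(\tilde u)$: for every $\phi\in C^2(\mathbb R^2;\mathbb R^m)$ with compact support, $$\int_{\mathbb R^2}\big(\tilde u_{tx}\cdot\phi_{tx}+\nabla\tilde u\cdot\nabla\phi+\nabla W(\tilde u)\cdot\phi\big)=0 .$$ Moreover $\lim_{t\to\pm\infty}d(\tilde U(t),F^\pm)=0$, and $\lim_{x\to\pm\infty}\tilde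 u(t,x)=a^\pm$ uniformly for $t$ in bounded sets. (iii) For every $t\in\mathbb R$, $\tfrac12\|\tilde U'(t)\|_{H^1}^2=\mathcal W(\tilde U(t))$, that is, $$\frac12\int_{\mathbb R}\big(|\tilde u_t(t,x)|^2+|\tilde u_{tx}(t,x)|^2\big)\,dx=\int_{\mathbb R}\Big[\frac12|\tilde u_x(t,x)|^2+W(\tilde u(t,x))\Big]dx-J_{\min}.$$ (iv) With $\tilde E_\Omega(u)=\int_\Omega\big[\tfrac12(|u_{tx}|^2+|\nabla u|^2)+W(u)\big]$, for every $\phi\in C^2(\mathbb R^2;\mathbb R^m)$ with compact support, $\tilde E_{\operatorname{supp}\phi}(\tilde u)$ is finite and $\tilde E_{\operatorname{supp}\phi}(\tilde u)\le\tilde E_{\operatorname{supp}\phi}(\tilde u+\phi)$. In addition, if $$\liminf_{d(u,F)\to0,\ d(u,F)>0}\frac{\mathcal W(u)}{d(u,F)^2}>0,$$ then there are $e^\pm\in F^\pm$ and $k,K>0$ such that $\|\tilde U(t)-e^+\|_{H^1}\le Ke^{-kt}$ for all $t\ge0$ and $\|\tilde U(t)-e^-\|_{H^1}\le Ke^{kt}$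 for all $t\le0$, and the convergence $\tilde u(t,x)\to a^\pm$ as $x\to\pm\infty$ is uniform for $t\in\mathbb R$. -/

import Mathlib

open MeasureTheory Filter Topology
open scoped ENNReal ContDiff

noncomputable section

namespace DoubleLayer

/-- `g` is the weak (distributional) derivative of `u` in the direction `v`. It is used with `Y = ℝ`,
`v = 1` (functions of one variable with values in a Banach space) and with `Y = ℝ × ℝ`,
`v = (1, 0)` or `v = (0, 1)` (partial derivatives with respect to `t` and `x`). -/
def HasWeakDeriv {Y X : Type*} [NormedAddCommGroup Y] [NormedSpace ℝ Y] [MeasureSpace Y]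
    [NormedAddCommGroup X] [NormedSpace ℝ X] (v : Y) (u g : Y → X) : Prop :=
  LocallyIntegrable u volume ∧ LocallyIntegrable g volume ∧
    ∀ φ : Y → ℝ, ContDiff ℝ ∞ φ → HasCompactSupport φ →
      ∫ y, (fderiv ℝ φ y v) • u y = - ∫ y, φ y • g y

open Classical in
/-- A representative of the weak derivative of `u` in the direction `v` (unique up to null sets);
`0` if there is none. -/
def weakDeriv {Y X : Type*} [NormedAddCommGroup Y] [NormedSpace ℝ Y] [MeasureSpace Y]
    [NormedAddCommGroup X] [NormedSpace ℝ X] (v : Y) (u : Y → X) : Y → X :=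
  if h : ∃ g : Y → X, HasWeakDeriv v u g then h.choose else 0

/-- `f ∈ L²_loc`. -/
def MemL2loc {Y X : Type*} [TopologicalSpace Y] [MeasureSpace Y] [NormedAddCommGroup X]
    (f : Y → X) : Prop :=
  ∀ K : Set Y, IsCompact K → MemLp f 2 (volume.restrict K)

/-- `V ∈ H¹_loc(ℝ; X)`. -/
def MemH1loc {X : Type*} [NormedAddCommGroup X] [NormedSpace ℝ X] (V : ℝ → X) : Prop :=
  MemL2loc V ∧ ∃ g : ℝ → X, HasWeakDeriv (1 : ℝ) V g ∧ MemL2loc g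

/-! ### The Hilbert space `H¹(ℝ; ℝᵐ)` -/

/-- `ℝᵐ` with the Euclidean norm. -/
abbrev E (m : ℕ) : Type := EuclideanSpace ℝ (Fin m)

/-- `L²(ℝ; ℝᵐ)`. -/
abbrev L2 (m : ℕ) : Type := Lp (E m) 2 (volume : Measure ℝ)

theorem locallyIntegrable_L2 {m : ℕ} (f : L2 m) : LocallyIntegrable (f : ℝ → E m) volume :=
  (Lp.memLp f).locallyIntegrable (by norm_num)

theorem integrable_smul_L2 {m : ℕ} (f : L2 m) {φ : ℝ → ℝ} (hφ : Continuous φ)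
    (hc : HasCompactSupport φ) : Integrable (fun x => φ x • (f : ℝ → E m) x) volume :=
  (locallyIntegrable_L2 f).integrable_smul_left_of_hasCompactSupport hφ hc

theorem hasWeakDeriv_add {m : ℕ} {f g f' g' : L2 m}
    (hf : HasWeakDeriv (1 : ℝ) (f : ℝ → E m) (f' : ℝ → E m))
    (hg : HasWeakDeriv (1 : ℝ) (g : ℝ → E m) (g' : ℝ → E m)) :
    HasWeakDeriv (1 : ℝ) ((f + g : L2 m) : ℝ → E m) ((f' + g' : L2 m) : ℝ → E m) := by
  refine ⟨locallyIntegrable_L2 _, locallyIntegrable_L2 _, fun φ hφ hc => ?_⟩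
  have hd : Continuous fun y => fderiv ℝ φ y 1 :=
    (hφ.continuous_fderiv (by simp)).clm_apply continuous_const
  have hdc : HasCompactSupport fun y => fderiv ℝ φ y 1 := hc.fderiv_apply (𝕜 := ℝ) 1
  have h1 : ∫ y, (fderiv ℝ φ y 1) • ((f + g : L2 m) : ℝ → E m) y
      = ∫ y, ((fderiv ℝ φ y 1) • (f : ℝ → E m) y + (fderiv ℝ φ y 1) • (g : ℝ → E m) y) := by
    refine integral_congr_ae ?_
    filter_upwards [Lp.coeFn_add f g] with y hy
    rw [hy, Pi.add_apply, smul_add]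
  have h2 : ∫ y, φ y • ((f' + g' : L2 m) : ℝ → E m) y
      = ∫ y, (φ y • (f' : ℝ → E m) y + φ y • (g' : ℝ → E m) y) := by
    refine integral_congr_ae ?_
    filter_upwards [Lp.coeFn_add f' g'] with y hy
    rw [hy, Pi.add_apply, smul_add]
  rw [h1, h2, integral_add (integrable_smul_L2 f hd hdc) (integrable_smul_L2 g hd hdc),
    integral_add (integrable_smul_L2 f' hφ.continuous hc) (integrable_smul_L2 g' hφ.continuous hc),
    hf.2.2 φ hφ hc, hg.2.2 φ hφ hc]
  abel

theorem hasWeakDeriv_smul {m : ℕ} (c : ℝ) {f f' : L2 m}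
    (hf : HasWeakDeriv (1 : ℝ) (f : ℝ → E m) (f' : ℝ → E m)) :
    HasWeakDeriv (1 : ℝ) ((c • f : L2 m) : ℝ → E m) ((c • f' : L2 m) : ℝ → E m) := by
  refine ⟨locallyIntegrable_L2 _, locallyIntegrable_L2 _, fun φ hφ hc => ?_⟩
  have h1 : ∫ y, (fderiv ℝ φ y 1) • ((c • f : L2 m) : ℝ → E m) y
      = ∫ y, c • ((fderiv ℝ φ y 1) • (f : ℝ → E m) y) := by
    refine integral_congr_ae ?_
    filter_upwards [Lp.coeFn_smul c f] with y hy
    rw [hy, Pi.smul_apply, smul_comm]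
  have h2 : ∫ y, φ y • ((c • f' : L2 m) : ℝ → E m) y
      = ∫ y, c • (φ y • (f' : ℝ → E m) y) := by
    refine integral_congr_ae ?_
    filter_upwards [Lp.coeFn_smul c f'] with y hy
    rw [hy, Pi.smul_apply, smul_comm]
  rw [h1, h2, integral_smul, integral_smul, hf.2.2 φ hφ hc, smul_neg]

theorem hasWeakDeriv_zero {m : ℕ} :
    HasWeakDeriv (1 : ℝ) ((0 : L2 m) : ℝ → E m) ((0 : L2 m) : ℝ → E m) := by
  refine ⟨locallyIntegrable_L2 _, locallyIntegrable_L2 _, fun φ hφ hc => ?_⟩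
  have h1 : ∫ y, (fderiv ℝ φ y 1) • ((0 : L2 m) : ℝ → E m) y = 0 := by
    refine integral_eq_zero_of_ae ?_
    filter_upwards [Lp.coeFn_zero (E m) 2 (volume : Measure ℝ)] with y _
    simp
  have h2 : ∫ y, φ y • ((0 : L2 m) : ℝ → E m) y = 0 := by
    refine integral_eq_zero_of_ae ?_
    filter_upwards [Lp.coeFn_zero (E m) 2 (volume : Measure ℝ)] with y _
    simp
  rw [h1, h2, neg_zero]

/-- `H¹(ℝ; ℝᵐ)`, as the space of pairs `(h, h')` in `L² × L²` such that `h'` is the weak derivative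
of `h`, with the inner product `⟨h, k⟩ = ∫ h · k + ∫ h' · k'` inherited from `L² × L²`. -/
def H1 (m : ℕ) : Submodule ℝ (WithLp 2 (L2 m × L2 m)) where
  carrier := {p | HasWeakDeriv (1 : ℝ) (p.fst : ℝ → E m) (p.snd : ℝ → E m)}
  add_mem' := fun ha hb => hasWeakDeriv_add ha hb
  zero_mem' := hasWeakDeriv_zero
  smul_mem' := fun c _ ha => hasWeakDeriv_smul c ha

/-- The function underlying an element of `H¹(ℝ; ℝᵐ)` (defined up to null sets). -/
def h1Fun {m : ℕ} (h : H1 m) : ℝ → E m := (h.val.fst : L2 m)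

/-- The weak derivative of an element of `H¹(ℝ; ℝᵐ)` (defined up to null sets). -/
def h1Der {m : ℕ} (h : H1 m) : ℝ → E m := (h.val.snd : L2 m)

theorem h1_inner_eq {m : ℕ} (h k : H1 m) :
    inner ℝ h k = (∫ x, inner ℝ (h1Fun h x) (h1Fun k x)) + ∫ x, inner ℝ (h1Der h x) (h1Der k x) := by
  rw [Submodule.coe_inner, WithLp.prod_inner_apply]
  rfl

theorem continuous_integral_smul_L2 {m : ℕ} {φ : ℝ → ℝ} (hφ : Continuous φ)
    (hc : HasCompactSupport φ) :
    Continuous fun f : L2 m => ∫ y, φ y • (f : ℝ → E m) y := by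
  have hmem : MemLp φ 2 volume := hφ.memLp_of_hasCompactSupport hc
  have heq : (fun f : L2 m => ∫ y, φ y • (f : ℝ → E m) y)
      = fun f : L2 m =>
        (ContinuousLinearMap.lsmul ℝ ℝ : ℝ →L[ℝ] E m →L[ℝ] E m).lpPairing volume 2 2
          (hmem.toLp φ) f := by
    funext f
    rw [ContinuousLinearMap.lpPairing_eq_integral]
    refine integral_congr_ae ?_
    filter_upwards [hmem.coeFn_toLp] with y hy
    simp [hy]
  rw [heq]
  exact ContinuousLinearMap.continuous _

theorem isClosed_H1 (m : ℕ) : IsClosed (H1 m : Set (WithLp 2 (L2 m × L2 m))) := by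
  have hset : (H1 m : Set (WithLp 2 (L2 m × L2 m)))
      = ⋂ (φ : ℝ → ℝ) (_ : ContDiff ℝ ∞ φ) (_ : HasCompactSupport φ),
        {p | ∫ y, (fderiv ℝ φ y 1) • (p.fst : ℝ → E m) y = - ∫ y, φ y • (p.snd : ℝ → E m) y} := by
    ext p
    simp only [Set.mem_iInter, Set.mem_ofPred_eq]
    exact ⟨fun hp => hp.2.2, fun hp => ⟨locallyIntegrable_L2 _, locallyIntegrable_L2 _, hp⟩⟩
  rw [hset]
  refine isClosed_iInter fun φ => isClosed_iInter fun hφ => isClosed_iInter fun hc => ?_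
  have hd : Continuous fun y => fderiv ℝ φ y 1 :=
    (hφ.continuous_fderiv (by simp)).clm_apply continuous_const
  have hdc : HasCompactSupport fun y => fderiv ℝ φ y 1 := hc.fderiv_apply (𝕜 := ℝ) 1
  refine isClosed_eq ?_ ?_
  · exact (continuous_integral_smul_L2 hd hdc).comp (WithLp.prod_continuous_ofLp 2 _ _).fst
  · exact ((continuous_integral_smul_L2 hφ.continuous hc).comp
      (WithLp.prod_continuous_ofLp 2 _ _).snd).neg

instance instCompleteSpaceH1 (m : ℕ) : CompleteSpace (H1 m) :=
  (isClosed_H1 m).completeSpace_coe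

/-! ### The potential, the one-dimensional action and the minimal heteroclinics -/

/-- `W : ℝᵐ → ℝ` is a `C^{2,α}` double-well potential with nondegenerate zeros `a⁻ ≠ a⁺` and with
`liminf_{|u| → ∞} W(u) > 0`. -/
structure IsDoubleWell {m : ℕ} (α : ℝ) (W : E m → ℝ) (am ap : E m) : Prop where
  contDiff : ContDiff ℝ 2 W
  holder : ∀ R : ℝ, ∃ C : ℝ, ∀ u v : E m, ‖u‖ ≤ R → ‖v‖ ≤ R →
    ‖fderiv ℝ (fderiv ℝ W) u - fderiv ℝ (fderiv ℝ W) v‖ ≤ C * ‖u - v‖ ^ α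
  nonneg : ∀ u, 0 ≤ W u
  ne : am ≠ ap
  zero_iff : ∀ u, W u = 0 ↔ u = am ∨ u = ap
  nondegenerate : ∃ r > 0, ∃ c > 0, ∀ u : E m, (‖u - am‖ ≤ r ∨ ‖u - ap‖ ≤ r) →
    ∀ ν : E m, ‖ν‖ = 1 → c ≤ fderiv ℝ (fderiv ℝ W) u ν ν
  liminf_pos : ∃ c > 0, ∀ᶠ u in cocompact (E m), c ≤ W u

/-- The action `J_ℝ(v) = ∫ ½|v'|² + W(v)`, for `v` with a weak derivative `v'` and `W ≥ 0`. -/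
def action {m : ℕ} (W : E m → ℝ) (v : ℝ → E m) : ℝ≥0∞ :=
  ∫⁻ x, ENNReal.ofReal ((1 / 2) * ‖weakDeriv (1 : ℝ) v x‖ ^ 2 + W (v x))

/-- The class `A` of the (continuous representatives of) `H¹_loc` maps `v` with
`v(x) → a^±` as `x → ±∞`. -/
def connectingClass {m : ℕ} (am ap : E m) : Set (ℝ → E m) :=
  {v | Continuous v ∧ MemH1loc v ∧ Tendsto v atBot (𝓝 am) ∧ Tendsto v atTop (𝓝 ap)}

/-- `J_min`, the infimum of the action in the class `A`. -/
def minAction {m : ℕ} (W : E m → ℝ) (am ap : E m) : ℝ≥0∞ :=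
  ⨅ v ∈ connectingClass am ap, action W v

/-- `e` is a minimal heteroclinic: a `C²` solution of `e'' = ∇W(e)` with `e(x) → a^±` as `x → ±∞`
that minimizes the action in the class `A`. -/
structure IsMinimalHeteroclinic {m : ℕ} (W : E m → ℝ) (am ap : E m) (e : ℝ → E m) : Prop where
  contDiff : ContDiff ℝ 2 e
  ode : ∀ x, deriv (deriv e) x = gradient W (e x)
  tendsto_atBot : Tendsto e atBot (𝓝 am)
  tendsto_atTop : Tendsto e atTop (𝓝 ap)
  minimal : ∀ v ∈ connectingClass am ap, action W e ≤ action W v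

/-! ### The affine space `H̃ = e₀ + H¹(ℝ; ℝᵐ)`

A point `u = e₀ + h` of `H̃` is represented by `h`, so that `H̃`, with its Hilbert structure, is
`H1 m`. -/

/-- The piecewise affine map `e₀`. -/
def e0 {m : ℕ} (am ap : E m) (x : ℝ) : E m :=
  if x ≤ -1 then am else if x ≤ 1 then am + ((x + 1) / 2) • (ap - am) else ap

/-- The map `u = e₀ + h : ℝ → ℝᵐ` (defined up to null sets). -/
def affineMap {m : ℕ} (am ap : E m) (h : H1 m) : ℝ → E m :=
  fun x => e0 am ap x + h1Fun h x

/-- The effective potential `𝒲(u) = J_ℝ(u) - J_min` on `H̃`. -/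
def effPot {m : ℕ} (W : E m → ℝ) (am ap : E m) (h : H1 m) : ℝ≥0∞ :=
  action W (affineMap am ap h) - minAction W am ap

/-- The set `F ⊂ H̃` of the minimal heteroclinics. -/
def minHet {m : ℕ} (W : E m → ℝ) (am ap : E m) : Set (H1 m) :=
  {h | ∃ e : ℝ → E m, IsMinimalHeteroclinic W am ap e ∧ affineMap am ap h =ᵐ[volume] e}

/-- The distance `d(S, T) = inf ‖s - t‖` of two nonempty subsets of `H̃`. -/
def setDist {m : ℕ} (S T : Set (H1 m)) : ℝ :=
  sInf {d | ∃ s ∈ S, ∃ t ∈ T, d = ‖s - t‖}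

/-- The action functional `∫ ½‖V'(t)‖² + 𝒲(V(t)) dt`, with the `H¹` norm of `V'(t)`. -/
def hAction {m : ℕ} (W : E m → ℝ) (am ap : E m) (V : ℝ → H1 m) : ℝ≥0∞ :=
  ∫⁻ t, (ENNReal.ofReal ((1 / 2) * ‖weakDeriv (1 : ℝ) V t‖ ^ 2) + effPot W am ap (V t))

/-- The constrained class of the (continuous representatives of) maps `V ∈ H¹_loc(ℝ; H̃)` with
`d(V(t), F⁻) ≤ d_min / 4` for `t ≤ t⁻` and `d(V(t), F⁺) ≤ d_min / 4` for `t ≥ t⁺`, for some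
`t⁻ < t⁺` depending on `V`. -/
def constrainedClass {m : ℕ} (Fm Fp : Set (H1 m)) : Set (ℝ → H1 m) :=
  {V | Continuous V ∧ MemH1loc V ∧ ∃ tm tp : ℝ, tm < tp ∧
    (∀ t ≤ tm, Metric.infDist (V t) Fm ≤ setDist Fm Fp / 4) ∧
    (∀ t ≥ tp, Metric.infDist (V t) Fp ≤ setDist Fm Fp / 4)}

/-- The nondegeneracy condition `liminf 𝒲(u) / d(u, F)² > 0` as `d(u, F) → 0`. -/
def IsNondegenerate {m : ℕ} (W : E m → ℝ) (am ap : E m) : Prop :=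
  0 < liminf
    (fun h : H1 m => effPot W am ap h /
      ENNReal.ofReal (Metric.infDist h (minHet W am ap) ^ 2))
    (comap (fun h : H1 m => Metric.infDist h (minHet W am ap)) (𝓝[>] 0))

/-! ### The fourth-order system in the plane -/

/-- The energy `∫_Ω ½(|u_tx|² + |u_t|² + |u_x|²) + W(u)`, with weak derivatives. -/
def energy {m : ℕ} (W : E m → ℝ) (Ω : Set (ℝ × ℝ)) (u : ℝ × ℝ → E m) : ℝ≥0∞ :=
  ∫⁻ p in Ω, ENNReal.ofReal
    ((1 / 2) * (‖weakDeriv ((0, 1) : ℝ × ℝ) (weakDeriv ((1, 0) : ℝ × ℝ) u) p‖ ^ 2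
      + ‖weakDeriv ((1, 0) : ℝ × ℝ) u p‖ ^ 2 + ‖weakDeriv ((0, 1) : ℝ × ℝ) u p‖ ^ 2) + W (u p))

/-- The classical partial derivative `φ_t`. -/
def pdt {m : ℕ} (φ : ℝ × ℝ → E m) (p : ℝ × ℝ) : E m := fderiv ℝ φ p (1, 0)

/-- The classical partial derivative `φ_x`. -/
def pdx {m : ℕ} (φ : ℝ × ℝ → E m) (p : ℝ × ℝ) : E m := fderiv ℝ φ p (0, 1)

end DoubleLayer

end

open DoubleLayer MeasureTheory Filter Topology

open scoped ENNReal ContDiff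

noncomputable section

namespace DoubleLayer

section Paths

/-! ### Weak derivatives and absolutely continuous paths -/

section WeakDeriv

variable {Y X : Type*} [NormedAddCommGroup Y] [NormedSpace ℝ Y] [MeasureSpace Y]
    [NormedAddCommGroup X] [NormedSpace ℝ X] {v : Y} {u u' g g' : Y → X}

/-! The variable `t` is regarded as the time of a mechanical system in the Hilbert space `H1 m`,
with potential `𝒲 ≥ 0`. The zeros of `𝒲` are exactly the minimal heteroclinics (`mem_minHet_iff`),
so the double layer is itself a minimal heteroclinic of `U'' = ∇𝒲(U)`, joining the set of wells `F⁻`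
to the set of wells `F⁺`.

The same variational argument is used at two levels, through the structure `TwoWell`: for `W` on
`ℝᵐ`, with two points as wells, and for `𝒲` on `H1 m`, with wells `F^±`. Its data are the separation
of the wells, a quadratic upper bound near them and a positive lower bound away from them. The
quadratic bound makes it cheap to join a nearby well by a segment, while crossing a fixed annulus
around the wells costs a fixed amount of energy. Hence (`near_minimizer`) a nearly optimal path
cannot leave a well after coming very close to it, except for the final passage, and this passage
takes a bounded time.

At the first level this gives compactness for `J`. A function of almost minimal action is bounded in
`H¹` after a translation in `x` (`exists_normalization`). For a minimizing sequence, the weak lower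
semicontinuity of both parts of the action, together with the convergence of their sum, upgrades
weak to strong convergence (`exists_subseq_translate`). The coercivity of `𝒲` and a sup bound for
all minimal heteroclinics follow, and these make `𝒲` an instance of `TwoWell` (`twoWell_realPot`).

At the second level, the translations in `x` act by isometries that preserve `𝒲` and also each of
`F^±`, because orbits are connected and `F^±` are a positive distance apart (`translate_mem`). A
minimizing sequence is normalized by a shift in `t` and a translation in `x`, and a weak limit is
taken (`exists_minimizer`). The energy is weakly lower semicontinuous, and the constraint survives
because bounded sequences in `F^±` are relatively compact.

The first variation shows that `U'` has the continuous weak derivative `∇𝒲(U)`, so `U` is `C²`. The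
conserved quantity `½‖U'‖² - 𝒲(U)` is a constant integrable on the line, hence zero
(`equipartition`). Under nondegeneracy, the energy `T(s)` spent before time `s` is at most a
constant times `d(U(s), F⁻)²`, hence at most a constant times `𝒲(U(s)) = T'(s)/2`; so `T` decays
exponentially as `s → -∞` and the length of the trajectory is controlled (`exists_exp_le`). Time
reversal treats the other end.

Finally, a test function in the plane is a compactly supported `C¹` curve in `H1 m`
(`exists_test_curve`). By Fubini, the weak equation (`weakForm`) and the minimality in the plane
(`energy_le_energy_add`) are the equation and the minimality of `U` read slice by slice. -/

theorem HasWeakDeriv.congr (h : HasWeakDeriv v u g) (hu : u =ᵐ[volume] u')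
    (hg : g =ᵐ[volume] g') : HasWeakDeriv v u' g' := by
  refine ⟨h.1.congr hu, h.2.1.congr hg, fun φ hφ hc => ?_⟩
  have h1 : ∫ y, (fderiv ℝ φ y v) • u' y = ∫ y, (fderiv ℝ φ y v) • u y :=
    integral_congr_ae (by filter_upwards [hu] with y hy; rw [hy])
  have h2 : ∫ y, φ y • g' y = ∫ y, φ y • g y :=
    integral_congr_ae (by filter_upwards [hg] with y hy; rw [hy])
  rw [h1, h2, h.2.2 φ hφ hc]

theorem HasWeakDeriv.ae_unique [FiniteDimensional ℝ Y] [BorelSpace Y] [CompleteSpace X]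
    (h : HasWeakDeriv v u g) (h' : HasWeakDeriv v u g') : g =ᵐ[volume] g' :=
  ae_eq_of_integral_contDiff_smul_eq h.2.1 h'.2.1 fun φ hφ hc => by
    have := (h.2.2 φ hφ hc).symm.trans (h'.2.2 φ hφ hc)
    exact neg_injective this

/-- `weakDeriv` is an arbitrary choice; uniqueness allows any known weak derivative to be
substituted for it under an integral. -/
theorem HasWeakDeriv.weakDeriv_ae_eq [FiniteDimensional ℝ Y] [BorelSpace Y] [CompleteSpace X]
    (h : HasWeakDeriv v u g) : weakDeriv v u =ᵐ[volume] g := by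
  have hex : ∃ g, HasWeakDeriv v u g := ⟨g, h⟩
  rw [weakDeriv, dif_pos hex]
  exact hex.choose_spec.ae_unique h

/-- Almost equal functions have the same weak derivatives, so the choice is made from the same
predicate. The equality is therefore literal and not only almost everywhere. -/
theorem weakDeriv_congr (hu : u =ᵐ[volume] u') : weakDeriv v u = weakDeriv v u' := by
  have : (fun g => HasWeakDeriv v u g) = fun g => HasWeakDeriv v u' g := by
    funext g
    exact propext ⟨fun h => h.congr hu (ae_eq_refl _), fun h => h.congr hu.symm (ae_eq_refl _)⟩
  simp only [weakDeriv]
  congr! 2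

end WeakDeriv

theorem _root_.MeasureTheory.LocallyIntegrable.intervalIntegrable' {X : Type*} [NormedAddCommGroup X] {g : ℝ → X}
    (hg : LocallyIntegrable g volume) (a b : ℝ) : IntervalIntegrable g volume a b :=
  intervalIntegrable_iff.mpr
    ((hg.integrableOn_isCompact isCompact_uIcc).mono_set Set.uIoc_subset_uIcc)

theorem locallyIntegrable_of_intervalIntegrable {X : Type*} [NormedAddCommGroup X] {g : ℝ → X}
    (hg : ∀ a b, IntervalIntegrable g volume a b) : LocallyIntegrable g volume := fun x =>
  ⟨Set.Ioo (x - 1) (x + 1), Ioo_mem_nhds (by linarith) (by linarith),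
    ((hg (x - 1) (x + 1)).1).mono_set Set.Ioo_subset_Ioc_self⟩

variable {X : Type*} [NormedAddCommGroup X] [NormedSpace ℝ X]

/-- `V` is absolutely continuous with derivative `g`. -/
structure IsPath (V g : ℝ → X) : Prop where
  locallyIntegrable : LocallyIntegrable g volume
  sub_eq : ∀ a b, V b - V a = ∫ t in a..b, g t

namespace IsPath

variable {V g V' g' : ℝ → X}

theorem intervalIntegrable (h : IsPath V g) (a b : ℝ) : IntervalIntegrable g volume a b :=
  h.locallyIntegrable.intervalIntegrable' a b

theorem eq_add (h : IsPath V g) (a b : ℝ) : V b = V a + ∫ t in a..b, g t := by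
  rw [← h.sub_eq a b]; abel

theorem of_locallyIntegrable (hg : LocallyIntegrable g volume) (c : X) :
    IsPath (fun t => c + ∫ s in (0 : ℝ)..t, g s) g := by
  refine ⟨hg, fun a b => ?_⟩
  have := intervalIntegral.integral_add_adjacent_intervals
    (hg.intervalIntegrable' 0 a) (hg.intervalIntegrable' a b)
  rw [← this]; abel

theorem continuous (h : IsPath V g) : Continuous V := by
  have : V = fun t => V 0 + ∫ s in (0 : ℝ)..t, g s := funext fun t => h.eq_add 0 t
  rw [this]
  exact continuous_const.add
    (intervalIntegral.continuous_primitive (fun a b => h.intervalIntegrable a b) 0)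

theorem congr_ae (h : IsPath V g) (hg : g =ᵐ[volume] g') : IsPath V g' :=
  ⟨h.locallyIntegrable.congr hg, fun a b => by
    rw [h.sub_eq]
    exact intervalIntegral.integral_congr_ae (by filter_upwards [hg] with t ht _ using ht)⟩

theorem add (h : IsPath V g) (h' : IsPath V' g') : IsPath (V + V') (g + g') :=
  ⟨h.locallyIntegrable.add h'.locallyIntegrable, fun a b => by
    have := intervalIntegral.integral_add (h.intervalIntegrable a b) (h'.intervalIntegrable a b)
    simp only [Pi.add_apply]
    rw [this, ← h.sub_eq, ← h'.sub_eq]; abel⟩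

theorem neg (h : IsPath V g) : IsPath (-V) (-g) :=
  ⟨h.locallyIntegrable.neg, fun a b => by
    simp only [Pi.neg_apply, intervalIntegral.integral_neg]
    rw [← h.sub_eq]; abel⟩

theorem sub (h : IsPath V g) (h' : IsPath V' g') : IsPath (V - V') (g - g') := by
  rw [sub_eq_add_neg, sub_eq_add_neg]; exact h.add h'.neg

theorem const_add (h : IsPath V g) (c : X) : IsPath (fun t => c + V t) g :=
  ⟨h.locallyIntegrable, fun a b => by rw [← h.sub_eq]; abel⟩

theorem const_smul (c : ℝ) (h : IsPath V g) : IsPath (fun t => c • V t) (fun t => c • g t) :=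
  ⟨h.locallyIntegrable.smul c, fun a b => by
    rw [intervalIntegral.integral_smul, ← h.sub_eq, smul_sub]⟩

theorem map {Z : Type*} [NormedAddCommGroup Z] [NormedSpace ℝ Z] [CompleteSpace X] [CompleteSpace Z]
    (L : X →L[ℝ] Z) (h : IsPath V g) : IsPath (fun t => L (V t)) (fun t => L (g t)) := by
  refine ⟨fun x => ?_, fun a b => ?_⟩
  · obtain ⟨s, hs, hi⟩ := h.locallyIntegrable x
    exact ⟨s, hs, L.integrable_comp hi⟩
  · rw [L.intervalIntegral_comp_comm (h.intervalIntegrable a b), ← h.sub_eq, map_sub]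

theorem smul_const {p q : ℝ → ℝ} [CompleteSpace X] (h : IsPath p q) (c : X) :
    IsPath (fun t => p t • c) (fun t => q t • c) :=
  h.map ((ContinuousLinearMap.id ℝ ℝ).smulRight c)

theorem comp_add (h : IsPath V g) (c : ℝ) : IsPath (fun t => V (t + c)) (fun t => g (t + c)) := by
  refine ⟨?_, fun a b => ?_⟩
  · refine (locallyIntegrable_map_homeomorph (Homeomorph.addRight c) (f := g)).1 ?_
    have : Measure.map (Homeomorph.addRight c) (volume : Measure ℝ) = volume :=
      map_add_right_eq_self volume c
    rw [this]; exact h.locallyIntegrable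
  · rw [intervalIntegral.integral_comp_add_right (fun t => g t), h.sub_eq]

theorem comp_neg (h : IsPath V g) : IsPath (fun t => V (-t)) (fun t => -g (-t)) := by
  refine ⟨?_, fun a b => ?_⟩
  · refine LocallyIntegrable.neg
      ((locallyIntegrable_map_homeomorph (Homeomorph.neg ℝ) (f := g)).1 ?_)
    have : Measure.map (Homeomorph.neg ℝ) (volume : Measure ℝ) = volume :=
      (Measure.measurePreserving_neg volume).map_eq
    rw [this]; exact h.locallyIntegrable
  · rw [intervalIntegral.integral_neg, intervalIntegral.integral_comp_neg (fun t => g t),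
      h.sub_eq, intervalIntegral.integral_symm]

theorem of_hasDerivAt [CompleteSpace X] (hd : ∀ t, HasDerivAt V (g t) t) (hg : Continuous g) : IsPath V g :=
  ⟨hg.locallyIntegrable, fun a b =>
    (intervalIntegral.integral_eq_sub_of_hasDerivAt (fun t _ => hd t)
      (hg.intervalIntegrable a b)).symm⟩

theorem ae_hasDerivAt [CompleteSpace X] (h : IsPath V g) : ∀ᵐ t, HasDerivAt V (g t) t := by
  filter_upwards [LocallyIntegrable.ae_hasDerivAt_integral h.locallyIntegrable] with t ht
  have : V = fun t => V 0 + ∫ s in (0 : ℝ)..t, g s := funext fun t => h.eq_add 0 t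
  rw [this]
  exact (ht 0).const_add _

theorem hasDerivAt [CompleteSpace X] (h : IsPath V g) (hg : Continuous g) (t : ℝ) :
    HasDerivAt V (g t) t := by
  have : V = fun t => V 0 + ∫ s in (0 : ℝ)..t, g s := funext fun t => h.eq_add 0 t
  rw [this]
  exact (intervalIntegral.integral_hasDerivAt_right (hg.intervalIntegrable _ _)
    (hg.stronglyMeasurableAtFilter _ _) hg.continuousAt).const_add _

theorem ae_unique [CompleteSpace X] (h : IsPath V g) (h' : IsPath V g') : g =ᵐ[volume] g' := by
  filter_upwards [h.ae_hasDerivAt, h'.ae_hasDerivAt] with t h1 h2 using h1.unique h2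

/-- The path `V` stopped to the left of `s`. -/
theorem stopped (h : IsPath V g) (s : ℝ) :
    IsPath (fun t => V (max t s)) ((Set.Ioi s).indicator g) := by
  have hl : LocallyIntegrable ((Set.Ioi s).indicator g) volume :=
    h.locallyIntegrable.indicator measurableSet_Ioi
  have key : ∀ b, V (max b s) - V s = ∫ t in s..b, (Set.Ioi s).indicator g t := by
    intro b
    rcases le_total s b with hb | hb
    · rw [max_eq_left hb, h.sub_eq, intervalIntegral.integral_of_le hb,
        intervalIntegral.integral_of_le hb]
      exact setIntegral_congr_fun measurableSet_Ioc fun t ht => by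
        rw [Set.indicator_of_mem]; exact ht.1
    · rw [max_eq_right hb, sub_self, intervalIntegral.integral_of_ge hb, eq_comm, neg_eq_zero]
      refine setIntegral_eq_zero_of_forall_eq_zero fun t ht => ?_
      rw [Set.indicator_of_notMem]; simpa using ht.2
  refine ⟨hl, fun a b => ?_⟩
  have := intervalIntegral.integral_interval_sub_left (hl.intervalIntegrable' s b)
    (hl.intervalIntegrable' s a)
  rw [← this, ← key, ← key]; abel

end IsPath

theorem isPath_id : IsPath (fun t : ℝ => t) (fun _ => (1 : ℝ)) :=
  IsPath.of_hasDerivAt (fun t => hasDerivAt_id t) continuous_const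

variable [CompleteSpace X]

/-- Gives access to integration by parts for scalar absolutely continuous functions, on which the
product rule `IsPath.smul` rests. -/
theorem IsPath.ac_real {V g : ℝ → ℝ} (h : IsPath V g) (a b : ℝ) :
    AbsolutelyContinuousOnInterval V a b := by
  have h1 : V = fun t => V a + ∫ s in a..t, g s := funext fun t => h.eq_add a t
  have h2 := (h.intervalIntegrable a b).absolutelyContinuousOnInterval_intervalIntegral
    (c := a) (by simp)
  have h3 : AbsolutelyContinuousOnInterval (fun _ : ℝ => V a) a b :=
    contDiffOn_const.absolutelyContinuousOnInterval
  rw [h1]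
  exact h3.add h2

theorem IsPath.smul {φ φ' : ℝ → ℝ} {V g : ℝ → X} (hφ : IsPath φ φ') (h : IsPath V g) :
    IsPath (fun t => φ t • V t) (fun t => φ' t • V t + φ t • g t) := by
  have hl1 : LocallyIntegrable (fun t => φ' t • V t) volume :=
    
    locallyIntegrable_of_intervalIntegrable fun a b =>
      (hφ.intervalIntegrable a b).smul_continuousOn h.continuous.continuousOn
  have hl2 : LocallyIntegrable (fun t => φ t • g t) volume :=
    
    locallyIntegrable_of_intervalIntegrable fun a b =>
      (h.intervalIntegrable a b).continuousOn_smul hφ.continuous.continuousOn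
  refine ⟨hl1.add hl2, fun a b => ?_⟩
  -- Functionals separate points and commute with the integral, so the vector-valued product rule
  -- reduces to the scalar one.
  refine (SeparatingDual.eq_iff_forall_dual_eq (R := ℝ)).2 fun L => ?_
  have hL := h.map L
  have e1 := L.intervalIntegral_comp_comm ((hl1.add hl2).intervalIntegrable' a b)
  have e2 := (hφ.ac_real a b).integral_deriv_mul_eq_sub (hL.ac_real a b)
  simp only [Pi.add_apply] at e1
  simp only [← e1, map_sub, map_smul, smul_eq_mul, ← e2, map_add]
  refine (intervalIntegral.integral_congr_ae ?_)
  filter_upwards [hφ.ae_hasDerivAt, hL.ae_hasDerivAt] with t h1 h2 _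
  rw [h1.deriv, h2.deriv]

/-- An absolutely continuous path has the weak derivative `g`. -/
theorem IsPath.hasWeakDeriv {V g : ℝ → X} (h : IsPath V g) : HasWeakDeriv (1 : ℝ) V g := by
  refine ⟨h.continuous.locallyIntegrable, h.locallyIntegrable, fun φ hφ hc => ?_⟩
  have hd : Continuous fun y => fderiv ℝ φ y 1 :=
    (hφ.continuous_fderiv (by simp)).clm_apply continuous_const
  have hdc : HasCompactSupport fun y => fderiv ℝ φ y 1 := hc.fderiv_apply (𝕜 := ℝ) 1
  have hp : IsPath φ fun y => fderiv ℝ φ y 1 :=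
    IsPath.of_hasDerivAt (fun t => by
      have := (hφ.differentiable (by simp) t).hasDerivAt
      simpa using this) hd
  have hq := hp.smul h
  have i1 : Integrable (fun y => (fderiv ℝ φ y 1) • V y) :=
    h.continuous.locallyIntegrable.integrable_smul_left_of_hasCompactSupport hd hdc
  have i2 : Integrable (fun y => φ y • g y) :=
    h.locallyIntegrable.integrable_smul_left_of_hasCompactSupport hφ.continuous hc
  rw [eq_neg_iff_add_eq_zero, ← integral_add i1 i2]
  obtain ⟨R, hR⟩ := hc.isCompact.isBounded.subset_ball 0
  have hz : ∀ y, y ∉ tsupport φ → φ y = 0 := fun y hy => image_eq_zero_of_notMem_tsupport hy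
  have hz' : ∀ y, y ∉ tsupport φ → fderiv ℝ φ y 1 = 0 := fun y hy => by
    rw [fderiv_of_notMem_tsupport (𝕜 := ℝ) hy]; rfl
  have hnot : ∀ y, R ≤ |y| → y ∉ tsupport φ := fun y hy hy' => by
    have := hR hy'
    rw [mem_ball_zero_iff, Real.norm_eq_abs] at this
    linarith
  -- The integrand is the derivative of `φ • V` and is supported in an interval at whose endpoints
  -- `φ` vanishes.
  have hsub : Function.support (fun y => (fderiv ℝ φ y 1) • V y + φ y • g y) ⊆
      Set.Ioc (-(|R| + 1)) (|R| + 1) := by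
    intro y hy
    by_contra hcon
    refine hy ?_
    have hy' : y ∉ tsupport φ := by
      refine hnot y ?_
      by_contra hlt
      push Not at hlt
      have h1 := abs_lt.1 hlt
      have h2 := le_abs_self R
      exact hcon ⟨by linarith, by linarith⟩
    simp [hz y hy', hz' y hy']
  rw [← intervalIntegral.integral_eq_integral_of_support_subset hsub, ← hq.sub_eq,
    hz _ (hnot (|R| + 1) (by rw [abs_of_nonneg (by positivity)]; linarith [le_abs_self R])),
    hz _ (hnot (-(|R| + 1)) (by
      rw [abs_neg, abs_of_nonneg (by positivity)]; linarith [le_abs_self R]))]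
  simp

/-- A smooth compactly supported function with zero integral has a compactly supported
primitive. -/
theorem exists_primitive_hasCompactSupport {ζ : ℝ → ℝ} (hζ : ContDiff ℝ ∞ ζ)
    (hc : HasCompactSupport ζ) (h0 : ∫ x, ζ x = 0) :
    ∃ Φ : ℝ → ℝ, ContDiff ℝ ∞ Φ ∧ HasCompactSupport Φ ∧ ∀ y, fderiv ℝ Φ y 1 = ζ y := by
  obtain ⟨R, hR⟩ := hc.isCompact.isBounded.subset_ball 0
  have hz : ∀ y, R ≤ |y| → ζ y = 0 := fun y hy => by
    refine image_eq_zero_of_notMem_tsupport fun hy' => ?_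
    have := hR hy'
    rw [mem_ball_zero_iff, Real.norm_eq_abs] at this
    linarith
  have hder : ∀ t, HasDerivAt (fun x => ∫ s in (-|R| - 1)..x, ζ s) (ζ t) t := fun t =>
    intervalIntegral.integral_hasDerivAt_right (hζ.continuous.intervalIntegrable _ _)
      (hζ.continuous.stronglyMeasurableAtFilter _ _) hζ.continuous.continuousAt
  refine ⟨fun x => ∫ s in (-|R| - 1)..x, ζ s, ?_, ?_, fun y => ?_⟩
  · rw [contDiff_infty_iff_deriv]
    refine ⟨fun t => (hder t).differentiableAt, ?_⟩
    have : deriv (fun x => ∫ s in (-|R| - 1)..x, ζ s) = ζ := funext fun t => (hder t).deriv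
    rw [this]; exact hζ
  · refine HasCompactSupport.of_support_subset_isCompact
      (isCompact_Icc (a := -|R| - 1) (b := |R| + 1)) fun x hx => ?_
    by_contra hcon
    refine hx ?_
    rw [Set.mem_Icc, not_and_or, not_le, not_le] at hcon
    have hR' := le_abs_self R
    have hR'' := abs_nonneg R
    rcases hcon with hx | hx
    · show ∫ s in (-|R| - 1)..x, ζ s = 0
      rw [intervalIntegral.integral_of_ge hx.le, neg_eq_zero]
      refine setIntegral_eq_zero_of_forall_eq_zero fun t ht => hz t ?_
      rw [abs_of_nonpos (by linarith [ht.2])]; linarith [ht.2]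
    · show ∫ s in (-|R| - 1)..x, ζ s = 0
      rw [intervalIntegral.integral_eq_integral_of_support_subset, h0]
      intro t ht
      by_contra hcon
      refine ht (hz t ?_)
      by_contra hlt
      push Not at hlt
      have h1 := abs_lt.1 hlt
      exact hcon ⟨by linarith, by linarith⟩
  · have := (hder y).hasFDerivAt.fderiv
    rw [this]; simp

/-- A function with vanishing weak derivative is constant almost everywhere. -/
theorem HasWeakDeriv.ae_const {w : ℝ → X} (h : HasWeakDeriv (1 : ℝ) w 0) :
    ∃ c, w =ᵐ[volume] fun _ => c := by
  let b : ContDiffBump (0 : ℝ) := ⟨1, 2, one_pos, by norm_num⟩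
  let η : ℝ → ℝ := b.normed volume
  have hη : ContDiff ℝ ∞ η := b.contDiff_normed
  have hηc : HasCompactSupport η := b.hasCompactSupport_normed
  have hη1 : ∫ x, η x = 1 := b.integral_normed
  refine ⟨∫ y, η y • w y, ae_eq_of_integral_contDiff_smul_eq h.1
    continuous_const.locallyIntegrable fun ψ hψ hψc => ?_⟩
  have iψ : Integrable ψ := hψ.continuous.integrable_of_hasCompactSupport hψc
  have iη : Integrable η := hη.continuous.integrable_of_hasCompactSupport hηc
  set I := ∫ x, ψ x with hI
  -- Subtracting `I • η` from `ψ` gives a test function of zero mean, that is, the derivative of a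
  -- test function, against which `w` integrates to zero. The constant is thus the `η`-average of
  -- `w`.
  obtain ⟨Φ, hΦ, hΦc, hd⟩ := exists_primitive_hasCompactSupport (ζ := fun x => ψ x - I * η x)
    (hψ.sub (contDiff_const.mul hη))
    (hψc.sub (hηc.mul_left)) (by
      rw [integral_sub iψ (iη.const_mul I), integral_const_mul, hη1, mul_one, sub_self])
  have := h.2.2 Φ hΦ hΦc
  simp only [hd, Pi.zero_apply, smul_zero, integral_zero, neg_zero] at this
  have e : ∀ y, (ψ y - I * η y) • w y = ψ y • w y - I • (η y • w y) := fun y => by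
    rw [sub_smul, mul_smul]
  simp only [e] at this
  rw [integral_sub (h.1.integrable_smul_left_of_hasCompactSupport hψ.continuous hψc)
    (show Integrable (fun y => I • (η y • w y)) from
      (h.1.integrable_smul_left_of_hasCompactSupport hη.continuous hηc).smul I),
    integral_smul, sub_eq_zero] at this
  rw [this, integral_smul_const]

/-- The difference of `V` and a primitive of `g` has zero weak derivative, hence is almost
everywhere constant. -/
theorem HasWeakDeriv.exists_isPath {V g : ℝ → X} (h : HasWeakDeriv (1 : ℝ) V g) :
    ∃ V₀, IsPath V₀ g ∧ V =ᵐ[volume] V₀ := by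
  have hp := IsPath.of_locallyIntegrable h.2.1 (0 : X)
  have hw := hp.hasWeakDeriv
  obtain ⟨c, hc⟩ : ∃ c, (fun y => V y - ((0 : X) + ∫ s in (0 : ℝ)..y, g s)) =ᵐ[volume]
      fun _ => c := by
    refine HasWeakDeriv.ae_const ⟨h.1.sub hw.1, locallyIntegrable_zero, fun φ hφ hφc => ?_⟩
    have hd : Continuous fun y => fderiv ℝ φ y 1 :=
      (hφ.continuous_fderiv (by simp)).clm_apply continuous_const
    have hdc : HasCompactSupport fun y => fderiv ℝ φ y 1 := hφc.fderiv_apply (𝕜 := ℝ) 1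
    simp only [smul_sub, Pi.zero_apply, smul_zero, integral_zero, neg_zero]
    rw [integral_sub (h.1.integrable_smul_left_of_hasCompactSupport hd hdc)
      (hw.1.integrable_smul_left_of_hasCompactSupport hd hdc), h.2.2 φ hφ hφc, hw.2.2 φ hφ hφc,
      sub_self]
  refine ⟨_, hp.const_add c, ?_⟩
  filter_upwards [hc] with y hy
  rw [← hy]; abel

theorem HasWeakDeriv.isPath {V g : ℝ → X} (h : HasWeakDeriv (1 : ℝ) V g) (hV : Continuous V) :
    IsPath V g := by
  obtain ⟨V₀, h₀, he⟩ := h.exists_isPath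
  rwa [(Continuous.ae_eq_iff_eq volume hV h₀.continuous).1 he]

end Paths

section TwoWells

/-! ### Energy of paths and the structure of near-minimizers -/

/-- A continuous function going down from `ρ` to `ρ'` stays between these values on some
interval joining them. -/
theorem exists_crossing {f : ℝ → ℝ} (hf : Continuous f) {a b ρ ρ' : ℝ} (hab : a ≤ b)
    (ha : ρ ≤ f a) (hb : f b ≤ ρ') (hρ : ρ' < ρ) :
    ∃ s t, a ≤ s ∧ s ≤ t ∧ t ≤ b ∧ f s = ρ ∧ f t = ρ' ∧
      ∀ x ∈ Set.Icc s t, ρ' ≤ f x ∧ f x ≤ ρ := by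
  -- `t`: the first time below `ρ'`
  have hA : IsCompact (Set.Icc a b ∩ f ⁻¹' Set.Iic ρ') :=
    isCompact_Icc.inter_right (isClosed_Iic.preimage hf)
  obtain ⟨t, ⟨ht, htρ⟩, hmin⟩ := hA.exists_isLeast ⟨b, ⟨hab, le_rfl⟩, hb⟩
  have hB : IsCompact (Set.Icc a t ∩ f ⁻¹' Set.Ici ρ) :=
    isCompact_Icc.inter_right (isClosed_Ici.preimage hf)
  obtain ⟨s, ⟨hs, hsρ⟩, hmax⟩ := hB.exists_isGreatest ⟨a, ⟨le_rfl, ht.1⟩, ha⟩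
  simp only [Set.mem_preimage, Set.mem_Iic, Set.mem_Ici] at htρ hsρ
  have h1 : ∀ x ∈ Set.Icc s t, ρ' ≤ f x := by
    intro x hx
    by_contra hlt
    push Not at hlt
    have hxt : t ≤ x := hmin ⟨⟨hs.1.trans hx.1, hx.2.trans ht.2⟩, hlt.le⟩
    have hx' : x = t := le_antisymm hx.2 hxt
    subst hx'
    -- At the first time `t` with `f t ≤ ρ'` the value must be exactly `ρ'`: a strict inequality
    -- would produce an earlier such time.
    obtain ⟨y, hy, hy'⟩ := intermediate_value_Icc' hs.2 hf.continuousOn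
      (show ρ' ∈ Set.Icc (f x) (f s) from ⟨hlt.le, by linarith⟩)
    have : x ≤ y := hmin ⟨⟨hs.1.trans hy.1, hy.2.trans ht.2⟩, hy'.le⟩
    have : y = x := le_antisymm hy.2 this
    rw [this] at hy'; linarith
  have h2 : ∀ x ∈ Set.Icc s t, f x ≤ ρ := by
    intro x hx
    by_contra hlt
    push Not at hlt
    have hxt : x ≤ s := hmax ⟨⟨hs.1.trans hx.1, hx.2⟩, hlt.le⟩
    have hx' : x = s := le_antisymm hxt hx.1
    subst hx'
    obtain ⟨y, hy, hy'⟩ := intermediate_value_Icc' hx.2 hf.continuousOn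
      (show ρ ∈ Set.Icc (f t) (f x) from ⟨by linarith, hlt.le⟩)
    have : y ≤ x := hmax ⟨⟨hs.1.trans hy.1, hy.2⟩, hy'.ge⟩
    have : y = x := le_antisymm this hy.1
    rw [this] at hy'; linarith
  exact ⟨s, t, hs.1, hs.2, ht.2, le_antisymm (h2 s ⟨le_rfl, hs.2⟩) hsρ,
    le_antisymm htρ (h1 t ⟨hs.2, le_rfl⟩), fun x hx => ⟨h1 x hx, h2 x hx⟩⟩

variable {X : Type*} [NormedAddCommGroup X] [NormedSpace ℝ X]

/-- The energy `∫_S ½‖g‖² + P(V)` of a path `V` with derivative `g`. -/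
def pathEnergy (P : X → ℝ) (S : Set ℝ) (V g : ℝ → X) : ℝ≥0∞ :=
  ∫⁻ t in S, ENNReal.ofReal ((1 / 2) * ‖g t‖ ^ 2 + P (V t))

theorem pathEnergy_mono {P : X → ℝ} {S T : Set ℝ} (h : S ⊆ T) (V g : ℝ → X) :
    pathEnergy P S V g ≤ pathEnergy P T V g := lintegral_mono_set h

theorem pathEnergy_union {P : X → ℝ} {S T : Set ℝ} (hT : MeasurableSet T) (h : Disjoint S T)
    (V g : ℝ → X) : pathEnergy P (S ∪ T) V g = pathEnergy P S V g + pathEnergy P T V g :=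
  lintegral_union hT h

theorem pathEnergy_comp_neg (P : X → ℝ) (V g : ℝ → X) :
    pathEnergy P Set.univ (fun t => V (-t)) (fun t => -g (-t)) = pathEnergy P Set.univ V g := by
  simp only [pathEnergy, setLIntegral_univ, norm_neg]
  exact (Measure.measurePreserving_neg volume).lintegral_comp_emb
    (Homeomorph.neg ℝ).measurableEmbedding (fun t => ENNReal.ofReal ((1 / 2) * ‖g t‖ ^ 2 + P (V t)))

theorem pathEnergy_comp_add (P : X → ℝ) (V g : ℝ → X) (c : ℝ) :
    pathEnergy P Set.univ (fun t => V (t + c)) (fun t => g (t + c)) =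
      pathEnergy P Set.univ V g := by
  simp only [pathEnergy, setLIntegral_univ]
  exact lintegral_add_right_eq_self
    (fun t => ENNReal.ofReal ((1 / 2) * ‖g t‖ ^ 2 + P (V t))) c

theorem pathEnergy_congr {P : X → ℝ} {S : Set ℝ} (hS : MeasurableSet S) {V g V' g' : ℝ → X}
    (hV : ∀ t ∈ S, V t = V' t) (hg : ∀ t ∈ S, g t = g' t) :
    pathEnergy P S V g = pathEnergy P S V' g' :=
  setLIntegral_congr_fun hS fun t ht => by simp only [hV t ht, hg t ht]

/-- Lower bound of the duration by the energy. -/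
theorem duration_cost {P : X → ℝ} {V g : ℝ → X} {a b c : ℝ} (hc : 0 ≤ c)
    (h : ∀ t ∈ Set.Ioo a b, c ≤ P (V t)) :
    ENNReal.ofReal (c * (b - a)) ≤ pathEnergy P (Set.Ioo a b) V g := by
  calc ENNReal.ofReal (c * (b - a)) = ∫⁻ _ in Set.Ioo a b, ENNReal.ofReal c := by
        rw [setLIntegral_const, Real.volume_Ioo, ENNReal.ofReal_mul hc]
    _ ≤ _ := setLIntegral_mono' measurableSet_Ioo fun t ht =>
        ENNReal.ofReal_le_ofReal (by have := h t ht; nlinarith [sq_nonneg ‖g t‖])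

theorem IsPath.norm_sub_le {V g : ℝ → X} (h : IsPath V g) {a b : ℝ} (hab : a ≤ b) :
    ENNReal.ofReal ‖V b - V a‖ ≤ ∫⁻ t in Set.Ioc a b, ‖g t‖ₑ := by
  rw [h.sub_eq, intervalIntegral.integral_of_le hab, ofReal_norm]
  exact enorm_integral_le_lintegral_enorm _

/-- Lower bound of the distance travelled by the energy. -/
theorem IsPath.travel_cost {P : X → ℝ} {V g : ℝ → X} (h : IsPath V g) {a b c : ℝ} (hab : a ≤ b)
    (hc : 0 ≤ c) (hP : ∀ t ∈ Set.Icc a b, c ≤ P (V t)) :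
    ENNReal.ofReal (√(2 * c) * ‖V b - V a‖) ≤ pathEnergy P (Set.Ioc a b) V g := by
  rw [ENNReal.ofReal_mul (Real.sqrt_nonneg _)]
  calc _ ≤ ENNReal.ofReal √(2 * c) * ∫⁻ t in Set.Ioc a b, ‖g t‖ₑ := by
        gcongr; exact h.norm_sub_le hab
    _ = ∫⁻ t in Set.Ioc a b, ENNReal.ofReal √(2 * c) * ‖g t‖ₑ := by
        rw [lintegral_const_mul' _ _ ENNReal.ofReal_ne_top]
    _ ≤ _ := setLIntegral_mono' measurableSet_Ioc fun t ht => by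
        rw [← ofReal_norm, ← ENNReal.ofReal_mul (Real.sqrt_nonneg _)]
        refine ENNReal.ofReal_le_ofReal ?_
        have h1 := hP t ⟨ht.1.le, ht.2⟩
        have h2 := Real.sq_sqrt (show 0 ≤ 2 * c by linarith)
        -- Young's inequality `√(2c) ‖g‖ ≤ ½ ‖g‖² + c`.
        nlinarith [sq_nonneg (√(2 * c) - ‖g t‖)]

/-- `P ≥ 0` is a potential with two sets of wells `Fm`, `Fp`, at distance at least `D`. -/
structure TwoWell (P : X → ℝ) (Fm Fp : Set X) (D : ℝ) : Prop where
  continuous : Continuous P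
  nonneg : ∀ x, 0 ≤ P x
  pos : 0 < D
  nonempty_left : Fm.Nonempty
  nonempty_right : Fp.Nonempty
  sep : ∀ x ∈ Fm, ∀ y ∈ Fp, D ≤ dist x y
  quad : ∃ C > 0, ∃ δ > 0, ∀ e ∈ Fm ∪ Fp, ∀ x, ‖x - e‖ ≤ δ → P x ≤ C * ‖x - e‖ ^ 2
  coercive : ∀ ε > 0, ∃ c > 0, ∀ x, ε ≤ Metric.infDist x Fm → ε ≤ Metric.infDist x Fp → c ≤ P x

/-- `V` is `r`-close to `Fm` near `-∞` and to `Fp` near `+∞`. -/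
def Connects (Fm Fp : Set X) (r : ℝ) (V : ℝ → X) : Prop :=
  ∃ tm tp : ℝ, tm < tp ∧ (∀ t ≤ tm, Metric.infDist (V t) Fm ≤ r) ∧
    (∀ t ≥ tp, Metric.infDist (V t) Fp ≤ r)

theorem Connects.comp_neg {Fm Fp : Set X} {r : ℝ} {V : ℝ → X} (h : Connects Fm Fp r V) :
    Connects Fp Fm r (fun t => V (-t)) := by
  obtain ⟨tm, tp, h0, h1, h2⟩ := h
  exact ⟨-tp, -tm, by linarith, fun t ht => h2 _ (by linarith), fun t ht => h1 _ (by linarith)⟩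

namespace TwoWell

variable {P : X → ℝ} {Fm Fp : Set X} {D : ℝ}

theorem symm (h : TwoWell P Fm Fp D) : TwoWell P Fp Fm D where
  continuous := h.continuous
  nonneg := h.nonneg
  pos := h.pos
  nonempty_left := h.nonempty_right
  nonempty_right := h.nonempty_left
  sep x hx y hy := by rw [dist_comm]; exact h.sep y hy x hx
  quad := by rw [Set.union_comm]; exact h.quad
  coercive ε hε := by
    obtain ⟨c, hc, h⟩ := h.coercive ε hε
    exact ⟨c, hc, fun x h1 h2 => h x h2 h1⟩

theorem zero (h : TwoWell P Fm Fp D) {e : X} (he : e ∈ Fm ∪ Fp) : P e = 0 := by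
  obtain ⟨C, hC, δ, hδ, hq⟩ := h.quad
  have := hq e he e (by simpa using hδ.le)
  simp only [sub_self, norm_zero] at this
  exact le_antisymm (by simpa using this) (h.nonneg e)

/-- Triangle inequality through nearly closest points. Its use: being within `D / 4` of one family
of wells forces a distance at least `3D / 4` to the other, so that `coercive` applies as soon as the
first distance is bounded below. -/
theorem le_infDist_add (h : TwoWell P Fm Fp D) (x : X) :
    D ≤ Metric.infDist x Fm + Metric.infDist x Fp := by
  refine le_of_forall_pos_le_add fun ε hε => ?_
  obtain ⟨y, hy, hxy⟩ := (Metric.infDist_lt_iff h.nonempty_left).1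
    (lt_add_of_pos_right (Metric.infDist x Fm) (half_pos hε))
  obtain ⟨z, hz, hxz⟩ := (Metric.infDist_lt_iff h.nonempty_right).1
    (lt_add_of_pos_right (Metric.infDist x Fp) (half_pos hε))
  have := h.sep y hy z hz
  have := dist_triangle_left y z x
  linarith

/-- A path of finite energy that is eventually close to `Fm` comes arbitrarily close to `Fm`. -/
theorem exists_close (h : TwoWell P Fm Fp D) {V g : ℝ → X} (hE : pathEnergy P Set.univ V g ≠ ⊤)
    {tm : ℝ} (ht : ∀ t ≤ tm, Metric.infDist (V t) Fm ≤ D / 4) {ε : ℝ} (hε : 0 < ε) (T : ℝ) :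
    ∃ t ≤ T, Metric.infDist (V t) Fm < ε := by
  by_contra hcon
  push Not at hcon
  -- A path that stays `ε`-far from `Fm` but within `D / 4` of it is far from both families, so `P`
  -- is bounded below on a half-line, and the energy would be infinite.
  obtain ⟨c, hc, hco⟩ := h.coercive (min ε (D / 4)) (lt_min hε (by linarith [h.pos]))
  set b := min T tm
  have hP : ∀ t ≤ b, c ≤ P (V t) := fun t htb => by
    refine hco _ ((min_le_left _ _).trans (hcon t (htb.trans (min_le_left _ _))))
      ((min_le_right _ _).trans ?_)
    have h1 := h.le_infDist_add (V t)
    have h2 := ht t (htb.trans (min_le_right _ _))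
    linarith [h.pos]
  obtain ⟨n, hn⟩ := exists_nat_gt ((pathEnergy P Set.univ V g).toReal / c)
  have := (duration_cost (g := g) (a := b - n) (b := b) hc.le fun t ht => hP t ht.2.le).trans
    (pathEnergy_mono (Set.subset_univ _) V g)
  rw [ENNReal.ofReal_le_iff_le_toReal hE] at this
  rw [div_lt_iff₀ hc] at hn
  nlinarith

/-- Crossing from distance `ρ` to distance `ρ/2` of `Fm` costs a fixed amount of energy. -/
theorem crossing_cost (h : TwoWell P Fm Fp D) {ρ c : ℝ} (hρ : 0 < ρ) (hρD : ρ ≤ D / 4)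
    (hc : 0 < c)
    (hco : ∀ x, ρ / 2 ≤ Metric.infDist x Fm → ρ / 2 ≤ Metric.infDist x Fp → c ≤ P x)
    {V g : ℝ → X} (hV : IsPath V g) {a b : ℝ} (hab : a ≤ b) (ha : ρ ≤ Metric.infDist (V a) Fm)
    (hb : Metric.infDist (V b) Fm ≤ ρ / 2) :
    ENNReal.ofReal (√(2 * c) * (ρ / 2)) ≤ pathEnergy P (Set.Ioc a b) V g := by
  obtain ⟨s, t, has, hst, htb, h1, h2, h3⟩ := exists_crossing
    ((Metric.continuous_infDist_pt Fm).comp hV.continuous) hab ha hb (half_lt_self hρ)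
  refine le_trans ?_ ((hV.travel_cost (P := P) hst hc.le fun x hx => ?_).trans
    (pathEnergy_mono (Set.Ioc_subset_Ioc has htb) V g))
  · refine ENNReal.ofReal_le_ofReal (mul_le_mul_of_nonneg_left ?_ (Real.sqrt_nonneg _))
    have := Metric.infDist_le_infDist_add_dist (s := Fm) (x := V s) (y := V t)
    simp only [Function.comp] at h1 h2
    rw [h1, h2, dist_comm, dist_eq_norm] at this
    linarith
  · have := h3 x hx
    simp only [Function.comp] at this
    refine hco _ this.1 ?_
    have h1 := h.le_infDist_add (V x)
    linarith [h.pos]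

/-- The same as `crossing_cost`, for a path moving away from `Fm`. -/
theorem crossing_cost' (h : TwoWell P Fm Fp D) {ρ c : ℝ} (hρ : 0 < ρ) (hρD : ρ ≤ D / 4)
    (hc : 0 < c)
    (hco : ∀ x, ρ / 2 ≤ Metric.infDist x Fm → ρ / 2 ≤ Metric.infDist x Fp → c ≤ P x)
    {V g : ℝ → X} (hV : IsPath V g) {a b : ℝ} (hab : a ≤ b)
    (ha : Metric.infDist (V a) Fm ≤ ρ / 2) (hb : ρ ≤ Metric.infDist (V b) Fm) :
    ENNReal.ofReal (√(2 * c) * (ρ / 2)) ≤ pathEnergy P (Set.Ioc a b) V g := by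
  obtain ⟨s, t, has, hst, htb, h1, h2, h3⟩ := exists_crossing
    (f := fun t => Metric.infDist (V (-t)) Fm) (a := -b) (b := -a)
    ((Metric.continuous_infDist_pt Fm).comp (hV.continuous.comp continuous_neg)) (by linarith)
    (by simpa using hb) (by simpa using ha) (half_lt_self hρ)
  refine le_trans ?_ ((hV.travel_cost (P := P) (neg_le_neg hst) hc.le fun x hx => ?_).trans
    (pathEnergy_mono (Set.Ioc_subset_Ioc (by linarith) (by linarith)) V g))
  · refine ENNReal.ofReal_le_ofReal (mul_le_mul_of_nonneg_left ?_ (Real.sqrt_nonneg _))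
    have := Metric.infDist_le_infDist_add_dist (s := Fm) (x := V (-s)) (y := V (-t))
    rw [h1, h2, dist_eq_norm] at this
    linarith
  · have := h3 (-x) ⟨by linarith [hx.2], by linarith [hx.1]⟩
    rw [neg_neg] at this
    refine hco _ this.1 ?_
    have h1 := h.le_infDist_add (V x)
    linarith [h.pos]

/-- A path of finite energy converges to the wells. -/
theorem tendsto_atBot (h : TwoWell P Fm Fp D) {V g : ℝ → X} (hV : IsPath V g)
    (hE : pathEnergy P Set.univ V g ≠ ⊤) {tm : ℝ}
    (ht : ∀ t ≤ tm, Metric.infDist (V t) Fm ≤ D / 4) :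
    Tendsto (fun t => Metric.infDist (V t) Fm) atBot (𝓝 0) := by
  rw [Metric.tendsto_nhds]
  intro ε₀ hε₀
  set ε := min ε₀ (D / 4)
  have hε : 0 < ε := lt_min hε₀ (by linarith [h.pos])
  obtain ⟨c, hc, hco⟩ := h.coercive (ε / 2) (half_pos hε)
  set κ := √(2 * c) * (ε / 2)
  have hκ : 0 < κ := by positivity
  -- the energy before some time is small
  let μ : Measure ℝ := volume.withDensity fun t => ENNReal.ofReal ((1 / 2) * ‖g t‖ ^ 2 + P (V t))
  have hμ : ∀ S, MeasurableSet S → μ S = pathEnergy P S V g := fun S hS => withDensity_apply _ hS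
  have hfin : μ Set.univ ≠ ⊤ := by rwa [hμ _ MeasurableSet.univ]
  have hT : ∃ T, μ Set.univ < μ (Set.Ici T) + ENNReal.ofReal κ := by
    have h1 := (tendsto_measure_Ici_atBot μ).add_const (ENNReal.ofReal κ)
    have h2 : μ Set.univ < μ Set.univ + ENNReal.ofReal κ :=
      ENNReal.lt_add_right hfin (by simpa using hκ)
    exact (h1.eventually (lt_mem_nhds h2)).exists
  obtain ⟨T, hT⟩ := hT
  filter_upwards [Iio_mem_atBot T] with t htT
  rw [Real.dist_0_eq_abs, abs_of_nonneg Metric.infDist_nonneg]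
  by_contra hcon
  push Not at hcon
  -- If the distance is at least `ε` at `t < T`, the path has been `ε / 2`-close before, and the
  -- excursion costs `κ`, more than all the energy spent before `T`.
  obtain ⟨s, hs, hs'⟩ := h.exists_close hE ht (half_pos hε) t
  have h1 := h.crossing_cost' hε (min_le_right _ _) hc hco hV hs hs'.le
    ((min_le_left _ _).trans hcon)
  rw [← hμ _ measurableSet_Ioc] at h1
  have hdis : Disjoint (Set.Ioc s t) (Set.Ici T) :=
    Set.disjoint_left.2 fun x hx hx' => absurd hx.2 (not_le.2 (lt_of_lt_of_le htT hx'))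
  have h2 : μ (Set.Ioc s t) + μ (Set.Ici T) ≤ μ Set.univ := by
    rw [← measure_union hdis measurableSet_Ici]; exact measure_mono (Set.subset_univ _)
  have h3 : μ (Set.Ici T) + ENNReal.ofReal κ ≤ μ Set.univ := by
    rw [add_comm]; exact (add_le_add_left h1 _).trans h2
  exact absurd hT (not_lt.2 h3)

theorem tendsto_atTop (h : TwoWell P Fm Fp D) {V g : ℝ → X} (hV : IsPath V g)
    (hE : pathEnergy P Set.univ V g ≠ ⊤) {tp : ℝ}
    (ht : ∀ t ≥ tp, Metric.infDist (V t) Fp ≤ D / 4) :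
    Tendsto (fun t => Metric.infDist (V t) Fp) atTop (𝓝 0) := by
  have := h.symm.tendsto_atBot hV.comp_neg (by rwa [pathEnergy_comp_neg]) (tm := -tp)
    (fun t ht' => ht _ (by linarith))
  have := this.comp tendsto_neg_atTop_atBot
  simpa [Function.comp_def] using this

variable [CompleteSpace X]

/-- The part of a path to the left of `s` may be replaced by a segment starting at a well. -/
theorem exists_segment_left (hnn : ∀ x, 0 ≤ P x) {C δ : ℝ} {e : X}
    (hq : ∀ x, ‖x - e‖ ≤ δ → P x ≤ C * ‖x - e‖ ^ 2) {V g : ℝ → X} (hV : IsPath V g) {s : ℝ}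
    (hs : ‖V s - e‖ ≤ δ) :
    ∃ V' g', IsPath V' g' ∧ (∀ t ≥ s, V' t = V t) ∧ (∀ t ≤ s - 1, V' t = e) ∧
      pathEnergy P Set.univ V' g' ≤
        ENNReal.ofReal ((1 / 2 + C) * ‖V s - e‖ ^ 2) + pathEnergy P (Set.Ioi s) V g := by
  have hδ : 0 ≤ δ := (norm_nonneg _).trans hs
  have hPe : P e = 0 := by
    refine le_antisymm ?_ (hnn e)
    simpa using hq e (by simpa using hδ)
  -- The competitor is `V (max t s) + (max t s - max t (s - 1)) • (e - V s)`. The scalar factor is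
  -- `0` for `t ≥ s`, `1` for `t ≤ s - 1` and `s - t` in between.
  have hp := (hV.stopped s).add (((isPath_id.stopped s).sub (isPath_id.stopped (s - 1))).smul_const (e - V s))
  refine ⟨_, _, hp, fun t ht => ?_, fun t ht => ?_, ?_⟩
  · simp [max_eq_left ht, max_eq_left (show s - 1 ≤ t by linarith)]
  · simp [max_eq_right ht, max_eq_right (show t ≤ s by linarith)]
  · have hu : (Set.univ : Set ℝ) = (Set.Iic (s - 1) ∪ Set.Ioc (s - 1) s) ∪ Set.Ioi s := by
      rw [Set.Iic_union_Ioc_eq_Iic (by linarith), Set.Iic_union_Ioi]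
    have hd1 : Disjoint (Set.Iic (s - 1) ∪ Set.Ioc (s - 1) s) (Set.Ioi s) := by
      rw [Set.Iic_union_Ioc_eq_Iic (by linarith)]
      exact Set.Iic_disjoint_Ioi le_rfl
    have hd2 : Disjoint (Set.Iic (s - 1)) (Set.Ioc (s - 1) s) := Set.Iic_disjoint_Ioc le_rfl
    rw [hu, pathEnergy_union measurableSet_Ioi hd1, pathEnergy_union measurableSet_Ioc hd2]
    refine add_le_add ?_ (le_of_eq ?_)
    · have e1 : pathEnergy P (Set.Iic (s - 1)) ((fun t => V (max t s)) + fun t =>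
          ((fun t => max t s) - fun t => max t (s - 1)) t • (e - V s))
          ((Set.Ioi s).indicator g + fun t => ((Set.Ioi s).indicator (fun _ => (1 : ℝ)) -
            (Set.Ioi (s - 1)).indicator fun _ => (1 : ℝ)) t • (e - V s)) = 0 := by
        rw [pathEnergy, setLIntegral_congr_fun (g := fun _ => 0) measurableSet_Iic, lintegral_zero]
        intro t ht
        have ht' : t ≤ s := by linarith [Set.mem_Iic.1 ht]
        have i1 : t ∉ Set.Ioi s := by simpa using ht'
        have i2 : t ∉ Set.Ioi (s - 1) := by simpa using Set.mem_Iic.1 ht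
        simp [Set.indicator_of_notMem i1, Set.indicator_of_notMem i2, max_eq_right ht',
          max_eq_right (Set.mem_Iic.1 ht), hPe]
      rw [e1, zero_add]
      calc _ ≤ ∫⁻ _ in Set.Ioc (s - 1) s, ENNReal.ofReal ((1 / 2 + C) * ‖V s - e‖ ^ 2) := by
            refine setLIntegral_mono' measurableSet_Ioc fun t ht => ENNReal.ofReal_le_ofReal ?_
            have i1 : t ∉ Set.Ioi s := by simpa using ht.2
            have i2 : t ∈ Set.Ioi (s - 1) := ht.1
            simp only [Pi.add_apply, Pi.sub_apply, Set.indicator_of_notMem i1,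
              Set.indicator_of_mem i2, max_eq_right ht.2, max_eq_left ht.1.le, zero_add, zero_sub,
              neg_smul, one_smul, norm_neg]
            have hx : V s + (s - t) • (e - V s) - e = (1 - (s - t)) • (V s - e) := by
              module
            have hb : ‖V s + (s - t) • (e - V s) - e‖ ≤ ‖V s - e‖ := by
              rw [hx, norm_smul, Real.norm_eq_abs, abs_of_nonneg (by linarith [ht.1])]
              exact mul_le_of_le_one_left (norm_nonneg _) (by linarith [ht.2])
            have h1 := hq _ (hb.trans hs)
            -- No sign of `C` is assumed; if `C < 0`, the bound and `P ≥ 0` force `V s = e`.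
            have hC : C * ‖V s + (s - t) • (e - V s) - e‖ ^ 2 ≤ C * ‖V s - e‖ ^ 2 := by
              rcases le_or_gt 0 C with hC | hC
              · gcongr
              · have := (hnn (V s)).trans (hq (V s) hs)
                have h0 : ‖V s - e‖ = 0 := by
                  by_contra h0
                  have := pow_pos (lt_of_le_of_ne (norm_nonneg _) (Ne.symm h0)) 2
                  nlinarith
                rw [hx, norm_smul, h0, mul_zero]
            rw [norm_sub_rev e]
            linarith
        _ = _ := by
            rw [setLIntegral_const, Real.volume_Ioc]; simp
    · refine pathEnergy_congr measurableSet_Ioi (fun t ht => ?_) (fun t ht => ?_)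
      · have ht' : s ≤ t := (Set.mem_Ioi.1 ht).le
        simp [max_eq_left ht', max_eq_left (show s - 1 ≤ t by linarith)]
      · have i2 : t ∈ Set.Ioi (s - 1) := by simp only [Set.mem_Ioi] at ht ⊢; linarith
        simp [Set.indicator_of_mem ht, Set.indicator_of_mem i2]

end TwoWell

end TwoWells

/-! ### Near-minimizing connections stay close to the wells outside a bounded time interval. -/

section NearMinimizers

variable {X : Type*} [NormedAddCommGroup X] [NormedSpace ℝ X] [CompleteSpace X]

namespace TwoWell

variable {P : X → ℝ} {Fm Fp : Set X} {D : ℝ}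

/-- A competitor for a path that comes close to the left wells at time `s`. -/
theorem le_energy_right (h : TwoWell P Fm Fp D) {C δ : ℝ}
    (hq : ∀ e ∈ Fm ∪ Fp, ∀ x, ‖x - e‖ ≤ δ → P x ≤ C * ‖x - e‖ ^ 2) (hδ : 0 < δ) (hC : 0 < C)
    {I : ℝ≥0∞}
    (hmin : ∀ V g : ℝ → X, IsPath V g → Connects Fm Fp (D / 4) V → I ≤ pathEnergy P Set.univ V g)
    {V g : ℝ → X} (hV : IsPath V g) (hc : Connects Fm Fp (D / 4) V) {s : ℝ}
    (hs : Metric.infDist (V s) Fm < δ) :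
    I ≤ ENNReal.ofReal ((1 / 2 + C) * δ ^ 2) + pathEnergy P (Set.Ioi s) V g := by
  obtain ⟨e, he, hse⟩ := (Metric.infDist_lt_iff h.nonempty_left).1 hs
  rw [dist_eq_norm] at hse
  obtain ⟨V', g', hp, h1, h2, h3⟩ :=
    exists_segment_left h.nonneg (hq e (Or.inl he)) hV (s := s) hse.le
  obtain ⟨tm, tp, h0, hm, hp'⟩ := hc
  refine (hmin V' g' hp ⟨s - 1, max tp s, ?_, fun t ht => ?_, fun t ht => ?_⟩).trans (h3.trans ?_)
  · exact lt_of_lt_of_le (by linarith) (le_max_right _ _)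
  · rw [h2 t ht, Metric.infDist_zero_of_mem he]; linarith [h.pos]
  · rw [h1 t ((le_max_right _ _).trans ht)]
    exact hp' t ((le_max_left _ _).trans ht)
  · gcongr

/-- If the path is `δ`-close to `Fm` at time `s`, its past can be replaced by a segment of energy at
most `κ / 4`, where `κ = √(2c) ρ / 2`. With an excess of at most `κ / 2` over the infimum, the true
past costs at most `3κ / 4`. An earlier point at distance more than `ρ` would force a crossing of
cost `κ`. -/
theorem left_close (h : TwoWell P Fm Fp D) {C δ : ℝ}
    (hq : ∀ e ∈ Fm ∪ Fp, ∀ x, ‖x - e‖ ≤ δ → P x ≤ C * ‖x - e‖ ^ 2) (hδ : 0 < δ) (hC : 0 < C)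
    {I : ℝ≥0∞}
    (hmin : ∀ V g : ℝ → X, IsPath V g → Connects Fm Fp (D / 4) V → I ≤ pathEnergy P Set.univ V g)
    {ρ c : ℝ} (hρ : 0 < ρ) (hρD : ρ ≤ D / 4) (hc0 : 0 < c)
    (hco : ∀ x, ρ / 2 ≤ Metric.infDist x Fm → ρ / 2 ≤ Metric.infDist x Fp → c ≤ P x)
    (hδρ : δ ≤ ρ / 2) (hsmall : (1 / 2 + C) * δ ^ 2 ≤ √(2 * c) * (ρ / 2) / 4)
    {V g : ℝ → X} (hV : IsPath V g) (hc : Connects Fm Fp (D / 4) V) (hI : I ≠ ⊤)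
    (hE : pathEnergy P Set.univ V g ≤ I + ENNReal.ofReal (√(2 * c) * (ρ / 2) / 2)) {s : ℝ}
    (hs : Metric.infDist (V s) Fm < δ) : ∀ t ≤ s, Metric.infDist (V t) Fm ≤ ρ := by
  intro t hts
  by_contra hcon
  push Not at hcon
  have h1 := h.crossing_cost hρ hρD hc0 hco hV hts hcon.le (hs.le.trans hδρ)
  have h2 := h.le_energy_right hq hδ hC hmin hV hc hs
  have h3 : pathEnergy P (Set.Ioc t s) V g + pathEnergy P (Set.Ioi s) V g ≤
      pathEnergy P Set.univ V g := by
    rw [← pathEnergy_union measurableSet_Ioi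
      (Set.disjoint_left.2 fun x hx hx' => absurd hx.2 (not_le.2 hx'))]
    exact pathEnergy_mono (Set.subset_univ _) _ _
  set κ := √(2 * c) * (ρ / 2)
  have hκ : 0 < κ := by positivity
  have hfin : pathEnergy P (Set.Ioi s) V g ≠ ⊤ := by
    refine ne_top_of_le_ne_top (ENNReal.add_ne_top.2 ⟨hI, ENNReal.ofReal_ne_top⟩)
      ((pathEnergy_mono (Set.subset_univ _) _ _).trans hE)
  set R := pathEnergy P (Set.Ioi s) V g
  have h4 : ENNReal.ofReal κ + R ≤
      (ENNReal.ofReal (κ / 4) + R) + ENNReal.ofReal (κ / 2) := by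
    calc ENNReal.ofReal κ + R ≤ pathEnergy P (Set.Ioc t s) V g + R := by gcongr
      _ ≤ I + ENNReal.ofReal (κ / 2) := h3.trans hE
      _ ≤ _ := by
        gcongr
        exact h2.trans (by gcongr)
  have h5 : ENNReal.ofReal κ + R ≤ ENNReal.ofReal (3 * κ / 4) + R := by
    refine h4.trans (le_of_eq ?_)
    rw [add_right_comm, ← ENNReal.ofReal_add (by positivity) (by positivity)]
    congr 2; ring
  rw [ENNReal.add_le_add_iff_right hfin, ENNReal.ofReal_le_ofReal_iff (by positivity)] at h5
  linarith

/-- Structure of near-minimizers: they stay close to the wells outside of an interval of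
bounded length. -/
theorem near_minimizer (h : TwoWell P Fm Fp D) {ρ : ℝ} (hρ : 0 < ρ) (hρD : ρ ≤ D / 4)
    {I : ℝ≥0∞} (hI : I ≠ ⊤)
    (hmin : ∀ V g : ℝ → X, IsPath V g → Connects Fm Fp (D / 4) V → I ≤ pathEnergy P Set.univ V g) :
    ∃ η > 0, ∃ T : ℝ, ∀ V g : ℝ → X, IsPath V g → Connects Fm Fp (D / 4) V →
      pathEnergy P Set.univ V g ≤ I + ENNReal.ofReal η →
      ∃ s σ, s ≤ σ ∧ σ ≤ s + T ∧ (∀ t ≤ s, Metric.infDist (V t) Fm ≤ ρ) ∧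
        ∀ t ≥ σ, Metric.infDist (V t) Fp ≤ ρ := by
  obtain ⟨C, hC, δ₀, hδ₀, hq⟩ := h.quad
  obtain ⟨c, hc0, hco⟩ := h.coercive (ρ / 2) (half_pos hρ)
  set κ := √(2 * c) * (ρ / 2) with hκdef
  have hκ : 0 < κ := by positivity
  -- `δ` is small enough for the crossing from `ρ` to `ρ / 2`, for the quadratic bound, and for a
  -- segment from distance `δ` to cost at most `κ / 4`.
  set δ := min (min (ρ / 2) δ₀) √(κ / 4 / (1 / 2 + C)) with hδdef
  have hδ : 0 < δ := lt_min (lt_min (half_pos hρ) hδ₀) (Real.sqrt_pos.2 (by positivity))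
  have hδρ : δ ≤ ρ / 2 := (min_le_left _ _).trans (min_le_left _ _)
  have hsmall : (1 / 2 + C) * δ ^ 2 ≤ κ / 4 := by
    have h1 : δ ≤ √(κ / 4 / (1 / 2 + C)) := min_le_right _ _
    have h2 : δ ^ 2 ≤ κ / 4 / (1 / 2 + C) := by
      rw [← Real.sq_sqrt (show 0 ≤ κ / 4 / (1 / 2 + C) by positivity)]; gcongr
    rw [le_div_iff₀ (by positivity)] at h2
    linarith
  have hq' : ∀ e ∈ Fm ∪ Fp, ∀ x, ‖x - e‖ ≤ δ → P x ≤ C * ‖x - e‖ ^ 2 := fun e he x hx =>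
    hq e he x (hx.trans ((min_le_left _ _).trans (min_le_right _ _)))
  obtain ⟨c₂, hc₂, hco₂⟩ := h.coercive (δ / 2) (half_pos hδ)
  refine ⟨κ / 2, half_pos hκ, (I.toReal + κ / 2) / c₂, fun V g hV hc hE => ?_⟩
  have hfin : pathEnergy P Set.univ V g ≠ ⊤ :=
    ne_top_of_le_ne_top (ENNReal.add_ne_top.2 ⟨hI, ENNReal.ofReal_ne_top⟩) hE
  obtain ⟨tm, tp, h0, hm, hp⟩ := hc
  have hc : Connects Fm Fp (D / 4) V := ⟨tm, tp, h0, hm, hp⟩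
  have hfm : Continuous fun t => Metric.infDist (V t) Fm :=
    (Metric.continuous_infDist_pt Fm).comp hV.continuous
  have hfp : Continuous fun t => Metric.infDist (V t) Fp :=
    (Metric.continuous_infDist_pt Fp).comp hV.continuous
  -- last time close to the left wells
  obtain ⟨t₀, ht₀, hVt₀⟩ := h.exists_close hfin hm (half_pos hδ) tm
  have hA : IsCompact (Set.Icc t₀ tp ∩ (fun t => Metric.infDist (V t) Fm) ⁻¹' Set.Iic (δ / 2)) :=
    isCompact_Icc.inter_right (isClosed_Iic.preimage hfm)
  obtain ⟨s, ⟨hs, hsδ⟩, hmax⟩ :=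
    hA.exists_isGreatest ⟨t₀, ⟨le_rfl, by linarith⟩, hVt₀.le⟩
  simp only [Set.mem_preimage, Set.mem_Iic] at hsδ
  have hafter : ∀ t > s, δ / 2 ≤ Metric.infDist (V t) Fm := by
    intro t hst
    by_contra hcon
    push Not at hcon
    rcases le_or_gt t tp with htp | htp
    · exact absurd (hmax ⟨⟨hs.1.trans hst.le, htp⟩, hcon.le⟩) (not_le.2 hst)
    · have h1 := h.le_infDist_add (V t)
      have h2 := hp t htp.le
      linarith [h.pos]
  -- first time after `s` close to the right wells
  obtain ⟨t₁', ht₁', hVt₁'⟩ := h.symm.exists_close (V := fun t => V (-t)) (g := fun t => -g (-t))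
    (by rwa [pathEnergy_comp_neg]) (tm := -tp) (fun t ht => hp _ (by linarith)) (half_pos hδ)
    (-(max s tp))
  have hB : IsCompact (Set.Icc s (-t₁') ∩ (fun t => Metric.infDist (V t) Fp) ⁻¹' Set.Iic (δ / 2)) :=
    isCompact_Icc.inter_right (isClosed_Iic.preimage hfp)
  have hst₁ : s ≤ -t₁' := by linarith [le_max_left s tp]
  obtain ⟨σ, ⟨hσ, hσδ⟩, hmin'⟩ :=
    hB.exists_isLeast ⟨-t₁', ⟨hst₁, le_rfl⟩, hVt₁'.le⟩
  simp only [Set.mem_preimage, Set.mem_Iic] at hσδ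
  refine ⟨s, σ, hσ.1, ?_, ?_, ?_⟩
  · have h1 := (duration_cost (P := P) (g := g) (V := V) (a := s) (b := σ) hc₂.le
      fun t ht => hco₂ _ (hafter t ht.1) ?_).trans
      ((pathEnergy_mono (Set.subset_univ _) V g).trans hE)
    · rw [← ENNReal.ofReal_toReal hI, ← ENNReal.ofReal_add ENNReal.toReal_nonneg (by positivity),
        ENNReal.ofReal_le_ofReal_iff (by positivity)] at h1
      have : σ - s ≤ (I.toReal + κ / 2) / c₂ := by rw [le_div_iff₀ hc₂]; linarith
      linarith
    · by_contra hcon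
      push Not at hcon
      exact absurd (hmin' ⟨⟨ht.1.le, ht.2.le.trans hσ.2⟩, hcon.le⟩) (not_le.2 ht.2)
  · exact h.left_close hq' hδ hC hmin hρ hρD hc0 hco hδρ hsmall hV hc hI hE
      (lt_of_le_of_lt hsδ (half_lt_self hδ))
  · have hmin2 : ∀ V g : ℝ → X, IsPath V g → Connects Fp Fm (D / 4) V →
        I ≤ pathEnergy P Set.univ V g := fun V g hV hc => by
      rw [← pathEnergy_comp_neg]; exact hmin _ _ hV.comp_neg hc.comp_neg
    have := h.symm.left_close (by rwa [Set.union_comm]) hδ hC hmin2 hρ hρD hc0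
      (fun x h1 h2 => hco x h2 h1) hδρ hsmall hV.comp_neg hc.comp_neg hI
      (by rwa [pathEnergy_comp_neg]) (s := -σ)
      (by rw [neg_neg]; exact lt_of_le_of_lt hσδ (half_lt_self hδ))
    intro t ht
    simpa using this (-t) (by linarith)

end TwoWell

end NearMinimizers

section SobolevLine

/-! ### Calculus in `H¹(ℝ; ℝᵐ)` -/

/-- The Cauchy–Schwarz inequality on an interval. -/
theorem sq_intervalIntegral_le {f : ℝ → ℝ} {a b : ℝ} (hab : a ≤ b)
    (hf : IntervalIntegrable f volume a b)
    (hf2 : IntervalIntegrable (fun t => f t ^ 2) volume a b) :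
    (∫ t in a..b, f t) ^ 2 ≤ (b - a) * ∫ t in a..b, f t ^ 2 := by
  rcases hab.eq_or_lt with rfl | hlt
  · simp
  -- `A` is the mean value of `f`; the inequality is the expansion of `∫ (f - A)² ≥ 0`.
  set A := (∫ t in a..b, f t) / (b - a) with hA
  have hba : 0 < b - a := by linarith
  have h0 : 0 ≤ ∫ t in a..b, (f t - A) ^ 2 :=
    intervalIntegral.integral_nonneg hab fun t _ => sq_nonneg _
  have e : ∀ t, (f t - A) ^ 2 = f t ^ 2 - (2 * A) * f t + A ^ 2 := fun t => by ring
  simp only [e] at h0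
  rw [intervalIntegral.integral_add (hf2.sub (hf.const_mul _)) (by simp),
    intervalIntegral.integral_sub hf2 (hf.const_mul _), intervalIntegral.integral_const_mul,
    intervalIntegral.integral_const, smul_eq_mul] at h0
  have hA' : (∫ t in a..b, f t) = A * (b - a) := by rw [hA]; field_simp
  rw [hA'] at h0 ⊢
  nlinarith

theorem intervalIntegrable_of_memLp {X : Type*} [NormedAddCommGroup X] {g : ℝ → X} {a b : ℝ}
    (hg : MemLp g 2 (volume.restrict (Set.uIoc a b))) :
    IntervalIntegrable g volume a b ∧ IntervalIntegrable (fun t => ‖g t‖ ^ 2) volume a b := by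
  have : IsFiniteMeasure ((volume : Measure ℝ).restrict (Set.uIoc a b)) :=
    ⟨by rw [Measure.restrict_apply_univ]; simp [Set.uIoc]⟩
  exact ⟨intervalIntegrable_iff.2 (hg.integrable (by norm_num)),
    intervalIntegrable_iff.2 hg.integrable_norm_pow'⟩

theorem IsPath.norm_sub_sq_le {X : Type*} [NormedAddCommGroup X] [NormedSpace ℝ X] {V g : ℝ → X}
    (h : IsPath V g) {a b : ℝ} (hab : a ≤ b)
    (hg : MemLp g 2 (volume.restrict (Set.uIoc a b))) :
    ‖V b - V a‖ ^ 2 ≤ (b - a) * ∫ t in a..b, ‖g t‖ ^ 2 := by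
  obtain ⟨i1, i2⟩ := intervalIntegrable_of_memLp hg
  refine le_trans ?_ (sq_intervalIntegral_le hab i1.norm i2)
  rw [h.sub_eq]
  gcongr
  exact intervalIntegral.norm_integral_le_integral_norm hab

variable {m : ℕ}

theorem memLp_h1Fun (h : H1 m) : MemLp (h1Fun h) 2 volume := Lp.memLp _

theorem memLp_h1Der (h : H1 m) : MemLp (h1Der h) 2 volume := Lp.memLp _

theorem hasWeakDeriv_h1 (h : H1 m) : HasWeakDeriv (1 : ℝ) (h1Fun h) (h1Der h) := h.property

/-- The continuous representative of an element of `H¹(ℝ; ℝᵐ)`. -/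
def rep (h : H1 m) : ℝ → E m := (hasWeakDeriv_h1 h).exists_isPath.choose

theorem isPath_rep (h : H1 m) : IsPath (rep h) (h1Der h) :=
  (hasWeakDeriv_h1 h).exists_isPath.choose_spec.1

theorem h1Fun_ae_eq_rep (h : H1 m) : h1Fun h =ᵐ[volume] rep h :=
  (hasWeakDeriv_h1 h).exists_isPath.choose_spec.2

theorem continuous_rep (h : H1 m) : Continuous (rep h) := (isPath_rep h).continuous

theorem memLp_rep (h : H1 m) : MemLp (rep h) 2 volume :=
  (memLp_h1Fun h).ae_eq (h1Fun_ae_eq_rep h)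

theorem rep_eq_of_ae {h : H1 m} {f : ℝ → E m} (hf : Continuous f) (he : h1Fun h =ᵐ[volume] f) :
    rep h = f :=
  (Continuous.ae_eq_iff_eq volume (continuous_rep h) hf).1 ((h1Fun_ae_eq_rep h).symm.trans he)

/-- The element of `H¹(ℝ; ℝᵐ)` defined by a square integrable function with a square integrable
weak derivative. -/
def mkH1 {f g : ℝ → E m} (hf : MemLp f 2 volume) (hg : MemLp g 2 volume)
    (hw : HasWeakDeriv (1 : ℝ) f g) : H1 m :=
  ⟨WithLp.toLp 2 (hf.toLp f, hg.toLp g), hw.congr hf.coeFn_toLp.symm hg.coeFn_toLp.symm⟩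

theorem h1Fun_mkH1 {f g : ℝ → E m} (hf : MemLp f 2 volume) (hg : MemLp g 2 volume)
    (hw : HasWeakDeriv (1 : ℝ) f g) : h1Fun (mkH1 hf hg hw) =ᵐ[volume] f := hf.coeFn_toLp

theorem h1Der_mkH1 {f g : ℝ → E m} (hf : MemLp f 2 volume) (hg : MemLp g 2 volume)
    (hw : HasWeakDeriv (1 : ℝ) f g) : h1Der (mkH1 hf hg hw) =ᵐ[volume] g := hg.coeFn_toLp

theorem rep_mkH1 {f g : ℝ → E m} (hf : MemLp f 2 volume) (hg : MemLp g 2 volume)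
    (hp : IsPath f g) : rep (mkH1 hf hg hp.hasWeakDeriv) = f :=
  rep_eq_of_ae hp.continuous (h1Fun_mkH1 hf hg _)

/-- The function, as a bounded linear map. -/
def fstL (m : ℕ) : H1 m →L[ℝ] L2 m :=
  (WithLp.fstL 2 ℝ (L2 m) (L2 m)).comp (H1 m).subtypeL

/-- The derivative, as a bounded linear map. -/
def sndL (m : ℕ) : H1 m →L[ℝ] L2 m :=
  (WithLp.sndL 2 ℝ (L2 m) (L2 m)).comp (H1 m).subtypeL

theorem coe_fstL (h : H1 m) : (fstL m h : ℝ → E m) = h1Fun h := rfl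

theorem coe_sndL (h : H1 m) : (sndL m h : ℝ → E m) = h1Der h := rfl

theorem inner_eq_fstL (h k : H1 m) :
    inner ℝ h k = inner ℝ (fstL m h) (fstL m k) + inner ℝ (sndL m h) (sndL m k) := by
  rw [Submodule.coe_inner, WithLp.prod_inner_apply]
  rfl

theorem norm_sq_eq_fstL (h : H1 m) : ‖h‖ ^ 2 = ‖fstL m h‖ ^ 2 + ‖sndL m h‖ ^ 2 := by
  rw [← real_inner_self_eq_norm_sq, inner_eq_fstL, real_inner_self_eq_norm_sq,
    real_inner_self_eq_norm_sq]

theorem L2_norm_sq (f : L2 m) : ‖f‖ ^ 2 = ∫ x, ‖(f : ℝ → E m) x‖ ^ 2 := by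
  rw [← real_inner_self_eq_norm_sq, L2.inner_def]
  simp only [real_inner_self_eq_norm_sq]

theorem norm_fstL_le (h : H1 m) : ‖fstL m h‖ ≤ ‖h‖ := by
  refine abs_le_of_sq_le_sq' ?_ (norm_nonneg _) |>.2
  rw [norm_sq_eq_fstL h]; nlinarith [sq_nonneg ‖sndL m h‖]

theorem norm_sndL_le (h : H1 m) : ‖sndL m h‖ ≤ ‖h‖ := by
  refine abs_le_of_sq_le_sq' ?_ (norm_nonneg _) |>.2
  rw [norm_sq_eq_fstL h]; nlinarith [sq_nonneg ‖fstL m h‖]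

theorem integral_rep_sq (h : H1 m) : ∫ x, ‖rep h x‖ ^ 2 = ‖fstL m h‖ ^ 2 := by
  rw [L2_norm_sq]
  refine integral_congr_ae ?_
  filter_upwards [h1Fun_ae_eq_rep h] with x hx
  rw [coe_fstL, hx]

theorem integral_der_sq (h : H1 m) : ∫ x, ‖h1Der h x‖ ^ 2 = ‖sndL m h‖ ^ 2 := by
  rw [L2_norm_sq]; rfl

theorem norm_sq_eq_integral (h : H1 m) :
    ‖h‖ ^ 2 = (∫ x, ‖rep h x‖ ^ 2) + ∫ x, ‖h1Der h x‖ ^ 2 := by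
  rw [norm_sq_eq_fstL, integral_rep_sq, integral_der_sq]

theorem integrable_rep_sq (h : H1 m) : Integrable fun x => ‖rep h x‖ ^ 2 :=
  (memLp_two_iff_integrable_sq_norm (memLp_rep h).1).1 (memLp_rep h)

theorem integrable_der_sq (h : H1 m) : Integrable fun x => ‖h1Der h x‖ ^ 2 :=
  (memLp_two_iff_integrable_sq_norm (memLp_h1Der h).1).1 (memLp_h1Der h)

theorem rep_add (h k : H1 m) : rep (h + k) = rep h + rep k := by
  refine rep_eq_of_ae ((continuous_rep h).add (continuous_rep k)) ?_
  filter_upwards [Lp.coeFn_add (fstL m h) (fstL m k), h1Fun_ae_eq_rep h, h1Fun_ae_eq_rep k]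
    with x hx h1 h2
  rw [← coe_fstL, map_add, hx, Pi.add_apply, Pi.add_apply, ← h1, ← h2]; rfl

theorem rep_smul (c : ℝ) (h : H1 m) : rep (c • h) = c • rep h := by
  refine rep_eq_of_ae ((continuous_rep h).const_smul c) ?_
  filter_upwards [Lp.coeFn_smul c (fstL m h), h1Fun_ae_eq_rep h] with x hx h1
  rw [← coe_fstL, map_smul, hx, Pi.smul_apply, Pi.smul_apply, ← h1]; rfl

theorem rep_sub (h k : H1 m) : rep (h - k) = rep h - rep k := by
  rw [sub_eq_add_neg, sub_eq_add_neg, rep_add, show -k = (-1 : ℝ) • k by simp, rep_smul]; simp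

theorem h1Der_sub (h k : H1 m) : h1Der (h - k) =ᵐ[volume] h1Der h - h1Der k :=
  Lp.coeFn_sub (sndL m h) (sndL m k)

/-- The derivative of an absolutely continuous function is determined almost everywhere, so the
continuous representative determines both components. Identities in `H1 m` can then be checked
pointwise. -/
theorem ext_rep {h k : H1 m} (he : rep h = rep k) : h = k := by
  have h1 : fstL m h = fstL m k := Lp.ext (by
    rw [coe_fstL, coe_fstL]
    exact (h1Fun_ae_eq_rep h).trans ((h1Fun_ae_eq_rep k).trans (by rw [he])).symm)
  have h2 : sndL m h = sndL m k := Lp.ext (by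
    rw [coe_sndL, coe_sndL]
    exact (isPath_rep h).ae_unique (he ▸ isPath_rep k))
  have h3 : ‖h - k‖ ^ 2 = 0 := by rw [norm_sq_eq_fstL]; simp [h1, h2]
  exact sub_eq_zero.1 (norm_eq_zero.1 (pow_eq_zero_iff (two_ne_zero) |>.1 h3))

/-- Compare the value at `x` with the values at `y ∈ [x, x + 1]` by Cauchy–Schwarz and average over
`y`. Keeping the right side local yields both the embedding into bounded functions and the decay at
infinity. -/
theorem norm_rep_sq_le (h : H1 m) (x : ℝ) :
    ‖rep h x‖ ^ 2 ≤ 2 * ∫ y in x..(x + 1), (‖rep h y‖ ^ 2 + ‖h1Der h y‖ ^ 2) := by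
  have hx1 : x ≤ x + 1 := by linarith
  have i1 : IntervalIntegrable (fun y => ‖rep h y‖ ^ 2) volume x (x + 1) :=
    (integrable_rep_sq h).intervalIntegrable
  have i2 : IntervalIntegrable (fun y => ‖h1Der h y‖ ^ 2) volume x (x + 1) :=
    (integrable_der_sq h).intervalIntegrable
  set B := ∫ y in x..(x + 1), ‖h1Der h y‖ ^ 2 with hB
  have key : ∀ y ∈ Set.Icc x (x + 1), ‖rep h x‖ ^ 2 ≤ 2 * ‖rep h y‖ ^ 2 + 2 * B := by
    intro y hy
    have h1 := (isPath_rep h).norm_sub_sq_le hy.1 ((memLp_h1Der h).restrict _)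
    have h0 : 0 ≤ ∫ t in x..y, ‖h1Der h t‖ ^ 2 :=
      intervalIntegral.integral_nonneg hy.1 fun t _ => sq_nonneg _
    have h2 : ∫ t in x..y, ‖h1Der h t‖ ^ 2 ≤ B :=
      intervalIntegral.integral_mono_interval le_rfl hy.1 hy.2
        (ae_of_all _ fun t => sq_nonneg _) i2
    have h3 : ‖rep h y - rep h x‖ ^ 2 ≤ B := by nlinarith [hy.1, hy.2]
    have h4 : ‖rep h x‖ ≤ ‖rep h y‖ + ‖rep h y - rep h x‖ := by
      have := norm_sub_le (rep h y) (rep h y - rep h x)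
      simpa using this
    nlinarith [norm_nonneg (rep h x), sq_nonneg (‖rep h y‖ - ‖rep h y - rep h x‖)]
  have := intervalIntegral.integral_mono_on hx1 (f := fun _ => ‖rep h x‖ ^ 2)
    (g := fun y => 2 * ‖rep h y‖ ^ 2 + 2 * B) (by simp)
    ((i1.const_mul 2).add (by simp)) key
  rw [intervalIntegral.integral_add (i1.const_mul 2) (by simp),
    intervalIntegral.integral_const_mul] at this
  simp only [intervalIntegral.integral_const, add_sub_cancel_left, one_smul] at this
  rw [intervalIntegral.integral_add i1 i2]
  linarith

theorem norm_rep_le (h : H1 m) (x : ℝ) : ‖rep h x‖ ≤ 2 * ‖h‖ := by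
  have h1 := norm_rep_sq_le h x
  have h2 : ∫ y in x..(x + 1), (‖rep h y‖ ^ 2 + ‖h1Der h y‖ ^ 2) ≤ ‖h‖ ^ 2 := by
    rw [norm_sq_eq_integral, ← integral_add (integrable_rep_sq h) (integrable_der_sq h),
      intervalIntegral.integral_of_le (by linarith)]
    exact setIntegral_le_integral ((integrable_rep_sq h).add (integrable_der_sq h))
      (ae_of_all _ fun y => by positivity)
  refine abs_le_of_sq_le_sq' ?_ (by positivity) |>.2
  nlinarith [sq_nonneg ‖h‖]

/-- Evaluation of the continuous representative. -/
def evalL (m : ℕ) (x : ℝ) : H1 m →L[ℝ] E m :=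
  LinearMap.mkContinuous
    { toFun := fun h => rep h x
      map_add' := fun h k => by rw [rep_add]; rfl
      map_smul' := fun c h => by rw [rep_smul]; rfl } 2 fun h => norm_rep_le h x

theorem evalL_apply (x : ℝ) (h : H1 m) : evalL m x h = rep h x := rfl

/-- The bound of `norm_rep_sq_le` is an integral over `[x, x + 1]` of an integrable function, hence
a difference of two convergent primitives. -/
theorem tendsto_rep_atTop (h : H1 m) : Tendsto (rep h) atTop (𝓝 0) := by
  set f := fun y => ‖rep h y‖ ^ 2 + ‖h1Der h y‖ ^ 2
  have hf : Integrable f := (integrable_rep_sq h).add (integrable_der_sq h)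
  have h1 : Tendsto (fun x => ∫ y in (0 : ℝ)..x, f y) atTop (𝓝 (∫ y in Set.Ioi 0, f y)) :=
    intervalIntegral_tendsto_integral_Ioi 0 hf.integrableOn tendsto_id
  have h2 : Tendsto (fun x => ∫ y in (0 : ℝ)..(x + 1), f y) atTop (𝓝 (∫ y in Set.Ioi 0, f y)) :=
    h1.comp (tendsto_atTop_add_const_right _ 1 tendsto_id)
  have h3 := (h2.sub h1).const_mul 2
  rw [sub_self, mul_zero] at h3
  rw [tendsto_zero_iff_norm_tendsto_zero]
  have h4 : Tendsto (fun x => ‖rep h x‖ ^ 2) atTop (𝓝 0) := by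
    refine squeeze_zero (fun x => sq_nonneg _) (fun x => ?_) h3
    refine (norm_rep_sq_le h x).trans (le_of_eq ?_)
    rw [intervalIntegral.integral_interval_sub_left hf.intervalIntegrable hf.intervalIntegrable]
  have := h4.sqrt
  simpa using this

theorem tendsto_rep_atBot (h : H1 m) : Tendsto (rep h) atBot (𝓝 0) := by
  set f := fun y => ‖rep h y‖ ^ 2 + ‖h1Der h y‖ ^ 2
  have hf : Integrable f := (integrable_rep_sq h).add (integrable_der_sq h)
  have h1 : Tendsto (fun x => ∫ y in x..(0 : ℝ), f y) atBot (𝓝 (∫ y in Set.Iic 0, f y)) :=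
    intervalIntegral_tendsto_integral_Iic 0 hf.integrableOn tendsto_id
  have h2 : Tendsto (fun x => ∫ y in (x + 1)..(0 : ℝ), f y) atBot (𝓝 (∫ y in Set.Iic 0, f y)) :=
    h1.comp (tendsto_atBot_add_const_right _ 1 tendsto_id)
  have h3 := (h1.sub h2).const_mul 2
  rw [sub_self, mul_zero] at h3
  rw [tendsto_zero_iff_norm_tendsto_zero]
  have h4 : Tendsto (fun x => ‖rep h x‖ ^ 2) atBot (𝓝 0) := by
    refine squeeze_zero (fun x => sq_nonneg _) (fun x => ?_) h3
    refine (norm_rep_sq_le h x).trans (le_of_eq ?_)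
    rw [← intervalIntegral.integral_add_adjacent_intervals (b := x + 1) (c := 0)
      hf.intervalIntegrable hf.intervalIntegrable, add_sub_cancel_right]
  have := h4.sqrt
  simpa using this

/-! ### The affine space `e₀ + H¹(ℝ; ℝᵐ)` -/

/-- The derivative of `e₀`. -/
def e0Der (am ap : E m) : ℝ → E m :=
  (Set.Ioc (-1 : ℝ) 1).indicator fun _ => (1 / 2 : ℝ) • (ap - am)

theorem isPath_e0 (am ap : E m) : IsPath (e0 am ap) (e0Der am ap) := by
  -- `e₀(t) = a⁺ + (max t (-1) - max t 1) • ½(a⁺ - a⁻)`, which makes the path structure automatic.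
  have h := (((isPath_id.stopped (-1)).sub (isPath_id.stopped 1)).smul_const
    ((1 / 2 : ℝ) • (ap - am))).const_add ap
  convert h using 1
  · funext t
    simp only [e0, Pi.sub_apply]
    split_ifs with h1 h2
    · rw [max_eq_right h1, max_eq_right (by linarith)]; module
    · push Not at h1
      rw [max_eq_left h1.le, max_eq_right h2]; module
    · push Not at h1 h2
      rw [max_eq_left h1.le, max_eq_left h2.le]; module
  · funext t
    by_cases h1 : -1 < t <;> by_cases h2 : 1 < t <;>
      simp [e0Der, Set.indicator, h1, h2, not_le.2, not_lt.1] <;> grind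

theorem memLp_e0Der (am ap : E m) : MemLp (e0Der am ap) 2 volume :=
  memLp_indicator_const 2 measurableSet_Ioc _ (Or.inr (by simp))

theorem e0_of_le {am ap : E m} {x : ℝ} (hx : x ≤ -1) : e0 am ap x = am := by simp [e0, hx]

theorem e0_of_ge {am ap : E m} {x : ℝ} (hx : 1 < x) : e0 am ap x = ap := by
  simp [e0, not_le.2 hx, show ¬ x ≤ -1 by linarith]

theorem norm_e0_le (am ap : E m) (x : ℝ) : ‖e0 am ap x‖ ≤ ‖am‖ + ‖ap‖ := by
  rw [e0]
  split_ifs with h1 h2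
  · linarith [norm_nonneg ap]
  · push Not at h1
    have : am + ((x + 1) / 2) • (ap - am) = (1 - (x + 1) / 2) • am + ((x + 1) / 2) • ap := by module
    rw [this]
    refine (norm_add_le _ _).trans ?_
    rw [norm_smul, norm_smul, Real.norm_eq_abs, Real.norm_eq_abs, abs_of_nonneg (by linarith),
      abs_of_nonneg (by linarith)]
    nlinarith [norm_nonneg am, norm_nonneg ap]
  · linarith [norm_nonneg am]

/-- The continuous representative of `e₀ + h`. -/
def urep (am ap : E m) (h : H1 m) (x : ℝ) : E m := e0 am ap x + rep h x

/-- The derivative of `e₀ + h`. -/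
def uder (am ap : E m) (h : H1 m) (x : ℝ) : E m := e0Der am ap x + h1Der h x

theorem isPath_urep (am ap : E m) (h : H1 m) : IsPath (urep am ap h) (uder am ap h) :=
  (isPath_e0 am ap).add (isPath_rep h)

theorem continuous_urep (am ap : E m) (h : H1 m) : Continuous (urep am ap h) :=
  (isPath_urep am ap h).continuous

theorem affineMap_ae_eq (am ap : E m) (h : H1 m) : affineMap am ap h =ᵐ[volume] urep am ap h := by
  filter_upwards [h1Fun_ae_eq_rep h] with x hx
  rw [affineMap, urep, hx]

theorem weakDeriv_affineMap (am ap : E m) (h : H1 m) :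
    weakDeriv (1 : ℝ) (affineMap am ap h) =ᵐ[volume] uder am ap h := by
  rw [weakDeriv_congr (affineMap_ae_eq am ap h)]
  exact (isPath_urep am ap h).hasWeakDeriv.weakDeriv_ae_eq

theorem memLp_uder (am ap : E m) (h : H1 m) : MemLp (uder am ap h) 2 volume :=
  (memLp_e0Der am ap).add (memLp_h1Der h)

theorem tendsto_urep_atTop (am ap : E m) (h : H1 m) : Tendsto (urep am ap h) atTop (𝓝 ap) := by
  have h1 : Tendsto (e0 am ap) atTop (𝓝 ap) :=
    tendsto_const_nhds.congr' (by filter_upwards [eventually_gt_atTop 1] with x hx; rw [e0_of_ge hx])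
  have := h1.add (tendsto_rep_atTop h)
  rwa [add_zero] at this

theorem tendsto_urep_atBot (am ap : E m) (h : H1 m) : Tendsto (urep am ap h) atBot (𝓝 am) := by
  have h1 : Tendsto (e0 am ap) atBot (𝓝 am) :=
    tendsto_const_nhds.congr' (by filter_upwards [eventually_le_atBot (-1)] with x hx; rw [e0_of_le hx])
  have := h1.add (tendsto_rep_atBot h)
  rwa [add_zero] at this

theorem norm_urep_le (am ap : E m) (h : H1 m) (x : ℝ) :
    ‖urep am ap h x‖ ≤ ‖am‖ + ‖ap‖ + 2 * ‖h‖ :=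
  (norm_add_le _ _).trans (add_le_add (norm_e0_le am ap x) (norm_rep_le h x))

theorem memL2loc_of_memLp {X : Type*} [NormedAddCommGroup X] {f : ℝ → X} (h : MemLp f 2 volume) :
    MemL2loc f := fun _ _ => h.restrict _

theorem memL2loc_of_continuous {Y X : Type*} [TopologicalSpace Y] [T2Space Y] [MeasureSpace Y]
    [OpensMeasurableSpace Y]  [TopologicalSpace.PseudoMetrizableSpace Y]
    [IsFiniteMeasureOnCompacts (volume : Measure Y)]
    [NormedAddCommGroup X] {f : Y → X} (h : Continuous f) : MemL2loc f := fun K hK => by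
  have : IsFiniteMeasure ((volume : Measure Y).restrict K) :=
    ⟨by rw [Measure.restrict_apply_univ]; exact hK.measure_lt_top⟩
  obtain ⟨C, hC⟩ := hK.exists_bound_of_continuousOn h.continuousOn
  refine MemLp.of_bound ?_ C ((ae_restrict_iff' hK.measurableSet).2 (ae_of_all _ hC))
  exact h.continuousOn.aestronglyMeasurable_of_isCompact hK hK.measurableSet

theorem urep_mem_connectingClass (am ap : E m) (h : H1 m) :
    urep am ap h ∈ connectingClass am ap :=
  ⟨continuous_urep am ap h, ⟨memL2loc_of_continuous (continuous_urep am ap h), _,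
    (isPath_urep am ap h).hasWeakDeriv, memL2loc_of_memLp (memLp_uder am ap h)⟩,
    tendsto_urep_atBot am ap h, tendsto_urep_atTop am ap h⟩

theorem action_affineMap (W : E m → ℝ) (am ap : E m) (h : H1 m) :
    action W (affineMap am ap h) =
      ∫⁻ x, ENNReal.ofReal ((1 / 2) * ‖uder am ap h x‖ ^ 2 + W (urep am ap h x)) := by
  refine lintegral_congr_ae ?_
  filter_upwards [weakDeriv_affineMap am ap h, affineMap_ae_eq am ap h] with x h1 h2
  rw [h1, h2]

theorem action_urep (W : E m → ℝ) (am ap : E m) (h : H1 m) :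
    action W (urep am ap h) = action W (affineMap am ap h) := by
  rw [action_affineMap]
  refine lintegral_congr_ae ?_
  filter_upwards [(isPath_urep am ap h).hasWeakDeriv.weakDeriv_ae_eq] with x h1
  rw [h1]

theorem minAction_le (W : E m → ℝ) (am ap : E m) (h : H1 m) :
    minAction W am ap ≤ action W (affineMap am ap h) := by
  rw [← action_urep]
  exact iInf₂_le _ (urep_mem_connectingClass am ap h)

end SobolevLine

section Potential

/-! ### The effective potential -/

variable {m : ℕ} {α : ℝ} {W : E m → ℝ} {am ap : E m}

namespace IsDoubleWell

theorem differentiable (hW : IsDoubleWell α W am ap) : Differentiable ℝ W :=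
  hW.contDiff.differentiable (by norm_num)

theorem continuous (hW : IsDoubleWell α W am ap) : Continuous W := hW.contDiff.continuous

theorem contDiff_gradient (hW : IsDoubleWell α W am ap) : ContDiff ℝ 1 (gradient W) := by
  have h1 : ContDiff ℝ 1 (fderiv ℝ W) := hW.contDiff.fderiv_right (by norm_num)
  exact (InnerProductSpace.toDual ℝ (E m)).symm.contDiff.comp h1

theorem continuous_gradient (hW : IsDoubleWell α W am ap) : Continuous (gradient W) :=
  hW.contDiff_gradient.continuous

theorem gradient_eq_zero (hW : IsDoubleWell α W am ap) {a : E m} (ha : W a = 0) :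
    gradient W a = 0 := by
  have : IsLocalMin W a := Filter.Eventually.of_forall fun u => by rw [ha]; exact hW.nonneg u
  rw [gradient, this.fderiv_eq_zero, map_zero]

/-- Lipschitz and Taylor estimates on balls. -/
theorem exists_taylor (hW : IsDoubleWell α W am ap) (R : ℝ) :
    ∃ L > 0, ∀ u v : E m, ‖u‖ ≤ R → ‖v‖ ≤ R → ‖gradient W v - gradient W u‖ ≤ L * ‖v - u‖ ∧
      |W v - W u - inner ℝ (gradient W u) (v - u)| ≤ L * ‖v - u‖ ^ 2 := by
  obtain ⟨K, hK⟩ := hW.contDiff_gradient.contDiffOn.exists_lipschitzOnWith (by decide)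
    (convex_closedBall (0 : E m) R) (isCompact_closedBall _ _)
  refine ⟨K + 1, by positivity, fun u v hu hv => ?_⟩
  have hu' : u ∈ Metric.closedBall (0 : E m) R := by simpa using hu
  have hv' : v ∈ Metric.closedBall (0 : E m) R := by simpa using hv
  have hlip : ∀ w ∈ Metric.closedBall (0 : E m) R,
      ‖gradient W w - gradient W u‖ ≤ (K + 1) * ‖w - u‖ := fun w hw => by
    have := hK.dist_le_mul _ hw _ hu'
    rw [dist_eq_norm, dist_eq_norm] at this
    nlinarith [norm_nonneg (w - u)]
  refine ⟨hlip v hv', ?_⟩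
  have hs : segment ℝ u v ⊆ Metric.closedBall (0 : E m) R :=
    (convex_closedBall _ _).segment_subset hu' hv'
  have key := (convex_segment u v).norm_image_sub_le_of_norm_fderiv_le'
    (f := W) (φ := fderiv ℝ W u) (C := (K + 1) * ‖v - u‖) (fun x _ => hW.differentiable x)
    (fun w hw => by
      have h1 : ‖fderiv ℝ W w - fderiv ℝ W u‖ = ‖gradient W w - gradient W u‖ := by
        rw [← toDual_gradient, ← toDual_gradient, ← map_sub, LinearIsometryEquiv.norm_map]
      rw [h1]
      refine (hlip w (hs hw)).trans ?_
      gcongr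
      exact norm_sub_le_of_mem_segment hw) (left_mem_segment ℝ u v) (right_mem_segment ℝ u v)
  rw [inner_gradient_left]
  rw [Real.norm_eq_abs] at key
  nlinarith

/-- Pointwise bounds along `e₀ + h`. -/
theorem exists_bound (hW : IsDoubleWell α W am ap) (R : ℝ) :
    ∃ L > 0, ∀ (x : ℝ) (v : E m), ‖e0 am ap x + v‖ ≤ R →
      ‖gradient W (e0 am ap x + v)‖ ≤ (Set.Icc (-1 : ℝ) 1).indicator (fun _ => L) x + L * ‖v‖ ∧
      W (e0 am ap x + v) ≤ (Set.Icc (-1 : ℝ) 1).indicator (fun _ => L) x + L * ‖v‖ ^ 2 := by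
  obtain ⟨L, hL, hT⟩ := hW.exists_taylor (max R (‖am‖ + ‖ap‖))
  obtain ⟨M, hM⟩ := (isCompact_closedBall (0 : E m) R).exists_bound_of_continuousOn
    hW.continuous.continuousOn
  obtain ⟨M', hM'⟩ := (isCompact_closedBall (0 : E m) R).exists_bound_of_continuousOn
    hW.continuous_gradient.continuousOn
  refine ⟨max L (max M M'), lt_max_of_lt_left hL, fun x v hv => ?_⟩
  set L' := max L (max M M')
  have hLL : L ≤ L' := le_max_left _ _
  have hL' : 0 < L' := hL.trans_le hLL
  have hmem : e0 am ap x + v ∈ Metric.closedBall (0 : E m) R := by simpa using hv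
  by_cases hx : x ∈ Set.Icc (-1 : ℝ) 1
  · rw [Set.indicator_of_mem hx]
    have h1 := hM _ hmem
    have h2 := hM' _ hmem
    have h3 : M ≤ L' := (le_max_left _ _).trans (le_max_right _ _)
    have h4 : M' ≤ L' := (le_max_right _ _).trans (le_max_right _ _)
    have h5 := le_abs_self (W (e0 am ap x + v))
    rw [Real.norm_eq_abs] at h1
    have h6 : 0 ≤ L' * ‖v‖ := by positivity
    have h7 : 0 ≤ L' * ‖v‖ ^ 2 := by positivity
    exact ⟨by linarith, by linarith⟩
  -- Outside `[-1, 1]` the value of `e₀` is a well, where `W` and `∇W` vanish; the Taylor estimate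
  -- there has no constant term, whence integrability on the whole line.
  · rw [Set.indicator_of_notMem hx, zero_add, zero_add]
    have ha : W (e0 am ap x) = 0 := by
      rw [hW.zero_iff]
      rw [Set.mem_Icc, not_and_or, not_le, not_le] at hx
      rcases hx with hx | hx
      · exact Or.inl (e0_of_le hx.le)
      · exact Or.inr (e0_of_ge hx)
    have := hT (e0 am ap x) (e0 am ap x + v) ((norm_e0_le _ _ _).trans (le_max_right _ _))
      (hv.trans (le_max_left _ _))
    rw [hW.gradient_eq_zero ha, ha, add_sub_cancel_left, inner_zero_left, sub_zero, sub_zero,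
      sub_zero] at this
    refine ⟨this.1.trans (by gcongr), (le_abs_self _).trans (this.2.trans (by gcongr))⟩

theorem memLp_gradient (hW : IsDoubleWell α W am ap) (h : H1 m) : MemLp (fun x => gradient W (urep am ap h x)) 2 volume := by
  obtain ⟨L, hL, hb⟩ := hW.exists_bound (‖am‖ + ‖ap‖ + 2 * ‖h‖)
  have h1 : MemLp ((Set.Icc (-1 : ℝ) 1).indicator (fun _ => L)) 2 volume :=
    memLp_indicator_const 2 measurableSet_Icc _ (Or.inr (by simp))
  have h2 : MemLp (fun x => L * ‖rep h x‖) 2 volume := (memLp_rep h).norm.const_mul L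
  refine (h1.add h2).mono' (hW.continuous_gradient.comp (continuous_urep am ap h)).aestronglyMeasurable
    (ae_of_all _ fun x => (hb x (rep h x) (norm_urep_le am ap h x)).1)

theorem integrable_potential (hW : IsDoubleWell α W am ap) (h : H1 m) : Integrable fun x => W (urep am ap h x) := by
  obtain ⟨L, hL, hb⟩ := hW.exists_bound (‖am‖ + ‖ap‖ + 2 * ‖h‖)
  have h1 : Integrable ((Set.Icc (-1 : ℝ) 1).indicator (fun _ => L)) :=
    (integrable_indicator_iff measurableSet_Icc).2 (by simp)
  have h2 : Integrable fun x => L * ‖rep h x‖ ^ 2 := (integrable_rep_sq h).const_mul L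
  refine (h1.add h2).mono' (hW.continuous.comp (continuous_urep am ap h)).aestronglyMeasurable
    (ae_of_all _ fun x => ?_)
  rw [Real.norm_eq_abs, abs_of_nonneg (hW.nonneg _)]
  exact (hb x (rep h x) (norm_urep_le am ap h x)).2

end IsDoubleWell

/-- The derivative of `e₀ + h` as an element of `L²`. -/
def uderL (am ap : E m) (h : H1 m) : L2 m := (memLp_e0Der am ap).toLp + sndL m h

theorem coe_uderL (am ap : E m) (h : H1 m) : (uderL am ap h : ℝ → E m) =ᵐ[volume] uder am ap h := by
  filter_upwards [Lp.coeFn_add ((memLp_e0Der am ap).toLp) (sndL m h), (memLp_e0Der am ap).coeFn_toLp]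
    with x h1 h2
  rw [uderL, h1, Pi.add_apply, h2]; rfl

theorem integral_uder_sq (am ap : E m) (h : H1 m) :
    ∫ x, ‖uder am ap h x‖ ^ 2 = ‖uderL am ap h‖ ^ 2 := by
  rw [L2_norm_sq]
  refine integral_congr_ae ?_
  filter_upwards [coe_uderL am ap h] with x hx
  rw [hx]

theorem integrable_uder_sq (am ap : E m) (h : H1 m) : Integrable fun x => ‖uder am ap h x‖ ^ 2 :=
  (memLp_two_iff_integrable_sq_norm (memLp_uder am ap h).1).1 (memLp_uder am ap h)

/-- The action of `e₀ + h`, as a real number. -/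
def realAction (W : E m → ℝ) (am ap : E m) (h : H1 m) : ℝ :=
  (1 / 2) * ‖uderL am ap h‖ ^ 2 + ∫ x, W (urep am ap h x)

namespace IsDoubleWell

theorem integrable_density (hW : IsDoubleWell α W am ap) (h : H1 m) :
    Integrable fun x => (1 / 2) * ‖uder am ap h x‖ ^ 2 + W (urep am ap h x) :=
  ((integrable_uder_sq am ap h).const_mul _).add (hW.integrable_potential h)

theorem integral_density (hW : IsDoubleWell α W am ap) (h : H1 m) :
    ∫ x, ((1 / 2) * ‖uder am ap h x‖ ^ 2 + W (urep am ap h x)) = realAction W am ap h := by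
  rw [integral_add ((integrable_uder_sq am ap h).const_mul _) (hW.integrable_potential h),
    integral_const_mul, integral_uder_sq, realAction]

theorem action_eq (hW : IsDoubleWell α W am ap) (h : H1 m) :
    action W (affineMap am ap h) = ENNReal.ofReal (realAction W am ap h) := by
  rw [action_affineMap, ← hW.integral_density, ofReal_integral_eq_lintegral_ofReal
    (hW.integrable_density h) (ae_of_all _ fun x => by have := hW.nonneg (urep am ap h x); positivity)]

theorem realAction_nonneg (hW : IsDoubleWell α W am ap) (h : H1 m) : 0 ≤ realAction W am ap h := by
  have : 0 ≤ ∫ x, W (urep am ap h x) := integral_nonneg fun x => hW.nonneg _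
  rw [realAction]; positivity

theorem action_ne_top (hW : IsDoubleWell α W am ap) (h : H1 m) : action W (affineMap am ap h) ≠ ⊤ := by
  rw [hW.action_eq]; exact ENNReal.ofReal_ne_top

theorem minAction_ne_top (hW : IsDoubleWell α W am ap) : minAction W am ap ≠ ⊤ :=
  ne_top_of_le_ne_top (hW.action_ne_top 0) (minAction_le W am ap 0)

theorem effPot_ne_top (hW : IsDoubleWell α W am ap) (h : H1 m) : effPot W am ap h ≠ ⊤ :=
  ne_top_of_le_ne_top (hW.action_ne_top h) tsub_le_self

theorem toReal_effPot (hW : IsDoubleWell α W am ap) (h : H1 m) :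
    (effPot W am ap h).toReal = realAction W am ap h - (minAction W am ap).toReal := by
  rw [effPot, ENNReal.toReal_sub_of_le (minAction_le W am ap h) (hW.action_ne_top h), hW.action_eq,
    ENNReal.toReal_ofReal (hW.realAction_nonneg h)]

/-- `∇W(e₀ + h)` as an element of `L²`. -/
def gradL (hW : IsDoubleWell α W am ap) (h : H1 m) : L2 m := (hW.memLp_gradient h).toLp

theorem coe_gradL (hW : IsDoubleWell α W am ap) (h : H1 m) :
    (hW.gradL h : ℝ → E m) =ᵐ[volume] fun x => gradient W (urep am ap h x) :=
  (hW.memLp_gradient h).coeFn_toLp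

theorem inner_gradL (hW : IsDoubleWell α W am ap) (h k : H1 m) :
    inner ℝ (hW.gradL h) (fstL m k) = ∫ x, inner ℝ (gradient W (urep am ap h x)) (rep k x) := by
  rw [L2.inner_def]
  refine integral_congr_ae ?_
  filter_upwards [hW.coe_gradL h, h1Fun_ae_eq_rep k] with x h1 h2
  rw [h1, coe_fstL, h2]

theorem integrable_inner_gradient (hW : IsDoubleWell α W am ap) (h k : H1 m) :
    Integrable fun x => inner ℝ (gradient W (urep am ap h x)) (rep k x) := by
  refine (L2.integrable_inner (𝕜 := ℝ) (hW.gradL h) (fstL m k)).congr ?_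
  filter_upwards [hW.coe_gradL h, h1Fun_ae_eq_rep k] with x h1 h2
  rw [h1, coe_fstL, h2]

/-- Taylor estimates for the Nemytskii operators. -/
theorem exists_taylor_integral (hW : IsDoubleWell α W am ap) (R : ℝ) :
    ∃ L > 0, ∀ h k : H1 m, (∀ x, ‖urep am ap h x‖ ≤ R) → (∀ x, ‖urep am ap k x‖ ≤ R) →
      ‖hW.gradL k - hW.gradL h‖ ≤ L * ‖k - h‖ ∧
      |(∫ x, W (urep am ap k x)) - (∫ x, W (urep am ap h x)) -
        inner ℝ (hW.gradL h) (fstL m (k - h))| ≤ L * ‖k - h‖ ^ 2 := by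
  obtain ⟨L, hL, hT⟩ := hW.exists_taylor R
  refine ⟨L, hL, fun h k hh hk => ?_⟩
  have hd : ∀ x, urep am ap k x - urep am ap h x = rep (k - h) x := fun x => by
    rw [rep_sub, urep, urep]; simp
  constructor
  · have h1 : ‖hW.gradL k - hW.gradL h‖ ^ 2 ≤ L ^ 2 * ‖fstL m (k - h)‖ ^ 2 := by
      rw [← integral_rep_sq, L2_norm_sq, ← integral_const_mul]
      refine integral_mono_of_nonneg (ae_of_all _ fun x => sq_nonneg _)
        ((integrable_rep_sq _).const_mul _) ?_
      filter_upwards [Lp.coeFn_sub (hW.gradL k) (hW.gradL h), hW.coe_gradL h, hW.coe_gradL k]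
        with x h1 h2 h3
      rw [h1, Pi.sub_apply, h2, h3, ← mul_pow, ← hd]
      exact pow_le_pow_left₀ (norm_nonneg _) (hT _ _ (hh x) (hk x)).1 2
    have h2 : ‖hW.gradL k - hW.gradL h‖ ≤ L * ‖fstL m (k - h)‖ := by
      rw [← mul_pow] at h1
      exact (abs_le_of_sq_le_sq' h1 (by positivity)).2
    exact h2.trans (mul_le_mul_of_nonneg_left (norm_fstL_le _) hL.le)
  · have i1 : Integrable fun x => W (urep am ap k x) - W (urep am ap h x) :=
      (hW.integrable_potential k).sub (hW.integrable_potential h)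
    have i2 := hW.integrable_inner_gradient h (k - h)
    have e : (∫ x, W (urep am ap k x)) - (∫ x, W (urep am ap h x)) -
        inner ℝ (hW.gradL h) (fstL m (k - h)) = ∫ x, (W (urep am ap k x) - W (urep am ap h x) -
          inner ℝ (gradient W (urep am ap h x)) (rep (k - h) x)) := by
      rw [integral_sub i1 i2, integral_sub (hW.integrable_potential k) (hW.integrable_potential h),
        hW.inner_gradL]
    rw [e, ← Real.norm_eq_abs]
    refine (norm_integral_le_integral_norm _).trans ?_
    calc _ ≤ ∫ x, L * ‖rep (k - h) x‖ ^ 2 := by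
          refine integral_mono_of_nonneg (ae_of_all _ fun x => norm_nonneg _)
            ((integrable_rep_sq _).const_mul _) (ae_of_all _ fun x => ?_)
          have := (hT _ _ (hh x) (hk x)).2
          rw [hd] at this
          exact this
      _ = L * ‖fstL m (k - h)‖ ^ 2 := by rw [integral_const_mul, integral_rep_sq]
      _ ≤ _ := by gcongr; exact norm_fstL_le _

/-- The differential of the action. -/
def dAction (hW : IsDoubleWell α W am ap) (h : H1 m) : H1 m →L[ℝ] ℝ :=
  (innerSL ℝ (uderL am ap h)).comp (sndL m) + (innerSL ℝ (hW.gradL h)).comp (fstL m)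

theorem dAction_apply (hW : IsDoubleWell α W am ap) (h k : H1 m) :
    hW.dAction h k = inner ℝ (uderL am ap h) (sndL m k) + inner ℝ (hW.gradL h) (fstL m k) := rfl

/-- The derivative enters the action quadratically, hence its expansion is exact, and only the
potential term needs an estimate. The constant depends on a sup bound and not on the `H¹` norm:
minimal heteroclinics share a sup bound, but their translates are unbounded in `H1 m`. -/
theorem exists_taylor_action (hW : IsDoubleWell α W am ap) (R : ℝ) :
    ∃ C > 0, ∀ h k : H1 m, (∀ x, ‖urep am ap h x‖ ≤ R) → (∀ x, ‖urep am ap k x‖ ≤ R) →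
      |realAction W am ap k - realAction W am ap h - hW.dAction h (k - h)| ≤ C * ‖k - h‖ ^ 2 := by
  obtain ⟨L, hL, hT⟩ := hW.exists_taylor_integral R
  refine ⟨1 / 2 + L, by positivity, fun h k hh hk => ?_⟩
  have h1 := (hT h k hh hk).2
  have h2 : uderL am ap k = uderL am ap h + sndL m (k - h) := by
    rw [uderL, uderL, map_sub]; abel
  have h3 : ‖uderL am ap k‖ ^ 2 = ‖uderL am ap h‖ ^ 2 +
      2 * inner ℝ (uderL am ap h) (sndL m (k - h)) + ‖sndL m (k - h)‖ ^ 2 := by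
    rw [h2, norm_add_sq_real]
  have h4 : ‖sndL m (k - h)‖ ^ 2 ≤ ‖k - h‖ ^ 2 := by gcongr; exact norm_sndL_le _
  rw [hW.dAction_apply, realAction, realAction, h3]
  rw [abs_le] at h1 ⊢
  constructor <;> nlinarith [sq_nonneg ‖sndL m (k - h)‖]

theorem hasFDerivAt_realAction (hW : IsDoubleWell α W am ap) (h : H1 m) :
    HasFDerivAt (realAction W am ap) (hW.dAction h) h := by
  obtain ⟨C, hC, hT⟩ := hW.exists_taylor_action (‖am‖ + ‖ap‖ + 2 * (‖h‖ + 1))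
  refine HasFDerivAt.of_isLittleO ?_
  have hO : (fun k => realAction W am ap k - realAction W am ap h - hW.dAction h (k - h)) =O[𝓝 h]
      fun k => ‖k - h‖ ^ 2 := by
    refine Asymptotics.IsBigO.of_bound C ?_
    filter_upwards [Metric.ball_mem_nhds h one_pos] with k hk
    rw [mem_ball_iff_norm] at hk
    have hk' : ‖k‖ ≤ ‖h‖ + 1 := by
      have := norm_le_norm_add_norm_sub' k h; linarith
    rw [norm_pow, norm_norm]
    exact hT h k (fun x => (norm_urep_le am ap h x).trans (by linarith))
      (fun x => (norm_urep_le am ap k x).trans (by linarith))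
  refine hO.trans_isLittleO ?_
  have : (fun k : H1 m => ‖k - h‖ ^ 2) =o[𝓝 h] fun k => ‖k - h‖ ^ 1 := by
    refine (Asymptotics.isLittleO_pow_pow one_lt_two).comp_tendsto ?_
    have : Tendsto (fun k => ‖k - h‖) (𝓝 h) (𝓝 ‖h - h‖) := by
      exact (continuous_id.sub continuous_const).norm.tendsto h
    simpa using this
  simp only [pow_one] at this
  exact this.of_norm_right

theorem continuous_dAction (hW : IsDoubleWell α W am ap) : Continuous hW.dAction := by
  have h1 : Continuous (uderL am ap) := continuous_const.add (sndL m).continuous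
  have h2 : Continuous hW.gradL := by
    rw [continuous_iff_continuousAt]
    intro h
    obtain ⟨L, hL, hT⟩ := hW.exists_taylor_integral (‖am‖ + ‖ap‖ + 2 * (‖h‖ + 1))
    rw [ContinuousAt, tendsto_iff_norm_sub_tendsto_zero]
    have h0 : Tendsto (fun k => L * ‖k - h‖) (𝓝 h) (𝓝 0) := by
      have : Tendsto (fun k => L * ‖k - h‖) (𝓝 h) (𝓝 (L * ‖h - h‖)) :=
        ((continuous_id.sub continuous_const).norm.const_mul L).tendsto h
      simpa using this
    refine squeeze_zero' (Eventually.of_forall fun k => norm_nonneg _) ?_ h0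
    filter_upwards [Metric.ball_mem_nhds h one_pos] with k hk
    rw [mem_ball_iff_norm] at hk
    have hk' : ‖k‖ ≤ ‖h‖ + 1 := by
      have := norm_le_norm_add_norm_sub' k h; linarith
    exact (hT h k (fun x => (norm_urep_le am ap h x).trans (by linarith))
      (fun x => (norm_urep_le am ap k x).trans (by linarith))).1
  exact (((innerSL ℝ).continuous.comp h1).clm_comp continuous_const).add
    (((innerSL ℝ).continuous.comp h2).clm_comp continuous_const)

theorem contDiff_realAction (hW : IsDoubleWell α W am ap) : ContDiff ℝ 1 (realAction W am ap) := by
  rw [contDiff_one_iff_fderiv]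
  refine ⟨fun h => (hW.hasFDerivAt_realAction h).differentiableAt, ?_⟩
  have : fderiv ℝ (realAction W am ap) = hW.dAction :=
    funext fun h => (hW.hasFDerivAt_realAction h).fderiv
  rw [this]
  exact hW.continuous_dAction

end IsDoubleWell

/-- The effective potential as a real function. -/
def realPot (W : E m → ℝ) (am ap : E m) (h : H1 m) : ℝ := (effPot W am ap h).toReal

theorem realPot_nonneg (h : H1 m) : 0 ≤ realPot W am ap h := ENNReal.toReal_nonneg

namespace IsDoubleWell

theorem ofReal_realPot (hW : IsDoubleWell α W am ap) (h : H1 m) : ENNReal.ofReal (realPot W am ap h) = effPot W am ap h :=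
  ENNReal.ofReal_toReal (hW.effPot_ne_top h)

theorem realPot_eq (hW : IsDoubleWell α W am ap) :
    realPot W am ap = fun h => realAction W am ap h - (minAction W am ap).toReal :=
  funext hW.toReal_effPot

theorem hasFDerivAt_realPot (hW : IsDoubleWell α W am ap) (h : H1 m) : HasFDerivAt (realPot W am ap) (hW.dAction h) h := by
  rw [hW.realPot_eq]
  exact (hW.hasFDerivAt_realAction h).sub_const _

theorem contDiff_realPot (hW : IsDoubleWell α W am ap) : ContDiff ℝ 1 (realPot W am ap) := by
  rw [hW.realPot_eq]
  exact hW.contDiff_realAction.sub contDiff_const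

/-- A zero of the nonnegative effective potential is a global minimum. -/
theorem dAction_eq_zero (hW : IsDoubleWell α W am ap) {h : H1 m} (h0 : realPot W am ap h = 0) : hW.dAction h = 0 := by
  have : IsLocalMin (realPot W am ap) h :=
    Filter.Eventually.of_forall fun u => by rw [h0]; exact realPot_nonneg u
  rw [← (hW.hasFDerivAt_realPot h).fderiv, this.fderiv_eq_zero]

/-- Quadratic bound of the effective potential near its zeros. -/
theorem exists_realPot_le (hW : IsDoubleWell α W am ap) (R : ℝ) :
    ∃ C > 0, ∀ e h : H1 m, realPot W am ap e = 0 → (∀ x, ‖urep am ap e x‖ ≤ R) → ‖h - e‖ ≤ 1 →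
      realPot W am ap h ≤ C * ‖h - e‖ ^ 2 := by
  obtain ⟨C, hC, hT⟩ := hW.exists_taylor_action (R + 2)
  refine ⟨C, hC, fun e h he hR hh => ?_⟩
  have hk : ∀ x, ‖urep am ap h x‖ ≤ R + 2 := fun x => by
    have h1 : urep am ap h x = urep am ap e x + rep (h - e) x := by rw [rep_sub, urep, urep]; simp
    rw [h1]
    refine (norm_add_le _ _).trans (add_le_add (hR x) ((norm_rep_le _ x).trans (by linarith)))
  have := hT e h (fun x => (hR x).trans (by linarith)) hk
  rw [hW.dAction_eq_zero he, zero_apply, sub_zero] at this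
  rw [hW.realPot_eq] at he ⊢
  have := (le_abs_self _).trans this
  simp only at he ⊢
  linarith

end IsDoubleWell

end Potential

section Translations

/-! ### Minimal heteroclinics are the zeros of the effective potential -/

variable {m : ℕ} {α : ℝ} {W : E m → ℝ} {am ap : E m}

/-- The element of `H¹(ℝ; ℝᵐ)` defined by a `C¹` function with compact support. -/
theorem exists_h1_of_contDiff {f g : ℝ → E m} (hd : ∀ t, HasDerivAt f (g t) t) (hg : Continuous g)
    (hc : HasCompactSupport f) :
    ∃ k : H1 m, rep k = f ∧ h1Der k =ᵐ[volume] g := by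
  have hp := IsPath.of_hasDerivAt hd hg
  have hgc : HasCompactSupport g := by
    have : g = deriv f := funext fun t => (hd t).deriv.symm
    rw [this]; exact hc.deriv
  have h1 : MemLp f 2 volume := hp.continuous.memLp_of_hasCompactSupport hc
  have h2 : MemLp g 2 volume := hg.memLp_of_hasCompactSupport hgc
  exact ⟨mkH1 h1 h2 hp.hasWeakDeriv, rep_mkH1 h1 h2 hp, h1Der_mkH1 h1 h2 _⟩

theorem integrable_inner_uder (h k : H1 m) :
    Integrable fun x => inner ℝ (uder am ap h x) (h1Der k x) := by
  refine (L2.integrable_inner (𝕜 := ℝ) (uderL am ap h) (sndL m k)).congr ?_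
  filter_upwards [coe_uderL am ap h] with x h1
  rw [h1, coe_sndL]

theorem IsDoubleWell.dAction_eq_integral (hW : IsDoubleWell α W am ap) (h k : H1 m) :
    hW.dAction h k = (∫ x, inner ℝ (uder am ap h x) (h1Der k x)) +
      ∫ x, inner ℝ (gradient W (urep am ap h x)) (rep k x) := by
  rw [hW.dAction_apply, hW.inner_gradL, L2.inner_def]
  congr 1
  refine integral_congr_ae ?_
  filter_upwards [coe_uderL am ap h] with x h1
  rw [h1, coe_sndL]

/-- The Euler–Lagrange equation of critical points, in the weak form. -/
theorem IsDoubleWell.hasWeakDeriv_uder (hW : IsDoubleWell α W am ap) {h : H1 m}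
    (h0 : hW.dAction h = 0) :
    HasWeakDeriv (1 : ℝ) (uder am ap h) fun x => gradient W (urep am ap h x) := by
  have hl : LocallyIntegrable (uder am ap h) volume := (isPath_urep am ap h).locallyIntegrable
  have hG : Continuous fun x => gradient W (urep am ap h x) :=
    hW.continuous_gradient.comp (continuous_urep am ap h)
  refine ⟨hl, hG.locallyIntegrable, fun φ hφ hc => ?_⟩
  have hd : Continuous fun y => fderiv ℝ φ y 1 :=
    (hφ.continuous_fderiv (by simp)).clm_apply continuous_const
  have hdc : HasCompactSupport fun y => fderiv ℝ φ y 1 := hc.fderiv_apply (𝕜 := ℝ) 1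
  have i1 : Integrable fun y => (fderiv ℝ φ y 1) • uder am ap h y :=
    hl.integrable_smul_left_of_hasCompactSupport hd hdc
  have i2 : Integrable fun y => φ y • gradient W (urep am ap h y) :=
    hG.locallyIntegrable.integrable_smul_left_of_hasCompactSupport hφ.continuous hc
  rw [eq_neg_iff_add_eq_zero]
  -- Paired with a vector `v`, the identity becomes the vanishing of the differential in the
  -- direction `φ • v`.
  refine ext_inner_right ℝ fun v => ?_
  obtain ⟨k, hk, hk'⟩ := exists_h1_of_contDiff (f := fun t => φ t • v)
    (g := fun t => (fderiv ℝ φ t 1) • v) (fun t => by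
      have := (hφ.differentiable (by simp) t).hasDerivAt
      exact (by simpa using this : HasDerivAt φ (fderiv ℝ φ t 1) t).smul_const v)
    (hd.smul continuous_const) hc.smul_right
  have key := hW.dAction_eq_integral h k
  rw [h0, zero_apply, hk] at key
  rw [inner_zero_left, inner_add_left, real_inner_comm, ← integral_inner i1, real_inner_comm,
    ← integral_inner i2, key]
  congr 1
  · refine integral_congr_ae ?_
    filter_upwards [hk'] with x hx
    rw [hx, real_inner_smul_right, real_inner_smul_right, real_inner_comm]
  · refine integral_congr_ae (ae_of_all _ fun x => ?_)
    simp only [real_inner_smul_right, real_inner_comm]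

/-- The weak derivative of `u'` is `∇W(u)`, which is continuous; so `u'` has a `C¹` representative
and `u` is a classical solution. The limits at `±∞` are built into `e₀ + H¹`. -/
theorem IsDoubleWell.isMinimalHeteroclinic (hW : IsDoubleWell α W am ap) {h : H1 m}
    (h0 : realPot W am ap h = 0) : IsMinimalHeteroclinic W am ap (urep am ap h) := by
  obtain ⟨G, hG, hae⟩ := (hW.hasWeakDeriv_uder (hW.dAction_eq_zero h0)).exists_isPath
  have hu : IsPath (urep am ap h) G := (isPath_urep am ap h).congr_ae hae
  have hd : ∀ x, HasDerivAt (urep am ap h) (G x) x := hu.hasDerivAt hG.continuous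
  have hc : Continuous fun x => gradient W (urep am ap h x) :=
    hW.continuous_gradient.comp (continuous_urep am ap h)
  have hd2 : ∀ x, HasDerivAt G (gradient W (urep am ap h x)) x := hG.hasDerivAt hc
  have e1 : deriv (urep am ap h) = G := funext fun x => (hd x).deriv
  have e2 : deriv G = fun x => gradient W (urep am ap h x) := funext fun x => (hd2 x).deriv
  refine ⟨?_, fun x => by rw [e1, e2], tendsto_urep_atBot am ap h, tendsto_urep_atTop am ap h, ?_⟩
  · rw [show (2 : WithTop ℕ∞) = 1 + 1 by norm_num, contDiff_succ_iff_deriv]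
    refine ⟨fun x => (hd x).differentiableAt, by simp, ?_⟩
    rw [e1, contDiff_one_iff_deriv, e2]
    exact ⟨fun x => (hd2 x).differentiableAt, hc⟩
  · intro v hv
    have h1 : effPot W am ap h = 0 :=
      (ENNReal.toReal_eq_zero_iff _).1 h0 |>.resolve_right (hW.effPot_ne_top h)
    rw [action_urep]
    exact (tsub_eq_zero_iff_le.1 h1).trans (iInf₂_le v hv)

/-- Turns the definition through differential equations into membership in the zero set of a
continuous function. A minimal heteroclinic belongs to the connecting class, so its action is
exactly the infimum; the converse is regularity of minimizers. -/
theorem IsDoubleWell.mem_minHet_iff (hW : IsDoubleWell α W am ap) {h : H1 m} :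
    h ∈ minHet W am ap ↔ realPot W am ap h = 0 := by
  constructor
  · rintro ⟨e, he, hae⟩
    have hder : ∀ x, HasDerivAt e (deriv e x) x := fun x =>
      (he.contDiff.differentiable (by norm_num) x).hasDerivAt
    have hcd : Continuous (deriv e) := he.contDiff.continuous_deriv (by norm_num)
    have hp := IsPath.of_hasDerivAt hder hcd
    have hmem : e ∈ connectingClass am ap :=
      ⟨hp.continuous, ⟨memL2loc_of_continuous hp.continuous, _, hp.hasWeakDeriv,
        memL2loc_of_continuous hcd⟩, he.tendsto_atBot, he.tendsto_atTop⟩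
    have h1 : action W (affineMap am ap h) = action W e := by
      rw [action, weakDeriv_congr hae]
      refine lintegral_congr_ae ?_
      filter_upwards [hae] with x hx
      rw [hx]
    have h2 : action W e ≤ minAction W am ap := le_iInf₂ he.minimal
    rw [realPot, effPot, h1, tsub_eq_zero_of_le h2, ENNReal.toReal_zero]
  · intro h0
    exact ⟨_, hW.isMinimalHeteroclinic h0, affineMap_ae_eq am ap h⟩

/-! ### Translations -/

theorem memLp_comp_add {X : Type*} [NormedAddCommGroup X] {f : ℝ → X} (hf : MemLp f 2 volume)
    (a : ℝ) : MemLp (fun x => f (x + a)) 2 volume :=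
  hf.comp_measurePreserving (measurePreserving_add_right volume a)

theorem ae_comp_add {X : Type*} {f g : ℝ → X} (h : f =ᵐ[volume] g) (a : ℝ) :
    (fun x => f (x + a)) =ᵐ[volume] fun x => g (x + a) :=
  (measurePreserving_add_right volume a).quasiMeasurePreserving.ae_eq_comp h

/-- Translation in `H¹(ℝ; ℝᵐ)`. -/
def shiftFun (a : ℝ) (h : H1 m) : H1 m :=
  mkH1 (memLp_comp_add (memLp_rep h) a) (memLp_comp_add (memLp_h1Der h) a)
    ((isPath_rep h).comp_add a).hasWeakDeriv

theorem rep_shiftFun (a : ℝ) (h : H1 m) : rep (shiftFun a h) = fun x => rep h (x + a) :=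
  rep_mkH1 _ _ ((isPath_rep h).comp_add a)

theorem h1Der_shiftFun (a : ℝ) (h : H1 m) :
    h1Der (shiftFun a h) =ᵐ[volume] fun x => h1Der h (x + a) := h1Der_mkH1 _ _ _

/-- Translation in `H¹(ℝ; ℝᵐ)` as a linear isometry. -/
def shiftL (m : ℕ) (a : ℝ) : H1 m →ₗᵢ[ℝ] H1 m where
  toFun := shiftFun a
  map_add' h k := ext_rep (by rw [rep_shiftFun, rep_add, rep_add, rep_shiftFun, rep_shiftFun]; rfl)
  map_smul' c h := ext_rep (by rw [rep_shiftFun]; simp only [rep_smul, rep_shiftFun, RingHom.id_apply]; rfl)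
  norm_map' h := by
    refine (sq_eq_sq₀ (norm_nonneg _) (norm_nonneg _)).1 ?_
    change ‖shiftFun a h‖ ^ 2 = _
    rw [norm_sq_eq_integral, norm_sq_eq_integral, rep_shiftFun]
    congr 1
    · exact integral_add_right_eq_self (fun x => ‖rep h x‖ ^ 2) a
    · rw [← integral_add_right_eq_self (fun x => ‖h1Der h x‖ ^ 2) a]
      refine integral_congr_ae ?_
      filter_upwards [h1Der_shiftFun a h] with x hx
      rw [hx]

theorem rep_shiftL (a : ℝ) (h : H1 m) : rep (shiftL m a h) = fun x => rep h (x + a) :=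
  rep_shiftFun a h

theorem hasCompactSupport_e0_shift (am ap : E m) (a : ℝ) :
    HasCompactSupport fun x => e0 am ap (x + a) - e0 am ap x := by
  refine HasCompactSupport.intro (isCompact_Icc (a := -(1 + |a|)) (b := 1 + |a|)) fun x hx => ?_
  have h1 := le_abs_self a
  have h2 := neg_abs_le a
  rw [Set.mem_Icc, not_and_or, not_le, not_le] at hx
  rcases hx with hx | hx
  · rw [e0_of_le (by linarith), e0_of_le (by linarith [abs_nonneg a]), sub_self]
  · rw [e0_of_ge (by linarith), e0_of_ge (by linarith [abs_nonneg a]), sub_self]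

theorem isPath_e0_shift (am ap : E m) (a : ℝ) :
    IsPath (fun x => e0 am ap (x + a) - e0 am ap x) fun x => e0Der am ap (x + a) - e0Der am ap x :=
  ((isPath_e0 am ap).comp_add a).sub (isPath_e0 am ap)

theorem memLp_e0_shift (am ap : E m) (a : ℝ) :
    MemLp (fun x => e0 am ap (x + a) - e0 am ap x) 2 volume :=
  (isPath_e0_shift am ap a).continuous.memLp_of_hasCompactSupport (hasCompactSupport_e0_shift am ap a)

theorem memLp_e0Der_shift (am ap : E m) (a : ℝ) :
    MemLp (fun x => e0Der am ap (x + a) - e0Der am ap x) 2 volume :=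
  (memLp_comp_add (memLp_e0Der am ap) a).sub (memLp_e0Der am ap)

/-- `e₀(· + a) - e₀`. -/
def e0Shift (am ap : E m) (a : ℝ) : H1 m :=
  mkH1 (memLp_e0_shift am ap a) (memLp_e0Der_shift am ap a) (isPath_e0_shift am ap a).hasWeakDeriv

theorem rep_e0Shift (am ap : E m) (a : ℝ) :
    rep (e0Shift am ap a) = fun x => e0 am ap (x + a) - e0 am ap x :=
  rep_mkH1 _ _ (isPath_e0_shift am ap a)

/-- Translation in `e₀ + H¹(ℝ; ℝᵐ)`. -/
def translate (am ap : E m) (a : ℝ) (h : H1 m) : H1 m := e0Shift am ap a + shiftL m a h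

theorem urep_translate (am ap : E m) (a : ℝ) (h : H1 m) :
    urep am ap (translate am ap a h) = fun x => urep am ap h (x + a) := by
  funext x
  rw [urep, translate, rep_add, rep_e0Shift, rep_shiftL, urep, Pi.add_apply]
  abel

theorem uder_translate (am ap : E m) (a : ℝ) (h : H1 m) :
    uder am ap (translate am ap a h) =ᵐ[volume] fun x => uder am ap h (x + a) := by
  have h1 := isPath_urep am ap (translate am ap a h)
  rw [urep_translate] at h1
  exact h1.ae_unique ((isPath_urep am ap h).comp_add a)

theorem ext_urep {h k : H1 m} (he : urep am ap h = urep am ap k) : h = k :=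
  ext_rep (funext fun x => by simpa [urep] using congrFun he x)

theorem translate_translate (am ap : E m) (a b : ℝ) (h : H1 m) :
    translate am ap a (translate am ap b h) = translate am ap (a + b) h :=
  ext_urep (am := am) (ap := ap) (by
    rw [urep_translate, urep_translate, urep_translate]
    funext x
    ring_nf)

theorem translate_zero (am ap : E m) (h : H1 m) : translate am ap 0 h = h :=
  ext_urep (am := am) (ap := ap) (by rw [urep_translate]; simp)

theorem norm_translate_sub (am ap : E m) (a : ℝ) (h k : H1 m) :
    ‖translate am ap a h - translate am ap a k‖ = ‖h - k‖ := by
  rw [translate, translate, add_sub_add_left_eq_sub, ← map_sub, LinearIsometry.norm_map]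

theorem realAction_translate (W : E m → ℝ) (am ap : E m) (a : ℝ) (h : H1 m) :
    realAction W am ap (translate am ap a h) = realAction W am ap h := by
  rw [realAction, realAction, ← integral_uder_sq, ← integral_uder_sq, urep_translate,
    integral_add_right_eq_self (fun x => W (urep am ap h x)) a,
    ← integral_add_right_eq_self (fun x => ‖uder am ap h x‖ ^ 2) a]
  congr 2
  refine integral_congr_ae ?_
  filter_upwards [uder_translate am ap a h] with x hx
  rw [hx]

theorem IsDoubleWell.realPot_translate (hW : IsDoubleWell α W am ap) (a : ℝ) (h : H1 m) :
    realPot W am ap (translate am ap a h) = realPot W am ap h := by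
  simp only [hW.realPot_eq, realAction_translate]

/-- Translation is continuous in `L²`. -/
theorem tendsto_L2_shift (f : L2 m) :
    Tendsto (fun a : ℝ => ∫ x, ‖(f : ℝ → E m) (x + a) - (f : ℝ → E m) x‖ ^ 2) (𝓝 0) (𝓝 0) := by
  let c : ℝ → C(ℝ, ℝ) := fun a => ⟨fun x => x + a, by fun_prop⟩
  have hc : Continuous c := ContinuousMap.continuous_of_continuous_uncurry _ (by
    simp only [Function.uncurry_def, c, ContinuousMap.coe_mk]; fun_prop)
  have hm : ∀ a, MeasurePreserving (c a) (volume : Measure ℝ) volume := fun a =>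
    measurePreserving_add_right volume a
  have h1 : Continuous fun a => Lp.compMeasurePreserving (c a) (hm a) f :=
    continuous_const.compMeasurePreservingLp hc hm (by norm_num)
  have h2 : Continuous fun a => ‖Lp.compMeasurePreserving (c a) (hm a) f - f‖ ^ 2 :=
    (h1.sub continuous_const).norm.pow 2
  have h3 : ∀ a, ‖Lp.compMeasurePreserving (c a) (hm a) f - f‖ ^ 2 =
      ∫ x, ‖(f : ℝ → E m) (x + a) - (f : ℝ → E m) x‖ ^ 2 := fun a => by
    rw [L2_norm_sq]
    refine integral_congr_ae ?_
    filter_upwards [Lp.coeFn_sub (Lp.compMeasurePreserving (c a) (hm a) f) f,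
      Lp.coeFn_compMeasurePreserving f (hm a)] with x h1 h2
    rw [h1, Pi.sub_apply, h2]; rfl
  have h4 := h2.tendsto 0
  simp only [h3] at h4
  simpa using h4

/-- For the derivative this is the continuity of translations in `L²`, since `(e₀ + h)'` is square
integrable although `e₀ + h` is not. For the function, `h` is treated in the same way, while `e₀(· +
a) - e₀` is bounded by a multiple of `|a|` and, for `|a| ≤ 1`, vanishes outside `[-2, 2]`. -/
theorem tendsto_translate_zero (am ap : E m) (h : H1 m) :
    Tendsto (fun a => translate am ap a h) (𝓝 0) (𝓝 h) := by
  rw [tendsto_iff_norm_sub_tendsto_zero]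
  have hrep : ∀ a, rep (translate am ap a h - h) = fun x => urep am ap h (x + a) - urep am ap h x :=
    fun a => by
      funext x
      rw [rep_sub, ← congrFun (urep_translate am ap a h) x, urep, urep]; simp
  have hder : ∀ a, h1Der (translate am ap a h - h) =ᵐ[volume]
      fun x => uder am ap h (x + a) - uder am ap h x := fun a => by
    have h1 := isPath_rep (translate am ap a h - h)
    rw [hrep] at h1
    exact h1.ae_unique (((isPath_urep am ap h).comp_add a).sub (isPath_urep am ap h))
  -- the derivatives
  have t1 : Tendsto (fun a => ∫ x, ‖h1Der (translate am ap a h - h) x‖ ^ 2) (𝓝 0) (𝓝 0) := by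
    refine (tendsto_L2_shift (uderL am ap h)).congr fun a => integral_congr_ae ?_
    filter_upwards [hder a, coe_uderL am ap h, ae_comp_add (coe_uderL am ap h) a] with x h1 h2 h3
    rw [h1, h2, h3]
  -- the functions
  have t2 : Tendsto (fun a => ∫ x, ‖rep (translate am ap a h - h) x‖ ^ 2) (𝓝 0) (𝓝 0) := by
    set B := 1 / 2 * ‖ap - am‖ with hB
    have hlip : ∀ a x, ‖e0 am ap (x + a) - e0 am ap x‖ ≤ B * |a| := fun a x => by
      have hbound : ∀ t, ‖e0Der am ap t‖ ≤ B := fun t => by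
        rw [e0Der]
        refine (norm_indicator_le_norm_self _ _).trans (le_of_eq ?_)
        rw [norm_smul, hB]; norm_num
      rw [(isPath_e0 am ap).sub_eq]
      have := intervalIntegral.norm_integral_le_of_norm_le_const (a := x) (b := x + a)
        (f := e0Der am ap) (fun t _ => hbound t)
      simpa using this
    have key : ∀ a, |a| ≤ 1 → ∫ x, ‖rep (translate am ap a h - h) x‖ ^ 2 ≤
        2 * (∫ x, ‖(fstL m h : ℝ → E m) (x + a) - (fstL m h : ℝ → E m) x‖ ^ 2) +
        2 * (4 * (B * |a|) ^ 2) := fun a ha => by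
      have i1 : Integrable fun x => ‖rep h (x + a) - rep h x‖ ^ 2 :=
        (memLp_two_iff_integrable_sq_norm ((memLp_comp_add (memLp_rep h) a).sub (memLp_rep h)).1).1
          ((memLp_comp_add (memLp_rep h) a).sub (memLp_rep h))
      have i2 : Integrable ((Set.Icc (-2 : ℝ) 2).indicator fun _ => (B * |a|) ^ 2) :=
        (integrable_indicator_iff measurableSet_Icc).2 continuous_const.integrableOn_Icc
      have e1 : ∫ x, ‖(fstL m h : ℝ → E m) (x + a) - (fstL m h : ℝ → E m) x‖ ^ 2 =
          ∫ x, ‖rep h (x + a) - rep h x‖ ^ 2 := by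
        refine integral_congr_ae ?_
        filter_upwards [h1Fun_ae_eq_rep h, ae_comp_add (h1Fun_ae_eq_rep h) a] with x h1 h2
        rw [coe_fstL, h1, h2]
      have e2 : ∫ x, (Set.Icc (-2 : ℝ) 2).indicator (fun _ => (B * |a|) ^ 2) x =
          4 * (B * |a|) ^ 2 := by
        rw [integral_indicator measurableSet_Icc, setIntegral_const]
        simp [Measure.real]
        norm_num
      rw [e1, ← e2, ← integral_const_mul, ← integral_const_mul,
        ← integral_add (i1.const_mul 2) (i2.const_mul 2)]
      refine integral_mono_of_nonneg (ae_of_all _ fun x => sq_nonneg _)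
        ((i1.const_mul 2).add (i2.const_mul 2)) (ae_of_all _ fun x => ?_)
      have hx : ‖e0 am ap (x + a) - e0 am ap x‖ ^ 2 ≤
          (Set.Icc (-2 : ℝ) 2).indicator (fun _ => (B * |a|) ^ 2) x := by
        by_cases hx : x ∈ Set.Icc (-2 : ℝ) 2
        · rw [Set.indicator_of_mem hx]
          exact pow_le_pow_left₀ (norm_nonneg _) (hlip a x) 2
        · rw [Set.indicator_of_notMem hx]
          rw [Set.mem_Icc, not_and_or, not_le, not_le] at hx
          have ha' := abs_le.1 ha
          rcases hx with hx | hx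
          · rw [e0_of_le (by linarith), e0_of_le (by linarith), sub_self]; norm_num
          · rw [e0_of_ge (by linarith), e0_of_ge (by linarith), sub_self]; norm_num
      simp only [hrep, urep]
      have h3 : e0 am ap (x + a) + rep h (x + a) - (e0 am ap x + rep h x) =
          (rep h (x + a) - rep h x) + (e0 am ap (x + a) - e0 am ap x) := by abel
      rw [h3]
      have h4 := norm_add_le (rep h (x + a) - rep h x) (e0 am ap (x + a) - e0 am ap x)
      have h5 := pow_le_pow_left₀ (norm_nonneg _) h4 2
      nlinarith [sq_nonneg (‖rep h (x + a) - rep h x‖ - ‖e0 am ap (x + a) - e0 am ap x‖)]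
    refine squeeze_zero' (Eventually.of_forall fun a => integral_nonneg fun x => sq_nonneg _)
      (g := fun a => 2 * (∫ x, ‖(fstL m h : ℝ → E m) (x + a) - (fstL m h : ℝ → E m) x‖ ^ 2) +
        2 * (4 * (B * |a|) ^ 2)) ?_ ?_
    · filter_upwards [Metric.ball_mem_nhds (0 : ℝ) one_pos] with a ha
      rw [mem_ball_zero_iff, Real.norm_eq_abs] at ha
      exact key a ha.le
    · have h1 := (tendsto_L2_shift (fstL m h)).const_mul 2
      have h2 : Tendsto (fun a : ℝ => 2 * (4 * (B * |a|) ^ 2)) (𝓝 0) (𝓝 (2 * (4 * (B * |(0 : ℝ)|) ^ 2))) :=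
        (by fun_prop : Continuous fun a : ℝ => 2 * (4 * (B * |a|) ^ 2)).tendsto 0
      simpa using h1.add h2
  have t3 := (t2.add t1).sqrt
  simp only [add_zero, Real.sqrt_zero] at t3
  refine t3.congr fun a => ?_
  rw [← norm_sq_eq_integral, Real.sqrt_sq (norm_nonneg _)]

theorem continuous_translate_param (am ap : E m) (h : H1 m) :
    Continuous fun a => translate am ap a h := by
  rw [continuous_iff_continuousAt]
  intro a
  have h1 := tendsto_translate_zero am ap (translate am ap a h)
  have h2 : Tendsto (fun b => b - a) (𝓝 a) (𝓝 0) := by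
    have : Tendsto (fun b => b - a) (𝓝 a) (𝓝 (a - a)) := (continuous_sub_right a).tendsto a
    simpa using this
  have := h1.comp h2
  simpa [ContinuousAt, Function.comp_def, translate_translate] using this

end Translations

section WeakConvergence

/-! ### Weak convergence in Hilbert spaces -/

section Weak

variable {X Z : Type*} [NormedAddCommGroup X] [InnerProductSpace ℝ X]
  [NormedAddCommGroup Z] [InnerProductSpace ℝ Z]

/-- Weak convergence of a sequence in a Hilbert space. -/
def WeakTendsto (x : ℕ → X) (y : X) : Prop :=
  ∀ z, Tendsto (fun n => inner ℝ (x n) z) atTop (𝓝 (inner ℝ y z))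

/-- The closed span of the sequence is separable, so closed balls of its dual are weak-*
sequentially compact. Pairings with arbitrary vectors reduce to this subspace by orthogonal
projection. -/
theorem exists_weakTendsto_subseq [CompleteSpace X] {x : ℕ → X} {B : ℝ} (hB : ∀ n, ‖x n‖ ≤ B) :
    ∃ (y : X) (φ : ℕ → ℕ), StrictMono φ ∧ WeakTendsto (x ∘ φ) y := by
  set K : Submodule ℝ X := (Submodule.span ℝ (Set.range x)).topologicalClosure with hK
  have hcl : IsClosed (K : Set X) := Submodule.isClosed_topologicalClosure _
  have : CompleteSpace K := hcl.completeSpace_coe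
  have : TopologicalSpace.SeparableSpace K := by
    have h1 : TopologicalSpace.IsSeparable (K : Set X) := by
      rw [hK, Submodule.topologicalClosure_coe]
      exact ((Set.countable_range x).isSeparable.span (R := ℝ)).closure
    exact h1.separableSpace
  have hxK : ∀ n, x n ∈ K := fun n =>
    Submodule.le_topologicalClosure _ (Submodule.subset_span ⟨n, rfl⟩)
  let f : ℕ → WeakDual ℝ K := fun n =>
    StrongDual.toWeakDual (InnerProductSpace.toDual ℝ K ⟨x n, hxK n⟩)
  have hf : ∀ n, f n ∈ WeakDual.toStrongDual ⁻¹' Metric.closedBall (0 : StrongDual ℝ K) B := by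
    intro n
    have h1 : ‖InnerProductSpace.toDual ℝ K ⟨x n, hxK n⟩‖ ≤ B := by
      rw [LinearIsometryEquiv.norm_map]; exact hB n
    exact mem_closedBall_zero_iff.2 h1
  obtain ⟨g, -, φ, hφ, hg⟩ := WeakDual.isSeqCompact_closedBall ℝ K 0 B hf
  let y : K := (InnerProductSpace.toDual ℝ K).symm (WeakDual.toStrongDual g)
  refine ⟨y, φ, hφ, fun z => ?_⟩
  have h1 := ((WeakDual.eval_continuous (K.orthogonalProjectionOnto z)).tendsto g).comp hg
  have h2 : ∀ w : K, inner ℝ (w : X) z = inner ℝ w (K.orthogonalProjectionOnto z) := fun w => by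
    rw [Submodule.inner_orthogonalProjectionOnto_eq_of_mem_left]
  have h3 : inner ℝ (y : X) z = g (K.orthogonalProjectionOnto z) := by
    rw [h2]
    change inner ℝ ((InnerProductSpace.toDual ℝ K).symm (WeakDual.toStrongDual g)) _ = _
    rw [InnerProductSpace.toDual_symm_apply]; rfl
  rw [h3]
  refine h1.congr fun n => ?_
  simp only [Function.comp]
  rw [show x (φ n) = ((⟨x (φ n), hxK _⟩ : K) : X) from rfl, h2]
  rfl

namespace WeakTendsto

variable {x : ℕ → X} {y : X}

theorem comp (h : WeakTendsto x y) {φ : ℕ → ℕ} (hφ : StrictMono φ) : WeakTendsto (x ∘ φ) y :=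
  fun z => (h z).comp hφ.tendsto_atTop

/-- Weak lower semicontinuity of the squared norm, from `‖xₙ‖² ≥ 2⟨xₙ, y⟩ - ‖y‖²`. The form with `ε`
lets several such bounds be added as real inequalities. -/
theorem eventually_norm_sq (h : WeakTendsto x y) {ε : ℝ} (hε : 0 < ε) :
    ∀ᶠ n in atTop, ‖y‖ ^ 2 - ε < ‖x n‖ ^ 2 := by
  have h1 : Tendsto (fun n => 2 * inner ℝ (x n) y - ‖y‖ ^ 2) atTop
      (𝓝 (2 * inner ℝ y y - ‖y‖ ^ 2)) := ((h y).const_mul 2).sub_const _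
  rw [real_inner_self_eq_norm_sq] at h1
  filter_upwards [h1.eventually (lt_mem_nhds (show ‖y‖ ^ 2 - ε < 2 * ‖y‖ ^ 2 - ‖y‖ ^ 2 by linarith))]
    with n hn
  have := norm_sub_sq_real (x n) y
  nlinarith [sq_nonneg ‖x n - y‖]

theorem map [CompleteSpace X] [CompleteSpace Z] (h : WeakTendsto x y) (L : X →L[ℝ] Z) :
    WeakTendsto (fun n => L (x n)) (L y) := fun z => by
  have := h (L.adjoint z)
  simpa only [ContinuousLinearMap.adjoint_inner_right] using this

theorem const_add (h : WeakTendsto x y) (c : X) : WeakTendsto (fun n => c + x n) (c + y) :=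
  fun z => by
    simp only [inner_add_left]
    exact (h z).const_add _

theorem add {x' : ℕ → X} {y' : X} (h : WeakTendsto x y) (h' : WeakTendsto x' y') :
    WeakTendsto (fun n => x n + x' n) (y + y') := fun z => by
  simp only [inner_add_left]
  exact (h z).add (h' z)

theorem of_tendsto (h : Tendsto x atTop (𝓝 y)) : WeakTendsto x y := fun _ =>
  h.inner tendsto_const_nhds

theorem sub {x' : ℕ → X} {y' : X} (h : WeakTendsto x y) (h' : WeakTendsto x' y') :
    WeakTendsto (fun n => x n - x' n) (y - y') := fun z => by
  simp only [inner_sub_left]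
  exact (h z).sub (h' z)

/-- Expand `‖xₙ - y‖²`; convergence of the norms is what weak convergence lacks. -/
theorem tendsto_of_norm_sq (h : WeakTendsto x y)
    (hn : Tendsto (fun n => ‖x n‖ ^ 2) atTop (𝓝 (‖y‖ ^ 2))) : Tendsto x atTop (𝓝 y) := by
  rw [tendsto_iff_norm_sub_tendsto_zero]
  have h1 : Tendsto (fun n => ‖x n - y‖ ^ 2) atTop (𝓝 0) := by
    have := (hn.sub ((h y).const_mul 2)).add_const (‖y‖ ^ 2)
    rw [real_inner_self_eq_norm_sq, show ‖y‖ ^ 2 - 2 * ‖y‖ ^ 2 + ‖y‖ ^ 2 = 0 by ring] at this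
    exact this.congr fun n => (norm_sub_sq_real (x n) y).symm
  simpa using h1.sqrt

end WeakTendsto

theorem weakTendsto_iff_tendsto [FiniteDimensional ℝ X] {x : ℕ → X} {y : X} :
    WeakTendsto x y ↔ Tendsto x atTop (𝓝 y) := by
  refine ⟨fun h => ?_, WeakTendsto.of_tendsto⟩
  let b := stdOrthonormalBasis ℝ X
  have h1 : Tendsto (fun n => ∑ i, inner ℝ (x n) (b i) • b i) atTop
      (𝓝 (∑ i, inner ℝ y (b i) • b i)) :=
    tendsto_finsetSum _ fun i _ => (h (b i)).smul_const _
  have h2 : ∀ z : X, ∑ i, inner ℝ z (b i) • b i = z := fun z => by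
    conv_rhs => rw [← b.sum_repr z]
    refine Finset.sum_congr rfl fun i _ => ?_
    rw [b.repr_apply_apply, real_inner_comm]
  simpa only [h2] using h1

end Weak

theorem ofReal_le_liminf {f : ℕ → ℝ} {a : ℝ} (h : ∀ ε > 0, ∀ᶠ n in atTop, a - ε < f n) :
    ENNReal.ofReal a ≤ liminf (fun n => ENNReal.ofReal (f n)) atTop := by
  refine le_of_forall_lt fun c hc => ?_
  obtain ⟨d, hcd, hd⟩ := exists_between hc
  have hdtop : d ≠ ⊤ := (hd.trans ENNReal.ofReal_lt_top).ne
  have h1 : d.toReal < a := by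
    have := (ENNReal.lt_ofReal_iff_toReal_lt hdtop).1 hd
    exact this
  refine lt_of_lt_of_le hcd (le_liminf_of_le (by isBoundedDefault) ?_)
  filter_upwards [h (a - d.toReal) (by linarith)] with n hn
  rw [sub_sub_cancel] at hn
  exact ((ENNReal.lt_ofReal_iff_toReal_lt hdtop).2 hn).le

/-- Fatou's lemma for nonnegative integrable functions. -/
theorem eventually_lt_integral {f : ℕ → ℝ → ℝ} {F : ℝ → ℝ} (hf : ∀ n, Integrable (f n))
    (hF : Integrable F) (h0 : ∀ n x, 0 ≤ f n x)
    (hlim : ∀ᵐ x, Tendsto (fun n => f n x) atTop (𝓝 (F x))) {ε : ℝ} (hε : 0 < ε) :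
    ∀ᶠ n in atTop, (∫ x, F x) - ε < ∫ x, f n x := by
  rcases lt_or_ge ((∫ x, F x) - ε) 0 with hneg | hpos
  · exact Eventually.of_forall fun n => lt_of_lt_of_le hneg (integral_nonneg (h0 n))
  have hF0 : 0 ≤ᵐ[volume] F := by
    filter_upwards [hlim] with x hx
    exact ge_of_tendsto' hx fun n => h0 n x
  have h1 : ENNReal.ofReal (∫ x, F x) ≤ liminf (fun n => ENNReal.ofReal (∫ x, f n x)) atTop := by
    have e : ∀ n, ENNReal.ofReal (∫ x, f n x) = ∫⁻ x, ENNReal.ofReal (f n x) := fun n =>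
      ofReal_integral_eq_lintegral_ofReal (hf n) (ae_of_all _ (h0 n))
    simp only [e]
    rw [ofReal_integral_eq_lintegral_ofReal hF hF0]
    calc ∫⁻ x, ENNReal.ofReal (F x) = ∫⁻ x, liminf (fun n => ENNReal.ofReal (f n x)) atTop := by
          refine lintegral_congr_ae ?_
          filter_upwards [hlim] with x hx
          exact ((ENNReal.continuous_ofReal.tendsto _).comp hx).liminf_eq.symm
      _ ≤ _ := lintegral_liminf_le' fun n => (hf n).aestronglyMeasurable.aemeasurable.ennreal_ofReal
  have h2 : ENNReal.ofReal ((∫ x, F x) - ε) < ENNReal.ofReal (∫ x, F x) :=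
    (ENNReal.ofReal_lt_ofReal_iff (by linarith)).2 (by linarith)
  filter_upwards [eventually_lt_of_lt_liminf (h2.trans_le h1)] with n hn
  exact (ENNReal.ofReal_lt_ofReal_iff_of_nonneg hpos).1 hn

end WeakConvergence

section Normalization

/-! ### Coercivity of the effective potential -/

variable {m : ℕ} {α : ℝ} {W : E m → ℝ} {am ap : E m}

namespace IsDoubleWell

theorem swap (hW : IsDoubleWell α W am ap) : IsDoubleWell α W ap am where
  contDiff := hW.contDiff
  holder := hW.holder
  nonneg := hW.nonneg
  ne := hW.ne.symm
  zero_iff u := by rw [hW.zero_iff, or_comm]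
  nondegenerate := by
    obtain ⟨r, hr, c, hc, h⟩ := hW.nondegenerate
    exact ⟨r, hr, c, hc, fun u hu => h u hu.symm⟩
  liminf_pos := hW.liminf_pos

/-- Along the segment from `am` to `u`, the second derivative of `W` is at least `c ‖u - am‖²`;
integrating twice from a point where `W` and its derivative vanish gives half of this constant. -/
theorem exists_lower_left (hW : IsDoubleWell α W am ap) :
    ∃ r > 0, ∃ c > 0, ∀ u, ‖u - am‖ ≤ r → c * ‖u - am‖ ^ 2 ≤ W u := by
  obtain ⟨r, hr, c, hc, hnd⟩ := hW.nondegenerate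
  refine ⟨r, hr, c / 2, half_pos hc, fun u hu => ?_⟩
  have ham : W am = 0 := (hW.zero_iff am).2 (Or.inl rfl)
  set v := u - am with hv
  have hγ : ∀ t : ℝ, HasDerivAt (fun t : ℝ => am + t • v) v t := fun t => by
    simpa using ((hasDerivAt_id t).smul_const v).const_add am
  have hd1 : ∀ t : ℝ, HasDerivAt (fun t : ℝ => W (am + t • v)) (fderiv ℝ W (am + t • v) v) t :=
    fun t => (hW.differentiable (am + t • v)).hasFDerivAt.comp_hasDerivAt t (hγ t)
  have hcd : ContDiff ℝ 1 (fderiv ℝ W) := hW.contDiff.fderiv_right (by norm_num)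
  have hd2 : ∀ t : ℝ, HasDerivAt (fun t : ℝ => fderiv ℝ W (am + t • v) v)
      (fderiv ℝ (fderiv ℝ W) (am + t • v) v v) t := fun t => by
    have := ((hcd.differentiable (by norm_num) (am + t • v)).hasFDerivAt.comp_hasDerivAt t (hγ t))
    simpa using this.clm_apply (hasDerivAt_const t v)
  have hlow : ∀ t ∈ Set.Icc (0 : ℝ) 1, c * ‖v‖ ^ 2 ≤ fderiv ℝ (fderiv ℝ W) (am + t • v) v v := by
    intro t ht
    rcases eq_or_ne v 0 with h0 | h0
    · simp [h0]
    have hn : ‖v‖ ≠ 0 := norm_ne_zero_iff.2 h0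
    have h1 := hnd (am + t • v) (Or.inl (by
      rw [add_sub_cancel_left, norm_smul, Real.norm_eq_abs, abs_of_nonneg ht.1]
      exact (mul_le_of_le_one_left (norm_nonneg _) ht.2).trans hu)) (‖v‖⁻¹ • v)
      (by rw [norm_smul, norm_inv, norm_norm, inv_mul_cancel₀ hn])
    simp only [map_smul, smul_apply, smul_eq_mul] at h1
    have h2 : 0 < ‖v‖ ^ 2 := by positivity
    calc c * ‖v‖ ^ 2 ≤ (‖v‖⁻¹ * (‖v‖⁻¹ * fderiv ℝ (fderiv ℝ W) (am + t • v) v v)) * ‖v‖ ^ 2 := by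
          gcongr
      _ = _ := by field_simp
  have h1 : ∀ t ∈ Set.Icc (0 : ℝ) 1, c * ‖v‖ ^ 2 * t ≤ fderiv ℝ W (am + t • v) v := by
    intro t ht
    have := (convex_Icc (0 : ℝ) 1).mul_sub_le_image_sub_of_le_deriv
      (f := fun t : ℝ => fderiv ℝ W (am + t • v) v) (C := c * ‖v‖ ^ 2)
      (fun t _ => (hd2 t).continuousAt.continuousWithinAt)
      (fun t _ => (hd2 t).differentiableAt.differentiableWithinAt)
      (fun t ht => by rw [(hd2 t).deriv]; exact hlow t (interior_subset ht))
      0 (by simp) t ht ht.1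
    have h0 : fderiv ℝ W am v = 0 := by
      rw [← inner_gradient_left, hW.gradient_eq_zero ham, inner_zero_left]
    simpa [h0] using this
  have hd3 : ∀ t : ℝ, HasDerivAt (fun t : ℝ => W (am + t • v) - c / 2 * ‖v‖ ^ 2 * t ^ 2)
      (fderiv ℝ W (am + t • v) v - c * ‖v‖ ^ 2 * t) t := fun t => by
    refine ((hd1 t).sub (((hasDerivAt_id t).pow 2).const_mul (c / 2 * ‖v‖ ^ 2))).congr_deriv ?_
    simp; ring
  have := (convex_Icc (0 : ℝ) 1).mul_sub_le_image_sub_of_le_deriv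
      (f := fun t : ℝ => W (am + t • v) - c / 2 * ‖v‖ ^ 2 * t ^ 2) (C := 0)
      (fun t _ => (hd3 t).continuousAt.continuousWithinAt)
      (fun t _ => (hd3 t).differentiableAt.differentiableWithinAt)
      (fun t ht => by rw [(hd3 t).deriv]; linarith [h1 t (interior_subset ht)])
      0 (by simp) 1 (by simp) zero_le_one
  have hu' : am + v = u := by rw [hv]; abel
  simp only [one_smul, zero_smul, add_zero, ham, hu'] at this
  linarith

theorem exists_lower (hW : IsDoubleWell α W am ap) :
    ∃ r > 0, ∃ c > 0, ∀ u, (‖u - am‖ ≤ r → c * ‖u - am‖ ^ 2 ≤ W u) ∧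
      (‖u - ap‖ ≤ r → c * ‖u - ap‖ ^ 2 ≤ W u) := by
  obtain ⟨r, hr, c, hc, h⟩ := hW.exists_lower_left
  obtain ⟨r', hr', c', hc', h'⟩ := hW.swap.exists_lower_left
  refine ⟨min r r', lt_min hr hr', min c c', lt_min hc hc', fun u => ⟨fun hu => ?_, fun hu => ?_⟩⟩
  · exact (mul_le_mul_of_nonneg_right (min_le_left _ _) (sq_nonneg _)).trans
      (h u (hu.trans (min_le_left _ _)))
  · exact (mul_le_mul_of_nonneg_right (min_le_right _ _) (sq_nonneg _)).trans
      (h' u (hu.trans (min_le_right _ _)))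

/-- The double-well potential fits the abstract framework. -/
theorem twoWell (hW : IsDoubleWell α W am ap) : TwoWell W {am} {ap} (dist am ap) where
  continuous := hW.continuous
  nonneg := hW.nonneg
  pos := dist_pos.2 hW.ne
  nonempty_left := Set.singleton_nonempty _
  nonempty_right := Set.singleton_nonempty _
  sep x hx y hy := by rw [Set.mem_singleton_iff.1 hx, Set.mem_singleton_iff.1 hy]
  quad := by
    obtain ⟨L, hL, hT⟩ := hW.exists_taylor (‖am‖ + ‖ap‖ + 1)
    refine ⟨L, hL, 1, one_pos, fun e he x hx => ?_⟩
    have hWe : W e = 0 := (hW.zero_iff e).2 (by simpa [or_comm] using he)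
    have hne : ‖e‖ ≤ ‖am‖ + ‖ap‖ := by
      rcases he with he | he <;> rw [Set.mem_singleton_iff.1 he]
      · linarith [norm_nonneg ap]
      · linarith [norm_nonneg am]
    have hnx : ‖x‖ ≤ ‖am‖ + ‖ap‖ + 1 := by
      have := norm_le_norm_add_norm_sub' x e; linarith
    have := (hT e x (by linarith) hnx).2
    rw [hWe, hW.gradient_eq_zero hWe, inner_zero_left, sub_zero, sub_zero] at this
    exact (le_abs_self _).trans this
  coercive ε hε := by
    obtain ⟨c, hc, hev⟩ := hW.liminf_pos
    obtain ⟨K, hK, hKc⟩ := mem_cocompact.1 hev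
    simp only [Metric.infDist_singleton]
    have hK' : IsCompact (K ∩ {x | ε ≤ dist x am ∧ ε ≤ dist x ap}) := by
      have h1 : IsClosed {x | ε ≤ dist x am} := isClosed_le continuous_const (by fun_prop)
      have h2 : IsClosed {x | ε ≤ dist x ap} := isClosed_le continuous_const (by fun_prop)
      exact hK.inter_right (h1.inter h2)
    rcases (K ∩ {x | ε ≤ dist x am ∧ ε ≤ dist x ap}).eq_empty_or_nonempty with h0 | hne
    · refine ⟨c, hc, fun x h1 h2 => ?_⟩
      by_cases hx : x ∈ K
      · exact absurd (show x ∈ K ∩ {x | ε ≤ dist x am ∧ ε ≤ dist x ap} from ⟨hx, h1, h2⟩)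
          (by simp [h0])
      · exact hKc hx
    · obtain ⟨x₀, hx₀, hmin⟩ := hK'.exists_isMinOn hne hW.continuous.continuousOn
      have hpos : 0 < W x₀ := by
        refine lt_of_le_of_ne (hW.nonneg _) fun h => ?_
        rcases (hW.zero_iff x₀).1 h.symm with h | h
        · have := hx₀.2.1; rw [h, dist_self] at this; linarith
        · have := hx₀.2.2; rw [h, dist_self] at this; linarith
      refine ⟨min c (W x₀), lt_min hc hpos, fun x h1 h2 => ?_⟩
      by_cases hx : x ∈ K
      · exact (min_le_right _ _).trans (hmin ⟨hx, h1, h2⟩)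
      · exact (min_le_left _ _).trans (hKc hx)

end IsDoubleWell

theorem memLp_of_pathEnergy {X : Type*} [NormedAddCommGroup X] [NormedSpace ℝ X] {P : X → ℝ}
    (hP : ∀ x, 0 ≤ P x) {V g : ℝ → X} (hg : AEStronglyMeasurable g volume)
    (hE : pathEnergy P Set.univ V g ≠ ⊤) : MemLp g 2 volume := by
  rw [memLp_two_iff_integrable_sq_norm hg]
  refine ⟨(hg.norm.pow 2), ?_⟩
  rw [hasFiniteIntegral_iff_ofReal (ae_of_all _ fun t => sq_nonneg _)]
  refine lt_of_le_of_lt ?_ (ENNReal.mul_lt_top (ENNReal.ofReal_lt_top (r := 2)) (lt_top_iff_ne_top.2 hE))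
  rw [pathEnergy, setLIntegral_univ, ← lintegral_const_mul' _ _ ENNReal.ofReal_ne_top]
  refine lintegral_mono fun t => ?_
  rw [← ENNReal.ofReal_mul (by norm_num)]
  exact ENNReal.ofReal_le_ofReal (by have := hP (V t); linarith)

namespace IsDoubleWell

/-- A path of finite energy that only stays near the wells at both ends actually converges to them,
hence is a competitor for `J_min`. Thus `J_min` may serve as the infimum in `near_minimizer`. -/
theorem minAction_le_pathEnergy (hW : IsDoubleWell α W am ap) {V g : ℝ → E m} (hV : IsPath V g)
    (hc : Connects {am} {ap} (dist am ap / 4) V) :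
    minAction W am ap ≤ pathEnergy W Set.univ V g := by
  by_cases hE : pathEnergy W Set.univ V g = ⊤
  · rw [hE]; exact le_top
  obtain ⟨tm, tp, -, hm, hp⟩ := hc
  have h1 := hW.twoWell.tendsto_atBot hV hE hm
  have h2 := hW.twoWell.tendsto_atTop hV hE hp
  simp only [Metric.infDist_singleton] at h1 h2
  have hmem : V ∈ connectingClass am ap :=
    ⟨hV.continuous, ⟨memL2loc_of_continuous hV.continuous, g, hV.hasWeakDeriv,
      memL2loc_of_memLp (memLp_of_pathEnergy hW.nonneg
        hV.locallyIntegrable.aestronglyMeasurable hE)⟩,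
      tendsto_iff_dist_tendsto_zero.2 h1, tendsto_iff_dist_tendsto_zero.2 h2⟩
  refine (iInf₂_le V hmem).trans (le_of_eq ?_)
  rw [pathEnergy, setLIntegral_univ]
  refine lintegral_congr_ae ?_
  filter_upwards [hV.hasWeakDeriv.weakDeriv_ae_eq] with x hx
  rw [hx]

theorem pathEnergy_urep (hW : IsDoubleWell α W am ap) (h : H1 m) :
    pathEnergy W Set.univ (urep am ap h) (uder am ap h) = ENNReal.ofReal (realAction W am ap h) := by
  rw [← hW.action_eq, action_affineMap, pathEnergy, setLIntegral_univ]

theorem connects_urep (hW : IsDoubleWell α W am ap) (h : H1 m) :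
    Connects {am} {ap} (dist am ap / 4) (urep am ap h) := by
  have h0 : 0 < dist am ap / 4 := by have := dist_pos.2 hW.ne; positivity
  obtain ⟨a, ha⟩ := eventually_atBot.1
    ((tendsto_urep_atBot am ap h).eventually (Metric.closedBall_mem_nhds am h0))
  obtain ⟨b, hb⟩ := eventually_atTop.1
    ((tendsto_urep_atTop am ap h).eventually (Metric.closedBall_mem_nhds ap h0))
  simp only [Metric.infDist_singleton, Connects]
  exact ⟨a, max b (a + 1), lt_of_lt_of_le (by linarith) (le_max_right _ _), fun t ht => ha t ht,
    fun t ht => hb t ((le_max_left _ _).trans ht)⟩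

/-- Functions of almost minimal action are bounded after a translation. -/
theorem exists_normalization (hW : IsDoubleWell α W am ap) :
    ∃ η > 0, ∃ B C M T : ℝ, ∀ h : H1 m, realPot W am ap h ≤ η → ∃ a,
      ‖translate am ap a h‖ ≤ B ∧
      ∀ x, ‖rep (translate am ap a h) x‖ ^ 2 ≤ C * W (urep am ap (translate am ap a h) x) +
        (Set.Icc (-1) T).indicator (fun _ => M) x := by
  obtain ⟨r, hr, c, hc, hlow⟩ := hW.exists_lower
  have hD : 0 < dist am ap := dist_pos.2 hW.ne
  set ρ := min r (dist am ap / 4) with hρdef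
  have hρ : 0 < ρ := lt_min hr (by positivity)
  obtain ⟨η, hη, T₀, hT₀⟩ := hW.twoWell.near_minimizer hρ (min_le_right _ _) hW.minAction_ne_top
    fun V g hV hc => hW.minAction_le_pathEnergy hV hc
  set J := (minAction W am ap).toReal + η with hJ
  have hJ0 : 0 ≤ J := by have := ENNReal.toReal_nonneg (a := minAction W am ap); positivity
  -- `T ≥ 1` ensures `e₀ = a⁺` to the right of `T`.
  set T := max T₀ 1 with hT
  have hT1 : 1 ≤ T := le_max_right _ _
  -- `R` bounds `|u| + |e₀|` on `[-1, T]`: `u` is `ρ`-close to `a⁻` on the negative axis, and moves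
  -- by at most `√(T · 2J)` on `[0, T]` by Cauchy–Schwarz.
  set R := ‖am‖ + ρ + √(T * (2 * J)) + ‖am‖ + ‖ap‖ with hR
  have hR0 : 0 ≤ R := by positivity
  set Bsq := (1 / c * J + R ^ 2 * (T + 1)) +
    (√(2 * J) + ‖((memLp_e0Der am ap).toLp : L2 m)‖) ^ 2 with hBsq
  refine ⟨η, hη, √Bsq, 1 / c, R ^ 2, T, fun h hh => ?_⟩
  have hact : realAction W am ap h ≤ J := by
    rw [hW.realPot_eq] at hh; simp only at hh; linarith
  have hE : pathEnergy W Set.univ (urep am ap h) (uder am ap h) ≤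
      minAction W am ap + ENNReal.ofReal η := by
    rw [hW.pathEnergy_urep, ← ENNReal.ofReal_toReal hW.minAction_ne_top,
      ← ENNReal.ofReal_add ENNReal.toReal_nonneg hη.le]
    exact ENNReal.ofReal_le_ofReal hact
  obtain ⟨s, σ, hsσ, hσT, hleft, hright⟩ := hT₀ _ _ (isPath_urep am ap h) (hW.connects_urep h) hE
  simp only [Metric.infDist_singleton] at hleft hright
  -- The translation brings to the origin a time before which the function is close to `a⁻`.
  refine ⟨s, ?_⟩
  set k := translate am ap s h with hk
  have hku : ∀ x, urep am ap k x = urep am ap h (x + s) := fun x => by rw [hk, urep_translate]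
  have hkact : realAction W am ap k ≤ J := by rw [hk, realAction_translate]; exact hact
  have hkleft : ∀ x ≤ 0, ‖urep am ap k x - am‖ ≤ ρ := fun x hx => by
    rw [hku, ← dist_eq_norm]; exact hleft _ (by linarith)
  have hkright : ∀ x ≥ T, ‖urep am ap k x - ap‖ ≤ ρ := fun x hx => by
    rw [hku, ← dist_eq_norm]
    exact hright _ (by linarith [le_max_left T₀ 1])
  have hWint : 0 ≤ ∫ x, W (urep am ap k x) := integral_nonneg fun x => hW.nonneg _
  have hder : ‖uderL am ap k‖ ^ 2 ≤ 2 * J := by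
    rw [realAction] at hkact; linarith
  have hWJ : ∫ x, W (urep am ap k x) ≤ J := by
    rw [realAction] at hkact; nlinarith [sq_nonneg ‖uderL am ap k‖]
  have hmid : ∀ x ∈ Set.Icc (0 : ℝ) T, ‖urep am ap k x‖ ≤ ‖am‖ + ρ + √(T * (2 * J)) := by
    intro x hx
    have h1 := (isPath_urep am ap k).norm_sub_sq_le hx.1 ((memLp_uder am ap k).restrict _)
    have h2 : ∫ t in (0 : ℝ)..x, ‖uder am ap k t‖ ^ 2 ≤ 2 * J := by
      rw [intervalIntegral.integral_of_le hx.1]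
      refine (setIntegral_le_integral (integrable_uder_sq am ap k)
        (ae_of_all _ fun t => sq_nonneg _)).trans ?_
      rwa [integral_uder_sq]
    have h3 : ‖urep am ap k x - urep am ap k 0‖ ^ 2 ≤ T * (2 * J) := by
      rw [sub_zero] at h1
      refine h1.trans (mul_le_mul hx.2 h2 ?_ (by linarith))
      exact intervalIntegral.integral_nonneg hx.1 fun t _ => sq_nonneg _
    have h4 : ‖urep am ap k x - urep am ap k 0‖ ≤ √(T * (2 * J)) :=
      Real.le_sqrt_of_sq_le h3
    have h5 := hkleft 0 le_rfl
    have h6 : urep am ap k x = am + (urep am ap k 0 - am) + (urep am ap k x - urep am ap k 0) := by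
      abel
    rw [h6]
    exact (norm_add₃_le).trans (by gcongr)
  have hpt : ∀ x, ‖rep k x‖ ^ 2 ≤ 1 / c * W (urep am ap k x) +
      (Set.Icc (-1) T).indicator (fun _ => R ^ 2) x := by
    intro x
    have hrep : rep k x = urep am ap k x - e0 am ap x := by rw [urep]; abel
    by_cases hx : x ∈ Set.Icc (-1) T
    · rw [Set.indicator_of_mem hx]
      have h1 : ‖urep am ap k x‖ ≤ ‖am‖ + ρ + √(T * (2 * J)) := by
        rcases le_total x 0 with h0 | h0
        · have := norm_le_norm_add_norm_sub' (urep am ap k x) am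
          have := hkleft x h0
          have := Real.sqrt_nonneg (T * (2 * J))
          linarith
        · exact hmid x ⟨h0, hx.2⟩
      have h2 : ‖rep k x‖ ≤ R := by
        rw [hrep]
        refine (norm_sub_le _ _).trans ?_
        have := norm_e0_le am ap x
        linarith
      have h3 : 0 ≤ 1 / c * W (urep am ap k x) := by have := hW.nonneg (urep am ap k x); positivity
      have := pow_le_pow_left₀ (norm_nonneg _) h2 2
      linarith
    · rw [Set.indicator_of_notMem hx, add_zero, hrep]
      rw [Set.mem_Icc, not_and_or, not_le, not_le] at hx
      rw [div_mul_eq_mul_div, one_mul, le_div_iff₀ hc, mul_comm]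
      rcases hx with hx | hx
      · rw [e0_of_le hx.le]
        exact (hlow _).1 ((hkleft x (by linarith)).trans (min_le_left _ _))
      · rw [e0_of_ge (by linarith)]
        exact (hlow _).2 ((hkright x hx.le).trans (min_le_left _ _))
  refine ⟨?_, hpt⟩
  have hfst : ‖fstL m k‖ ^ 2 ≤ 1 / c * J + R ^ 2 * (T + 1) := by
    rw [← integral_rep_sq]
    have i1 : Integrable fun x => 1 / c * W (urep am ap k x) :=
      (hW.integrable_potential k).const_mul _
    have i2 : Integrable ((Set.Icc (-1) T).indicator fun _ => R ^ 2) :=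
      (integrable_indicator_iff measurableSet_Icc).2 continuous_const.integrableOn_Icc
    have h1 : ∫ x, (Set.Icc (-1) T).indicator (fun _ => R ^ 2) x = R ^ 2 * (T + 1) := by
      rw [integral_indicator measurableSet_Icc, setIntegral_const]
      simp only [Measure.real, Real.volume_Icc, smul_eq_mul]
      rw [ENNReal.toReal_ofReal (by linarith)]; ring
    calc _ ≤ ∫ x, (1 / c * W (urep am ap k x) + (Set.Icc (-1) T).indicator (fun _ => R ^ 2) x) :=
          integral_mono_of_nonneg (ae_of_all _ fun x => sq_nonneg _) (i1.add i2) (ae_of_all _ hpt)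
      _ = 1 / c * (∫ x, W (urep am ap k x)) + R ^ 2 * (T + 1) := by
          rw [integral_add i1 i2, integral_const_mul, h1]
      _ ≤ _ := by gcongr
  have hsnd : ‖sndL m k‖ ≤ √(2 * J) + ‖((memLp_e0Der am ap).toLp : L2 m)‖ := by
    have h1 : sndL m k = uderL am ap k - (memLp_e0Der am ap).toLp := by rw [uderL]; abel
    rw [h1]
    exact (norm_sub_le _ _).trans (by gcongr; exact Real.le_sqrt_of_sq_le hder)
  refine Real.le_sqrt_of_sq_le ?_
  rw [norm_sq_eq_fstL, hBsq]
  gcongr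

end IsDoubleWell

end Normalization

/-! ### Compactness up to translations and the two-well structure of the effective potential. -/

section Compactness

variable {m : ℕ} {α : ℝ} {W : E m → ℝ} {am ap : E m}

/-- Point evaluation is bounded on `H1 m`, so weak convergence gives pointwise convergence of the
continuous representatives, which is what Fatou's lemma needs. -/
theorem WeakTendsto.tendsto_rep {k : ℕ → H1 m} {k₀ : H1 m} (h : WeakTendsto k k₀) (x : ℝ) :
    Tendsto (fun n => rep (k n) x) atTop (𝓝 (rep k₀ x)) :=
  weakTendsto_iff_tendsto.1 (h.map (evalL m x))

theorem WeakTendsto.uderL {k : ℕ → H1 m} {k₀ : H1 m} (h : WeakTendsto k k₀) (am ap : E m) :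
    WeakTendsto (fun n => uderL am ap (k n)) (uderL am ap k₀) :=
  (h.map (sndL m)).const_add _

namespace IsDoubleWell

theorem eventually_potential (hW : IsDoubleWell α W am ap) {k : ℕ → H1 m} {k₀ : H1 m}
    (h : WeakTendsto k k₀) {ε : ℝ} (hε : 0 < ε) :
    ∀ᶠ n in atTop, (∫ x, W (urep am ap k₀ x)) - ε < ∫ x, W (urep am ap (k n) x) :=
  eventually_lt_integral (fun n => hW.integrable_potential (k n)) (hW.integrable_potential k₀)
    (fun _ _ => hW.nonneg _) (ae_of_all _ fun x =>
      (hW.continuous.tendsto _).comp ((h.tendsto_rep x).const_add _)) hε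

/-- Weak lower semicontinuity of the effective potential. -/
theorem eventually_realPot (hW : IsDoubleWell α W am ap) {k : ℕ → H1 m} {k₀ : H1 m}
    (h : WeakTendsto k k₀) {ε : ℝ} (hε : 0 < ε) :
    ∀ᶠ n in atTop, realPot W am ap k₀ - ε < realPot W am ap (k n) := by
  filter_upwards [hW.eventually_potential h (half_pos hε),
    (h.uderL am ap).eventually_norm_sq (half_pos hε)] with n h1 h2
  rw [hW.realPot_eq]
  simp only [realAction]
  linarith

/-- A minimizing sequence converges to a minimal heteroclinic, up to translations. -/
theorem exists_subseq_translate (hW : IsDoubleWell α W am ap) {h : ℕ → H1 m}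
    (hlim : Tendsto (fun n => realPot W am ap (h n)) atTop (𝓝 0)) :
    ∃ (e : H1 m) (φ : ℕ → ℕ) (a : ℕ → ℝ), realPot W am ap e = 0 ∧ StrictMono φ ∧
      Tendsto (fun n => translate am ap (a n) (h (φ n))) atTop (𝓝 e) := by
  obtain ⟨η, hη, B, C, M, T, hnorm⟩ := hW.exists_normalization
  obtain ⟨N, hN⟩ := eventually_atTop.1 (hlim.eventually (ge_mem_nhds hη))
  choose a ha hpt using fun n => hnorm (h (n + N)) (hN (n + N) (Nat.le_add_left _ _))
  obtain ⟨e, φ, hφ, hw⟩ := exists_weakTendsto_subseq ha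
  set k : ℕ → H1 m := fun n => translate am ap (a (φ n)) (h (φ n + N)) with hk
  have hw : WeakTendsto k e := hw
  have hk0 : Tendsto (fun n => realPot W am ap (k n)) atTop (𝓝 0) := by
    simp only [hk, hW.realPot_translate]
    exact hlim.comp ((tendsto_add_atTop_nat N).comp hφ.tendsto_atTop)
  have he : realPot W am ap e = 0 := by
    refine le_antisymm (le_of_forall_pos_le_add fun ε hε => ?_) (realPot_nonneg e)
    obtain ⟨n, h1, h2⟩ := ((hW.eventually_realPot hw (half_pos hε)).and
      (hk0.eventually (gt_mem_nhds (half_pos hε)))).exists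
    linarith
  refine ⟨e, fun n => φ n + N, fun n => a (φ n), he, fun i j hij => ?_, ?_⟩
  · have := hφ hij
    simp only; omega
  -- convergence of the two parts of the action
  have hsum : Tendsto (fun n => realAction W am ap (k n)) atTop (𝓝 (realAction W am ap e)) := by
    rw [hW.realPot_eq] at he hk0
    simp only at he hk0
    have := hk0.add_const (minAction W am ap).toReal
    simpa [sub_eq_zero.1 he] using this
  -- Both parts of the action are weakly lower semicontinuous and their sum converges to its value
  -- at `e`, so neither part can lose mass.
  have hA : Tendsto (fun n => ‖uderL am ap (k n)‖ ^ 2) atTop (𝓝 (‖uderL am ap e‖ ^ 2)) := by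
    rw [Metric.tendsto_nhds]
    intro ε hε
    filter_upwards [(hw.uderL am ap).eventually_norm_sq hε,
      hW.eventually_potential hw (show 0 < ε / 4 by positivity),
      hsum.eventually (gt_mem_nhds (show realAction W am ap e < realAction W am ap e + ε / 4 by
        linarith))] with n h1 h2 h3
    rw [realAction, realAction] at h3
    rw [Real.dist_eq, abs_lt]
    constructor <;> linarith
  have hB : Tendsto (fun n => ∫ x, W (urep am ap (k n) x)) atTop
      (𝓝 (∫ x, W (urep am ap e x))) := by
    have := hsum.sub (hA.const_mul (1 / 2))
    simpa [realAction] using this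
  have hder := (hw.uderL am ap).tendsto_of_norm_sq hA
  have hsnd : Tendsto (fun n => ‖sndL m (k n - e)‖ ^ 2) atTop (𝓝 0) := by
    have h1 : ∀ n, sndL m (k n - e) = uderL am ap (k n) - uderL am ap e := fun n => by
      rw [map_sub, uderL, uderL]; abel
    simp only [h1]
    have := (tendsto_iff_norm_sub_tendsto_zero.1 hder).pow 2
    simpa using this
  -- convergence in `L²`
  set I : ℝ → ℝ := (Set.Icc (-1) T).indicator fun _ => M
  have iI : Integrable I :=
    (integrable_indicator_iff measurableSet_Icc).2 continuous_const.integrableOn_Icc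
  have hpk : ∀ n x, ‖rep (k n) x‖ ^ 2 ≤ C * W (urep am ap (k n) x) + I x := fun n => hpt (φ n)
  have hWx : ∀ x, Tendsto (fun n => W (urep am ap (k n) x)) atTop (𝓝 (W (urep am ap e x))) :=
    fun x => (hW.continuous.tendsto _).comp ((hw.tendsto_rep x).const_add _)
  have hpe : ∀ x, ‖rep e x‖ ^ 2 ≤ C * W (urep am ap e x) + I x := fun x =>
    le_of_tendsto_of_tendsto' ((hw.tendsto_rep x).norm.pow 2)
      (((hWx x).const_mul C).add_const (I x)) fun n => hpk n x
  -- `G n` dominates `‖k n - e‖²` pointwise and its integrals converge, because the potential part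
  -- of the action does. Fatou's lemma for the difference then gives convergence in `L²`.
  set G : ℕ → ℝ → ℝ := fun n x => 2 * (C * W (urep am ap (k n) x) + I x) +
    2 * (C * W (urep am ap e x) + I x) with hG
  set G₀ : ℝ → ℝ := fun x => 2 * (C * W (urep am ap e x) + I x) +
    2 * (C * W (urep am ap e x) + I x) with hG₀
  have iW : ∀ n, Integrable fun x => 2 * (C * W (urep am ap (k n) x) + I x) := fun n =>
    (((hW.integrable_potential (k n)).const_mul C).add iI).const_mul 2
  have iW₀ : Integrable fun x => 2 * (C * W (urep am ap e x) + I x) :=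
    (((hW.integrable_potential e).const_mul C).add iI).const_mul 2
  have hGlim : Tendsto (fun n => ∫ x, G n x) atTop (𝓝 (∫ x, G₀ x)) := by
    have e1 : ∀ n, ∫ x, G n x = 2 * (C * (∫ x, W (urep am ap (k n) x)) + ∫ x, I x) +
        ∫ x, 2 * (C * W (urep am ap e x) + I x) := fun n => by
      rw [hG, integral_add (iW n) iW₀, integral_const_mul,
        integral_add ((hW.integrable_potential (k n)).const_mul C) iI, integral_const_mul]
    have e2 : ∫ x, G₀ x = 2 * (C * (∫ x, W (urep am ap e x)) + ∫ x, I x) +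
        ∫ x, 2 * (C * W (urep am ap e x) + I x) := by
      rw [hG₀, integral_add iW₀ iW₀]
      congr 1
      rw [integral_const_mul, integral_add ((hW.integrable_potential e).const_mul C) iI,
        integral_const_mul]
    simp only [e1, e2]
    exact (((hB.const_mul C).add_const _).const_mul 2).add_const _
  have hfst : Tendsto (fun n => ‖fstL m (k n - e)‖ ^ 2) atTop (𝓝 0) := by
    rw [Metric.tendsto_nhds]
    intro ε hε
    have hd : ∀ n x, ‖rep (k n - e) x‖ ^ 2 ≤ G n x := fun n x => by
      rw [rep_sub, Pi.sub_apply, hG]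
      have h1 := norm_sub_le (rep (k n) x) (rep e x)
      have h2 := pow_le_pow_left₀ (norm_nonneg _) h1 2
      have := hpk n x
      have := hpe x
      simp only
      nlinarith [sq_nonneg (‖rep (k n) x‖ - ‖rep e x‖)]
    have hF := eventually_lt_integral (f := fun n x => G n x - ‖rep (k n - e) x‖ ^ 2) (F := G₀)
      (fun n => ((iW n).add iW₀).sub (integrable_rep_sq _)) (iW₀.add iW₀)
      (fun n x => sub_nonneg.2 (hd n x)) (ae_of_all _ fun x => by
        have h1 : Tendsto (fun n => ‖rep (k n - e) x‖ ^ 2) atTop (𝓝 0) := by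
          have := ((hw.tendsto_rep x).sub_const (rep e x)).norm.pow 2
          simpa [rep_sub] using this
        have h2 := (((((hWx x).const_mul C).add_const (I x)).const_mul 2).add_const
          (2 * (C * W (urep am ap e x) + I x))).sub h1
        simpa using h2) (half_pos hε)
    filter_upwards [hF, hGlim.eventually (gt_mem_nhds (show (∫ x, G₀ x) < (∫ x, G₀ x) + ε / 2 by
      linarith))] with n h1 h2
    have iG : Integrable (G n) := (iW n).add iW₀
    rw [integral_sub iG (integrable_rep_sq _), integral_rep_sq] at h1
    rw [Real.dist_0_eq_abs, abs_of_nonneg (sq_nonneg _)]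
    linarith
  rw [tendsto_iff_norm_sub_tendsto_zero]
  have h1 := (hfst.add hsnd).sqrt
  simp only [← norm_sq_eq_fstL, Real.sqrt_sq (norm_nonneg _), add_zero, Real.sqrt_zero] at h1
  exact h1

/-- A sequence far from the minimal heteroclinics with `𝒲 → 0` would converge, after translations,
to one of them; translating back, which is an isometry, contradicts the distance. -/
theorem infDist_minHet_coercive (hW : IsDoubleWell α W am ap) {ε : ℝ} (hε : 0 < ε) :
    ∃ c > 0, ∀ h, ε ≤ Metric.infDist h (minHet W am ap) → c ≤ realPot W am ap h := by
  by_contra hcon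
  push Not at hcon
  choose h hh1 hh2 using fun n : ℕ => hcon (1 / ((n : ℝ) + 1)) (by positivity)
  have hlim : Tendsto (fun n => realPot W am ap (h n)) atTop (𝓝 0) :=
    squeeze_zero (fun n => realPot_nonneg _) (fun n => (hh2 n).le) tendsto_one_div_add_atTop_nhds_zero_nat
  obtain ⟨e, φ, a, he, -, ht⟩ := hW.exists_subseq_translate hlim
  obtain ⟨n, hn⟩ := (ht.eventually (Metric.ball_mem_nhds e hε)).exists
  have hmem : translate am ap (-a n) e ∈ minHet W am ap := by
    rw [hW.mem_minHet_iff, hW.realPot_translate, he]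
  have h1 := Metric.infDist_le_dist_of_mem (x := h (φ n)) hmem
  have h2 : dist (h (φ n)) (translate am ap (-a n) e) =
      dist (translate am ap (a n) (h (φ n))) e := by
    rw [dist_eq_norm, dist_eq_norm, ← norm_translate_sub am ap (a n), translate_translate,
      add_neg_cancel, translate_zero]
  linarith [hh1 (φ n)]

theorem exists_norm_minHet (hW : IsDoubleWell α W am ap) :
    ∃ B, ∀ e, realPot W am ap e = 0 → ∃ a, ‖translate am ap a e‖ ≤ B := by
  obtain ⟨η, hη, B, C, M, T, hnorm⟩ := hW.exists_normalization
  refine ⟨B, fun e he => ?_⟩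
  obtain ⟨a, ha, -⟩ := hnorm e (by rw [he]; exact hη.le)
  exact ⟨a, ha⟩

/-- A translate of each minimal heteroclinic is bounded in `H1 m`, and translations do not change
the sup norm. This makes the quadratic bound of `twoWell_realPot` uniform over all wells. -/
theorem exists_sup_minHet (hW : IsDoubleWell α W am ap) :
    ∃ R, ∀ e, realPot W am ap e = 0 → ∀ x, ‖urep am ap e x‖ ≤ R := by
  obtain ⟨B, hB⟩ := hW.exists_norm_minHet
  refine ⟨‖am‖ + ‖ap‖ + 2 * B, fun e he x => ?_⟩
  obtain ⟨a, ha⟩ := hB e he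
  have := congrFun (urep_translate am ap a e) (x - a)
  simp only [sub_add_cancel] at this
  rw [← this]
  exact (norm_urep_le _ _ _ _).trans (by linarith)

end IsDoubleWell

theorem setDist_le {S T : Set (H1 m)} {s t : H1 m} (hs : s ∈ S) (ht : t ∈ T) :
    setDist S T ≤ dist s t :=
  csInf_le ⟨0, by rintro _ ⟨s, -, t, -, rfl⟩; exact norm_nonneg _⟩
    ⟨s, hs, t, ht, dist_eq_norm s t⟩

/-- The effective potential fits the abstract framework. -/
theorem IsDoubleWell.twoWell_realPot (hW : IsDoubleWell α W am ap) {Fm Fp : Set (H1 m)}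
    (hF : minHet W am ap = Fm ∪ Fp) (hFm : Fm.Nonempty) (hFp : Fp.Nonempty)
    (hd : 0 < setDist Fm Fp) : TwoWell (realPot W am ap) Fm Fp (setDist Fm Fp) where
  continuous := hW.contDiff_realPot.continuous
  nonneg := realPot_nonneg
  pos := hd
  nonempty_left := hFm
  nonempty_right := hFp
  sep _ hx _ hy := setDist_le hx hy
  quad := by
    obtain ⟨R, hR⟩ := hW.exists_sup_minHet
    obtain ⟨C, hC, h⟩ := hW.exists_realPot_le R
    refine ⟨C, hC, 1, one_pos, fun e he x hx => ?_⟩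
    rw [← hF, hW.mem_minHet_iff] at he
    exact h e x he (hR e he) hx
  coercive ε hε := by
    obtain ⟨c, hc, h⟩ := hW.infDist_minHet_coercive hε
    refine ⟨c, hc, fun x h1 h2 => h x ?_⟩
    rw [hF, Metric.le_infDist (hFm.mono Set.subset_union_left)]
    rintro y (hy | hy)
    · exact h1.trans (Metric.infDist_le_dist_of_mem hy)
    · exact h2.trans (Metric.infDist_le_dist_of_mem hy)

namespace IsDoubleWell

/-- The orbit of `e` under translations is connected and stays in `Fm ∪ Fp`. If it met `Fp`, the
difference of the distances to `Fm` and `Fp` would vanish somewhere on it; there both distances are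
zero, contrary to the separation. -/
theorem translate_mem (hW : IsDoubleWell α W am ap) {Fm Fp : Set (H1 m)}
    (hF : minHet W am ap = Fm ∪ Fp) {D : ℝ} (hP : TwoWell (realPot W am ap) Fm Fp D)
    {e : H1 m} (he : e ∈ Fm) (a : ℝ) : translate am ap a e ∈ Fm := by
  have hmem : ∀ b, translate am ap b e ∈ Fm ∪ Fp := fun b => by
    rw [← hF, hW.mem_minHet_iff, hW.realPot_translate, ← hW.mem_minHet_iff, hF]
    exact Or.inl he
  rcases hmem a with h | h
  · exact h
  exfalso
  set f : ℝ → ℝ := fun b => Metric.infDist (translate am ap b e) Fm -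
    Metric.infDist (translate am ap b e) Fp with hf
  have hfc : Continuous f :=
    ((Metric.continuous_infDist_pt _).comp (continuous_translate_param am ap e)).sub
      ((Metric.continuous_infDist_pt _).comp (continuous_translate_param am ap e))
  have h0 : f 0 ≤ 0 := by
    simp only [hf, translate_zero, Metric.infDist_zero_of_mem he, zero_sub]
    linarith [Metric.infDist_nonneg (x := e) (s := Fp)]
  have h1 : 0 ≤ f a := by
    simp only [hf, Metric.infDist_zero_of_mem h, sub_zero]
    exact Metric.infDist_nonneg
  obtain ⟨b, hb⟩ := mem_range_of_exists_le_of_exists_ge hfc ⟨0, h0⟩ ⟨a, h1⟩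
  have h2 := hP.le_infDist_add (translate am ap b e)
  have h3 : Metric.infDist (translate am ap b e) Fm = Metric.infDist (translate am ap b e) Fp :=
    sub_eq_zero.1 hb
  have hpos := hP.pos
  rcases hmem b with h | h
  · rw [Metric.infDist_zero_of_mem h] at h2 h3; linarith
  · rw [Metric.infDist_zero_of_mem h] at h2 h3; linarith

theorem infDist_translate (hW : IsDoubleWell α W am ap) {Fm Fp : Set (H1 m)}
    (hF : minHet W am ap = Fm ∪ Fp) {D : ℝ} (hP : TwoWell (realPot W am ap) Fm Fp D)
    (a : ℝ) (h : H1 m) : Metric.infDist (translate am ap a h) Fm = Metric.infDist h Fm := by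
  have hiso : Isometry (translate am ap a) := Isometry.of_dist_eq fun x y => by
    rw [dist_eq_norm, dist_eq_norm, norm_translate_sub]
  have himg : translate am ap a '' Fm = Fm := by
    refine Set.Subset.antisymm ?_ fun e he => ?_
    · rintro _ ⟨e, he, rfl⟩; exact hW.translate_mem hF hP he a
    · exact ⟨translate am ap (-a) e, hW.translate_mem hF hP he _, by
        rw [translate_translate, add_neg_cancel, translate_zero]⟩
  conv_lhs => rw [← himg]
  exact Metric.infDist_image hiso

/-- Translations of a given function that are bounded in `H¹` are bounded. -/
theorem exists_abs_le_of_norm_translate (hW : IsDoubleWell α W am ap) (e : H1 m) (B : ℝ) :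
    ∃ A, ∀ a, ‖translate am ap a e‖ ≤ B → |a| ≤ A := by
  set d := dist am ap with hd
  have hd0 : 0 < d := dist_pos.2 hW.ne
  obtain ⟨X₁, hX₁⟩ := eventually_atBot.1
    ((tendsto_urep_atBot am ap e).eventually (Metric.closedBall_mem_nhds am (half_pos hd0)))
  obtain ⟨X₂, hX₂⟩ := eventually_atTop.1
    ((tendsto_urep_atTop am ap e).eventually (Metric.closedBall_mem_nhds ap (half_pos hd0)))
  -- a lower bound of the norm
  have hlow : ∀ (k : H1 m) (a b : ℝ), a ≤ b → (∀ x ∈ Set.Ioc a b, d / 2 ≤ ‖rep k x‖) →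
      (b - a) * (d / 2) ^ 2 ≤ ‖k‖ ^ 2 := by
    intro k a b hab hk
    calc (b - a) * (d / 2) ^ 2 = ∫ _ in Set.Ioc a b, (d / 2) ^ 2 := by
          rw [setIntegral_const]
          simp only [Measure.real, Real.volume_Ioc, smul_eq_mul]
          rw [ENNReal.toReal_ofReal (by linarith)]
      _ ≤ ∫ x in Set.Ioc a b, ‖rep k x‖ ^ 2 := by
          refine setIntegral_mono_on (by simp) (integrable_rep_sq k).integrableOn
            measurableSet_Ioc fun x hx => ?_
          exact pow_le_pow_left₀ (by positivity) (hk x hx) 2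
      _ ≤ ∫ x, ‖rep k x‖ ^ 2 := setIntegral_le_integral (integrable_rep_sq k)
          (ae_of_all _ fun x => sq_nonneg _)
      _ ≤ ‖k‖ ^ 2 := by
          rw [integral_rep_sq]; exact pow_le_pow_left₀ (norm_nonneg _) (norm_fstL_le k) 2
  refine ⟨B ^ 2 / (d / 2) ^ 2 + |X₁| + |X₂| + 1, fun a ha => ?_⟩
  have hB : ‖translate am ap a e‖ ^ 2 ≤ B ^ 2 := pow_le_pow_left₀ (norm_nonneg _) ha 2
  have hrep : ∀ x, rep (translate am ap a e) x = urep am ap e (x + a) - e0 am ap x := fun x => by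
    rw [← congrFun (urep_translate am ap a e) x, urep]; abel
  have hdp : 0 < (d / 2) ^ 2 := by positivity
  have hq : 0 ≤ B ^ 2 / (d / 2) ^ 2 := by positivity
  have hX1 := neg_abs_le X₁
  have hX2 := le_abs_self X₂
  have hX1' := abs_nonneg X₁
  have hX2' := abs_nonneg X₂
  have hfin : ∀ L : ℝ, L * (d / 2) ^ 2 ≤ B ^ 2 → L ≤ B ^ 2 / (d / 2) ^ 2 := fun L hL => by
    rwa [le_div_iff₀ hdp]
  rw [abs_le]
  constructor
  · by_contra hcon
    push Not at hcon
    -- For very negative `a` the translated profile is still near `a⁻` on `(1, X₁ - a]`, where `e₀ =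
    -- a⁺`; the mismatch of at least `d / 2` bounds the length of this interval. The other case is
    -- symmetric.
    have h1 := hlow (translate am ap a e) 1 (X₁ - a) (by linarith) fun x hx => by
      rw [hrep, e0_of_ge hx.1]
      have h2 := hX₁ (x + a) (by linarith [hx.2])
      have h3 := dist_triangle_left am ap (urep am ap e (x + a))
      rw [← dist_eq_norm]; linarith
    have := hfin _ (h1.trans hB)
    linarith
  · by_contra hcon
    push Not at hcon
    have h1 := hlow (translate am ap a e) (X₂ - a) (-1) (by linarith) fun x hx => by
      rw [hrep, e0_of_le hx.2]
      have h2 := hX₂ (x + a) (by linarith [hx.1])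
      have h3 := dist_triangle_left am ap (urep am ap e (x + a))
      rw [← dist_eq_norm]; linarith
    have := hfin _ (h1.trans hB)
    linarith

/-- Bounded sequences of minimal heteroclinics are relatively compact. -/
theorem exists_subseq_minHet (hW : IsDoubleWell α W am ap) {Fm Fp : Set (H1 m)}
    (hF : minHet W am ap = Fm ∪ Fp) {D : ℝ} (hP : TwoWell (realPot W am ap) Fm Fp D)
    {e : ℕ → H1 m} (he : ∀ n, e n ∈ Fm) {B : ℝ} (hB : ∀ n, ‖e n‖ ≤ B) :
    ∃ e₀ ∈ Fm, ∃ φ : ℕ → ℕ, StrictMono φ ∧ Tendsto (e ∘ φ) atTop (𝓝 e₀) := by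
  have h0 : ∀ n, realPot W am ap (e n) = 0 := fun n => hP.zero (Or.inl (he n))
  obtain ⟨k, φ, a, hk, hφ, hlim⟩ := hW.exists_subseq_translate (h := e) (by simp [h0])
  obtain ⟨A, hA⟩ := hW.exists_abs_le_of_norm_translate k (B + 1)
  have heq : ∀ n, ‖e (φ n) - translate am ap (-a n) k‖ =
      ‖translate am ap (a n) (e (φ n)) - k‖ := fun n => by
    rw [← norm_translate_sub am ap (a n), translate_translate, add_neg_cancel, translate_zero]
  have hlim0 := tendsto_iff_norm_sub_tendsto_zero.1 hlim
  obtain ⟨N, hN⟩ := eventually_atTop.1 (hlim0.eventually (ge_mem_nhds one_pos))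
  have hab : ∀ n, -a (n + N) ∈ Metric.closedBall (0 : ℝ) A := fun n => by
    rw [mem_closedBall_zero_iff, Real.norm_eq_abs]
    refine hA _ ?_
    have h1 := hN (n + N) (Nat.le_add_left _ _)
    rw [← heq] at h1
    have h2 := norm_le_norm_add_norm_sub (e (φ (n + N))) (translate am ap (-a (n + N)) k)
    linarith [hB (φ (n + N))]
  -- The shifts bringing the limit `k` back near the bounded sequence are bounded, so a subsequence
  -- of them converges and `e` converges to a translate of `k`.
  obtain ⟨b, -, ψ, hψ, hb⟩ := (isCompact_closedBall (0 : ℝ) A).tendsto_subseq hab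
  have hmono : StrictMono fun n => φ (ψ n + N) := fun i j hij => hφ (by
    have := hψ hij; omega)
  have hconv : Tendsto (e ∘ fun n => φ (ψ n + N)) atTop (𝓝 (translate am ap b k)) := by
    have h1 : Tendsto (fun n => translate am ap (-a (ψ n + N)) k) atTop
        (𝓝 (translate am ap b k)) :=
      ((continuous_translate_param am ap k).tendsto b).comp hb
    have h2 : Tendsto (fun n => ‖e (φ (ψ n + N)) - translate am ap (-a (ψ n + N)) k‖) atTop
        (𝓝 0) := by
      simp only [heq]
      exact hlim0.comp ((tendsto_add_atTop_nat N).comp hψ.tendsto_atTop)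
    have h3 := (tendsto_zero_iff_norm_tendsto_zero.2 h2).add h1
    simpa [Function.comp_def] using h3
  refine ⟨_, ?_, _, hmono, hconv⟩
  have hmem : translate am ap b k ∈ Fm ∪ Fp := by
    rw [← hF, hW.mem_minHet_iff, hW.realPot_translate, hk]
  rcases hmem with h | h
  · exact h
  · exfalso
    obtain ⟨n, hn⟩ := (hconv.eventually (Metric.ball_mem_nhds _ hP.pos)).exists
    exact absurd (hP.sep _ (he _) _ h) (not_le.2 hn)

end IsDoubleWell

end Compactness

section Existence

/-! ### Existence of minimizing connections in a Hilbert space -/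

variable {X : Type*} [NormedAddCommGroup X] [InnerProductSpace ℝ X] [CompleteSpace X]

theorem WeakTendsto.exists_bound {x : ℕ → X} {y : X} (h : WeakTendsto x y) :
    ∃ B, ∀ n, ‖x n‖ ≤ B := by
  obtain ⟨B, hB⟩ := banach_steinhaus (g := fun n => innerSL ℝ (x n)) fun z => by
    obtain ⟨C, hC⟩ := (h z).norm.bddAbove_range
    exact ⟨C, fun n => hC ⟨n, rfl⟩⟩
  exact ⟨B, fun n => by simpa using hB n⟩

theorem WeakTendsto.norm_le {x : ℕ → X} {y : X} (h : WeakTendsto x y) {r : ℝ} (hr : 0 ≤ r)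
    (hx : ∀ ε > 0, ∀ᶠ n in atTop, ‖x n‖ ≤ r + ε) : ‖y‖ ≤ r := by
  refine le_of_forall_pos_le_add fun ε hε => ?_
  refine (pow_le_pow_iff_left₀ (norm_nonneg _) (by positivity) two_ne_zero).1
    (le_of_forall_pos_le_add fun δ hδ => ?_)
  obtain ⟨n, h1, h2⟩ := ((h.eventually_norm_sq hδ).and (hx ε hε)).exists
  have := pow_le_pow_left₀ (norm_nonneg _) h2 2
  linarith

/-- The distance to a set whose bounded sequences are relatively compact is weakly lower
semicontinuous. -/
theorem WeakTendsto.infDist_le {S : Set X} (hS : S.Nonempty)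
    (hcpt : ∀ e : ℕ → X, (∀ n, e n ∈ S) → ∀ B, (∀ n, ‖e n‖ ≤ B) →
      ∃ e₀ ∈ S, ∃ φ : ℕ → ℕ, StrictMono φ ∧ Tendsto (e ∘ φ) atTop (𝓝 e₀))
    {x : ℕ → X} {y : X} (h : WeakTendsto x y) {r : ℝ} (hr : ∀ n, Metric.infDist (x n) S ≤ r) :
    Metric.infDist y S ≤ r := by
  have h0 : ∀ n : ℕ, 0 < 1 / ((n : ℝ) + 1) := fun n => by positivity
  choose e heS he using fun n => (Metric.infDist_lt_iff hS).1
    (lt_of_le_of_lt (hr n) (lt_add_of_pos_right r (h0 n)))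
  obtain ⟨B, hB⟩ := h.exists_bound
  have hle1 : ∀ n : ℕ, 1 / ((n : ℝ) + 1) ≤ 1 := fun n => by
    rw [div_le_one (by positivity)]; linarith [(n.cast_nonneg : (0 : ℝ) ≤ n)]
  obtain ⟨e₀, he₀, φ, hφ, hlim⟩ := hcpt e heS (B + (r + 1)) fun n => by
    have h1 := norm_le_norm_add_norm_sub (x n) (e n)
    have h2 := he n
    rw [dist_eq_norm] at h2
    rw [norm_sub_rev] at h1
    linarith [hB n, hle1 n, norm_sub_rev (x n) (e n)]
  have hr0 : 0 ≤ r := Metric.infDist_nonneg.trans (hr 0)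
  -- `xₙ - eₙ` converges weakly to `y - e₀`, and its norms are below `r + 1/(n + 1)`.
  have hw := (h.comp hφ).sub (WeakTendsto.of_tendsto hlim)
  refine (Metric.infDist_le_dist_of_mem he₀).trans ?_
  rw [dist_eq_norm]
  refine hw.norm_le hr0 fun ε hε => ?_
  filter_upwards [(tendsto_one_div_add_atTop_nhds_zero_nat.comp hφ.tendsto_atTop).eventually
    (gt_mem_nhds hε)] with n hn
  have h2 := he (φ n)
  rw [dist_eq_norm] at h2
  simp only [Function.comp] at hn ⊢
  linarith

theorem liminf_add_liminf_le (u v : ℕ → ℝ≥0∞) :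
    liminf u atTop + liminf v atTop ≤ liminf (fun n => u n + v n) atTop := by
  by_cases hu : liminf u atTop = 0
  · rw [hu, zero_add]; exact liminf_le_liminf (Eventually.of_forall fun n => le_add_self)
  by_cases hv : liminf v atTop = 0
  · rw [hv, add_zero]; exact liminf_le_liminf (Eventually.of_forall fun n => le_self_add)
  refine le_of_forall_lt fun c hc => ?_
  obtain ⟨a, ha, b, hb, hab⟩ := ENNReal.exists_lt_add_of_lt_add hc hu hv
  refine hab.trans_le (le_liminf_of_le (by isBoundedDefault) ?_)
  filter_upwards [eventually_lt_of_lt_liminf ha, eventually_lt_of_lt_liminf hb] with n h1 h2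
  exact add_le_add h1.le h2.le

theorem pathEnergy_eq_add {P : X → ℝ} (hP : ∀ x, 0 ≤ P x) {V g : ℝ → X} (hg : MemLp g 2 volume) :
    pathEnergy P Set.univ V g =
      ENNReal.ofReal ((1 / 2) * ‖hg.toLp g‖ ^ 2) + ∫⁻ t, ENNReal.ofReal (P (V t)) := by
  have h1 : ‖hg.toLp g‖ ^ 2 = ∫ t, ‖g t‖ ^ 2 := by
    rw [← real_inner_self_eq_norm_sq, L2.inner_def]
    refine integral_congr_ae ?_
    filter_upwards [hg.coeFn_toLp] with t ht
    rw [ht, real_inner_self_eq_norm_sq]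
  rw [pathEnergy, setLIntegral_univ, h1, ← integral_const_mul,
    ofReal_integral_eq_lintegral_ofReal (((memLp_two_iff_integrable_sq_norm hg.1).1 hg).const_mul _)
      (ae_of_all _ fun t => by positivity),
    ← lintegral_add_left' ((hg.1.norm.aemeasurable.pow_const 2).const_mul _).ennreal_ofReal]
  exact lintegral_congr fun t => ENNReal.ofReal_add (by positivity) (hP _)

/-- Weak lower semicontinuity of the energy. -/
theorem pathEnergy_le_liminf {P : X → ℝ} (hc : Continuous P) (hP : ∀ x, 0 ≤ P x)
    (hwl : ∀ (x : ℕ → X) (y : X), WeakTendsto x y → ∀ ε > 0, ∀ᶠ n in atTop, P y - ε < P (x n))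
    {V g : ℕ → ℝ → X} {V₀ g₀ : ℝ → X} (hV : ∀ n, Continuous (V n)) (hg : ∀ n, MemLp (g n) 2 volume)
    (hg₀ : MemLp g₀ 2 volume) (hVw : ∀ t, WeakTendsto (fun n => V n t) (V₀ t))
    (hgw : WeakTendsto (fun n => (hg n).toLp (g n)) (hg₀.toLp g₀)) :
    pathEnergy P Set.univ V₀ g₀ ≤ liminf (fun n => pathEnergy P Set.univ (V n) (g n)) atTop := by
  simp only [pathEnergy_eq_add hP, hg₀, hg]
  refine le_trans (add_le_add ?_ ?_) (liminf_add_liminf_le _ _)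
  · refine ofReal_le_liminf fun ε hε => ?_
    filter_upwards [hgw.eventually_norm_sq hε] with n hn
    linarith
  · refine (lintegral_mono fun t => ofReal_le_liminf fun ε hε => hwl _ _ (hVw t) ε hε).trans ?_
    exact lintegral_liminf_le fun n => (hc.comp (hV n)).measurable.ennreal_ofReal

/-- Pairing an integral over an interval with `z` is pairing with the `L²` function equal to `z` on
the interval. With convergence at `t = 0`, this gives weak convergence of the paths at every time.
-/
theorem WeakTendsto.intervalIntegral {g : ℕ → ℝ → X} {g₀ : ℝ → X}
    (hg : ∀ n, MemLp (g n) 2 volume) (hg₀ : MemLp g₀ 2 volume)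
    (h : WeakTendsto (fun n => (hg n).toLp (g n)) (hg₀.toLp g₀)) (a b : ℝ) :
    WeakTendsto (fun n => ∫ t in a..b, g n t) (∫ t in a..b, g₀ t) := by
  have key : ∀ a b : ℝ, WeakTendsto (fun n => ∫ t in Set.Ioc a b, g n t)
      (∫ t in Set.Ioc a b, g₀ t) := fun a b z => by
    have e : ∀ {f : ℝ → X} (hf : MemLp f 2 volume), inner ℝ (∫ t in Set.Ioc a b, f t) z =
        inner ℝ (hf.toLp f) (indicatorConstLp 2 (measurableSet_Ioc (a := a) (b := b))
          (measure_Ioc_lt_top (μ := volume)).ne z) := fun {f} hf => by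
      rw [real_inner_comm, real_inner_comm _ (hf.toLp f),
        L2.inner_indicatorConstLp_eq_inner_setIntegral]
      congr 1
      exact setIntegral_congr_ae measurableSet_Ioc
        (by filter_upwards [hf.coeFn_toLp] with t ht _ using ht.symm)
    simp only [e hg₀, e (hg _)]
    exact h _
  exact (key a b).sub (key b a)

namespace TwoWell

variable {P : X → ℝ} {Fm Fp : Set X} {D : ℝ}

theorem exists_finite (h : TwoWell P Fm Fp D) :
    ∃ V g : ℝ → X, IsPath V g ∧ Connects Fm Fp (D / 4) V ∧ pathEnergy P Set.univ V g ≠ ⊤ := by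
  obtain ⟨em, hem⟩ := h.nonempty_left
  obtain ⟨ep, hep⟩ := h.nonempty_right
  -- The scalar factor is `-1` for `t ≤ 0` and `0` for `t ≥ 1`: the affine segment from `em` to
  -- `ep`, at rest outside `[0, 1]`.
  have hV := (((isPath_id.stopped 0).sub (isPath_id.stopped 1)).smul_const (ep - em)).const_add ep
  have h0 : ∀ t ≤ (0 : ℝ), ep + (((fun t : ℝ => max t 0) - (fun t : ℝ => max t 1) : ℝ → ℝ) t) • (ep - em) = em :=
    fun t ht => by
      rw [Pi.sub_apply, max_eq_right ht, max_eq_right (ht.trans zero_le_one)]; simp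
  have h1 : ∀ t ≥ (1 : ℝ), ep + (((fun t : ℝ => max t 0) - (fun t : ℝ => max t 1) : ℝ → ℝ) t) • (ep - em) = ep :=
    fun t ht => by
      rw [Pi.sub_apply, max_eq_left (zero_le_one.trans ht), max_eq_left ht]; simp
  have hD := h.pos
  refine ⟨_, _, hV, ⟨0, 1, zero_lt_one, fun t ht => ?_, fun t ht => ?_⟩, ?_⟩
  · simp only; rw [h0 t ht, Metric.infDist_zero_of_mem hem]; positivity
  · simp only; rw [h1 t ht, Metric.infDist_zero_of_mem hep]; positivity
  obtain ⟨M, hM⟩ := isCompact_Icc.exists_bound_of_continuousOn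
    (s := Set.Icc (0 : ℝ) 1) (h.continuous.comp hV.continuous).continuousOn
  rw [pathEnergy, setLIntegral_univ]
  refine ne_top_of_le_ne_top (b := ∫⁻ t, (Set.Icc (0 : ℝ) 1).indicator
    (fun _ => ENNReal.ofReal ((1 / 2) * ‖ep - em‖ ^ 2 + M)) t) ?_ (lintegral_mono fun t => ?_)
  · rw [lintegral_indicator measurableSet_Icc, setLIntegral_const]
    exact ENNReal.mul_ne_top ENNReal.ofReal_ne_top (by simp)
  by_cases ht : t ∈ Set.Icc (0 : ℝ) 1
  · rw [Set.indicator_of_mem ht]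
    refine ENNReal.ofReal_le_ofReal (add_le_add ?_ ((le_abs_self _).trans (hM t ht)))
    rw [norm_smul, mul_pow]
    have : ‖((Set.Ioi (0 : ℝ)).indicator (fun _ => (1 : ℝ)) -
        (Set.Ioi (1 : ℝ)).indicator fun _ => (1 : ℝ)) t‖ ^ 2 ≤ 1 := by
      simp only [Pi.sub_apply, Set.indicator_apply]
      split_ifs <;> norm_num
    have h3 := sq_nonneg ‖ep - em‖
    nlinarith
  · rw [Set.indicator_of_notMem ht]
    rw [Set.mem_Icc, not_and_or, not_le, not_le] at ht
    rcases ht with ht | ht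
    · rw [h0 t ht.le, h.zero (Or.inl hem)]
      simp [ht.le.not_gt, (ht.trans one_pos).le.not_gt]
    · rw [h1 t ht.le, h.zero (Or.inr hep)]
      simp [ht, one_pos.trans ht]

/-- Existence of minimizing connections between two sets of wells, modulo a group of isometries. -/
theorem exists_minimizer (h : TwoWell P Fm Fp D)
    (hwl : ∀ (x : ℕ → X) (y : X), WeakTendsto x y → ∀ ε > 0, ∀ᶠ n in atTop, P y - ε < P (x n))
    (hcm : ∀ e : ℕ → X, (∀ n, e n ∈ Fm) → ∀ B, (∀ n, ‖e n‖ ≤ B) →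
      ∃ e₀ ∈ Fm, ∃ φ : ℕ → ℕ, StrictMono φ ∧ Tendsto (e ∘ φ) atTop (𝓝 e₀))
    (hcp : ∀ e : ℕ → X, (∀ n, e n ∈ Fp) → ∀ B, (∀ n, ‖e n‖ ≤ B) →
      ∃ e₀ ∈ Fp, ∃ φ : ℕ → ℕ, StrictMono φ ∧ Tendsto (e ∘ φ) atTop (𝓝 e₀))
    (hnorm : ∃ B, ∀ e ∈ Fm, ∃ (c : X) (L : X →ₗᵢ[ℝ] X), (∀ x, P (c + L x) = P x) ∧
      (∀ x, Metric.infDist (c + L x) Fm = Metric.infDist x Fm) ∧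
      (∀ x, Metric.infDist (c + L x) Fp = Metric.infDist x Fp) ∧ ‖c + L e‖ ≤ B) :
    ∃ V g : ℝ → X, IsPath V g ∧ Connects Fm Fp (D / 4) V ∧ pathEnergy P Set.univ V g ≠ ⊤ ∧
      ∀ V' g' : ℝ → X, IsPath V' g' → Connects Fm Fp (D / 4) V' →
        pathEnergy P Set.univ V g ≤ pathEnergy P Set.univ V' g' := by
  have hD := h.pos
  let S : Set ℝ≥0∞ := {a | ∃ V g : ℝ → X, IsPath V g ∧ Connects Fm Fp (D / 4) V ∧
    a = pathEnergy P Set.univ V g}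
  set I : ℝ≥0∞ := sInf S with hI
  have hmin : ∀ V g : ℝ → X, IsPath V g → Connects Fm Fp (D / 4) V →
      I ≤ pathEnergy P Set.univ V g := fun V g h1 h2 => sInf_le ⟨V, g, h1, h2, rfl⟩
  have hItop : I ≠ ⊤ := by
    obtain ⟨V, g, h1, h2, h3⟩ := h.exists_finite
    exact ne_top_of_le_ne_top h3 (hmin V g h1 h2)
  obtain ⟨η, hη, T, hnear⟩ := h.near_minimizer (ρ := D / 4) (by positivity) le_rfl hItop hmin
  obtain ⟨B, hB⟩ := hnorm
  -- a normalized minimizing sequence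
  have hseq : ∀ n : ℕ, ∃ V g : ℝ → X, IsPath V g ∧
      (∀ t ≤ 0, Metric.infDist (V t) Fm ≤ D / 4) ∧ (∀ t ≥ T, Metric.infDist (V t) Fp ≤ D / 4) ∧
      ‖V 0‖ ≤ B + D ∧ pathEnergy P Set.univ V g ≤ I + ENNReal.ofReal (min η (1 / ((n : ℝ) + 1))) := by
    intro n
    have hpos : 0 < min η (1 / ((n : ℝ) + 1)) := lt_min hη (by positivity)
    obtain ⟨_, ⟨V, g, hV, hc, rfl⟩, hlt⟩ := sInf_lt_iff.1
      (show sInf S < I + ENNReal.ofReal (min η (1 / ((n : ℝ) + 1))) from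
        ENNReal.lt_add_right hItop (by simpa using hpos))
    -- Time is shifted by `s`, so the constraints hold from `0` and `T` on, uniformly in `n`. The
    -- isometry that makes a well close to `V s` bounded then bounds `V` at time `0`.
    obtain ⟨s, σ, hsσ, hσ, hl, hr⟩ := hnear V g hV hc (hlt.le.trans
      (by gcongr; exact min_le_left _ _))
    obtain ⟨e, he, hVe⟩ := (Metric.infDist_lt_iff h.nonempty_left).1
      (lt_of_le_of_lt (hl s le_rfl) (show D / 4 < D by linarith))
    obtain ⟨c, L, hP, hm, hp, hn⟩ := hB e he
    refine ⟨_, _, ((hV.comp_add s).map L.toContinuousLinearMap).const_add c, fun t ht => ?_,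
      fun t ht => ?_, ?_, ?_⟩
    · exact (hm _).trans_le (hl _ (by linarith))
    · exact (hp _).trans_le (hr _ (by linarith))
    · have h1 : ‖(c + L (V s)) - (c + L e)‖ < D := by
        rw [add_sub_add_left_eq_sub, ← map_sub, L.norm_map, ← dist_eq_norm]; exact hVe
      have h2 := norm_le_norm_add_norm_sub (c + L e) (c + L (V s))
      simp only [zero_add]
      change ‖c + L (V s)‖ ≤ _
      rw [norm_sub_rev] at h2
      linarith [norm_sub_rev (c + L e) (c + L (V s))]
    · refine le_trans (le_of_eq ?_) hlt.le
      rw [← pathEnergy_comp_add P V g s]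
      simp only [pathEnergy]
      refine lintegral_congr fun t => ?_
      change ENNReal.ofReal (1 / 2 * ‖L (g (t + s))‖ ^ 2 + P (c + L (V (t + s)))) = _
      rw [hP, L.norm_map]
  choose V g hV hl hr h0 hE using hseq
  have hfin : ∀ n, pathEnergy P Set.univ (V n) (g n) ≠ ⊤ := fun n =>
    ne_top_of_le_ne_top (ENNReal.add_ne_top.2 ⟨hItop, ENNReal.ofReal_ne_top⟩) (hE n)
  have hg : ∀ n, MemLp (g n) 2 volume := fun n =>
    memLp_of_pathEnergy h.nonneg (hV n).locallyIntegrable.aestronglyMeasurable (hfin n)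
  have hgb : ∀ n, ‖(hg n).toLp (g n)‖ ≤ √(2 * (I.toReal + η)) := fun n => by
    have h1 : ENNReal.ofReal ((1 / 2) * ‖(hg n).toLp (g n)‖ ^ 2) ≤ ENNReal.ofReal (I.toReal + η) := by
      rw [ENNReal.ofReal_add ENNReal.toReal_nonneg hη.le, ENNReal.ofReal_toReal hItop]
      refine le_trans ?_ ((hE n).trans (by gcongr; exact min_le_left _ _))
      rw [pathEnergy_eq_add h.nonneg (hg n)]
      exact le_self_add
    have hpos : 0 ≤ I.toReal + η := add_nonneg ENNReal.toReal_nonneg hη.le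
    rw [ENNReal.ofReal_le_ofReal_iff hpos] at h1
    exact Real.le_sqrt_of_sq_le (by linarith)
  -- weak limits
  obtain ⟨G, φ, hφ, hGw⟩ := exists_weakTendsto_subseq hgb
  obtain ⟨v₀, ψ, hψ, hv⟩ := exists_weakTendsto_subseq (x := fun n => V (φ n) 0) fun n => h0 (φ n)
  set k : ℕ → ℕ := φ ∘ ψ with hk
  have hkm : StrictMono k := hφ.comp hψ
  have hG : MemLp (G : ℝ → X) 2 volume := Lp.memLp G
  have hgw : WeakTendsto (fun n => (hg (k n)).toLp (g (k n))) (hG.toLp G) := by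
    rw [Lp.toLp_coeFn]; exact hGw.comp hψ
  have hU := IsPath.of_locallyIntegrable (hG.locallyIntegrable (by norm_num)) v₀
  have hVw : ∀ t, WeakTendsto (fun n => V (k n) t) (v₀ + ∫ s in (0 : ℝ)..t, G s) := fun t => by
    have h1 := hv.add (WeakTendsto.intervalIntegral (fun n => hg (k n)) hG hgw 0 t)
    have h2 : (fun n => V (k n) t) = fun n => ((fun n => V (φ n) 0) ∘ ψ) n +
      ∫ s in (0 : ℝ)..t, g (k n) s := funext fun n => (hV (k n)).eq_add 0 t
    rw [h2]; exact h1
  have hle : pathEnergy P Set.univ (fun t => v₀ + ∫ s in (0 : ℝ)..t, G s) G ≤ I := by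
    refine (pathEnergy_le_liminf h.continuous h.nonneg hwl (fun n => (hV (k n)).continuous)
      (fun n => hg (k n)) hG hVw hgw).trans ?_
    refine ENNReal.le_of_forall_pos_le_add fun ε hε _ => ?_
    refine liminf_le_of_frequently_le' (Eventually.frequently ?_)
    filter_upwards [(tendsto_one_div_add_atTop_nhds_zero_nat.comp hkm.tendsto_atTop).eventually
      (gt_mem_nhds (show (0 : ℝ) < ε from hε))] with n hn
    refine (hE (k n)).trans ?_
    gcongr
    refine ENNReal.ofReal_le_of_le_toReal ?_
    exact (min_le_right _ _).trans hn.le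
  refine ⟨_, _, hU, ⟨0, max T 1, by positivity, fun t ht => ?_, fun t ht => ?_⟩,
    ne_top_of_le_ne_top hItop hle, fun V' g' h1 h2 => hle.trans (hmin V' g' h1 h2)⟩
  · exact (hVw t).infDist_le h.nonempty_left hcm fun n => hl _ t ht
  · exact (hVw t).infDist_le h.nonempty_right hcp fun n => hr _ t ((le_max_left _ _).trans ht)

end TwoWell

end Existence

section Variation

/-! ### The Euler-Lagrange equation -/

section EulerLagrange

variable {X : Type*} [NormedAddCommGroup X] [InnerProductSpace ℝ X] [CompleteSpace X]

theorem inner_gradient_eq {P : X → ℝ} (x v : X) : inner ℝ (gradient P x) v = fderiv ℝ P x v := by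
  rw [gradient, InnerProductSpace.toDual_symm_apply]

theorem continuous_gradient_of_contDiff {P : X → ℝ} (hP : ContDiff ℝ 1 P) :
    Continuous (gradient P) :=
  (InnerProductSpace.toDual ℝ X).symm.continuous.comp (hP.continuous_fderiv one_ne_zero)

/-- If two paths of finite energy agree outside `S` then their energies are compared on `S`. -/
theorem pathEnergy_le_of_le {P : X → ℝ} {S : Set ℝ} (hS : MeasurableSet S) {V g V' g' : ℝ → X}
    (hfin : pathEnergy P Set.univ V g ≠ ⊤)
    (hle : pathEnergy P Set.univ V g ≤ pathEnergy P Set.univ V' g')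
    (hV : ∀ t ∉ S, V t = V' t) (hg : ∀ t ∉ S, g t = g' t) :
    pathEnergy P S V g ≤ pathEnergy P S V' g' := by
  rw [← Set.union_compl_self S, pathEnergy_union hS.compl disjoint_compl_right,
    pathEnergy_union hS.compl disjoint_compl_right, ← pathEnergy_congr hS.compl hV hg] at hle
  have h2 : pathEnergy P Sᶜ V g ≠ ⊤ :=
    ne_top_of_le_ne_top hfin (pathEnergy_mono (Set.subset_univ _) V g)
  exact (ENNReal.add_le_add_iff_right h2).1 hle

/-- Outside `[-R, R]` the perturbation vanishes and the finite energy there cancels, so minimality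
holds on the compact interval. The energy is differentiated there under the integral at `ε = 0`,
with `g` only square integrable. -/
theorem firstVariation {P : X → ℝ} (hP : ContDiff ℝ 1 P) (hP0 : ∀ x, 0 ≤ P x) {U g : ℝ → X}
    (hU : IsPath U g) (hg : MemLp g 2 volume) {φ φ' : ℝ → ℝ} (hφ : ∀ t, HasDerivAt φ (φ' t) t)
    (hφ' : Continuous φ') {R : ℝ} (h0 : ∀ t ∉ Set.Icc (-R) R, φ t = 0)
    (h0' : ∀ t ∉ Set.Icc (-R) R, φ' t = 0) (k : X) (hfin : pathEnergy P Set.univ U g ≠ ⊤)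
    (hmin : ∀ ε : ℝ, pathEnergy P Set.univ U g ≤
      pathEnergy P Set.univ (fun t => U t + (ε * φ t) • k) (fun t => g t + (ε * φ' t) • k)) :
    ∫ t in Set.Icc (-R) R, (φ' t * inner ℝ (g t) k + φ t * fderiv ℝ P (U t) k) = 0 := by
  set S := Set.Icc (-R) R
  have hφc : Continuous φ := continuous_iff_continuousAt.2 fun t => (hφ t).continuousAt
  have hUc := hU.continuous
  have hgS : MemLp g 2 (volume.restrict S) := hg.restrict S
  have hDc : Continuous (fderiv ℝ P) := hP.continuous_fderiv one_ne_zero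
  let F : ℝ → ℝ → ℝ := fun ε t => (1 / 2) * ‖g t + (ε * φ' t) • k‖ ^ 2 + P (U t + (ε * φ t) • k)
  let F' : ℝ → ℝ → ℝ := fun ε t => inner ℝ (g t + (ε * φ' t) • k) (φ' t • k) +
    fderiv ℝ P (U t + (ε * φ t) • k) (φ t • k)
  have hkS : ∀ ε, MemLp (fun t => (ε * φ' t) • k) 2 (volume.restrict S) := fun ε =>
    memL2loc_of_continuous ((continuous_const.mul hφ').smul continuous_const) _ isCompact_Icc
  have hFi : ∀ ε, Integrable (F ε) (volume.restrict S) := fun ε => by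
    refine Integrable.add ?_ ?_
    · exact ((memLp_two_iff_integrable_sq_norm (hgS.add (hkS ε)).1).1 (hgS.add (hkS ε))).const_mul _
    · exact (hP.continuous.comp (hUc.add ((continuous_const.mul hφc).smul
        continuous_const))).continuousOn.integrableOn_compact isCompact_Icc
  have hF0 : ∀ ε t, 0 ≤ F ε t := fun ε t => add_nonneg (by positivity) (hP0 _)
  have hEF : ∀ ε, pathEnergy P S (fun t => U t + (ε * φ t) • k) (fun t => g t + (ε * φ' t) • k) =
      ENNReal.ofReal (∫ t in S, F ε t) := fun ε =>
    (ofReal_integral_eq_lintegral_ofReal (hFi ε) (ae_of_all _ (hF0 ε))).symm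
  have hmin' : ∀ ε, ∫ t in S, F 0 t ≤ ∫ t in S, F ε t := fun ε => by
    have h1 := pathEnergy_le_of_le measurableSet_Icc hfin (hmin ε) (S := S)
      (fun t ht => by simp [h0 t ht]) (fun t ht => by simp [h0' t ht])
    have h2 := hEF 0
    simp only [zero_mul, zero_smul, add_zero] at h2
    rw [h2, hEF] at h1
    exact (ENNReal.ofReal_le_ofReal_iff (integral_nonneg (hF0 ε))).1 h1
  -- bounds
  obtain ⟨M, hM⟩ := (isCompact_Icc.prod isCompact_Icc).exists_bound_of_continuousOn
    (s := Set.Icc (-1 : ℝ) 1 ×ˢ S)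
    (f := fun p : ℝ × ℝ => fderiv ℝ P (U p.2 + (p.1 * φ p.2) • k) (φ p.2 • k))
    ((hDc.comp ((hUc.comp continuous_snd).add ((continuous_fst.mul
      (hφc.comp continuous_snd)).smul continuous_const))).clm_apply
      ((hφc.comp continuous_snd).smul continuous_const)).continuousOn
  obtain ⟨M₁, hM₁⟩ := (isCompact_Icc (a := -R) (b := R)).exists_bound_of_continuousOn
    (f := fun t => φ' t • k) (hφ'.smul continuous_const).continuousOn
  have hder : ∀ t ε, HasDerivAt (fun ε => F ε t) (F' ε t) ε := fun t ε => by
    have d1 : HasDerivAt (fun ε : ℝ => g t + (ε * φ' t) • k) (φ' t • k) ε := by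
      have := (((hasDerivAt_id ε).mul_const (φ' t)).smul_const k).const_add (g t)
      simpa using this
    have d2 : HasDerivAt (fun ε : ℝ => U t + (ε * φ t) • k) (φ t • k) ε := by
      have := (((hasDerivAt_id ε).mul_const (φ t)).smul_const k).const_add (U t)
      simpa using this
    have d3 := (d1.norm_sq.const_mul (1 / 2)).add
      (((hP.differentiable one_ne_zero _).hasFDerivAt).comp_hasDerivAt ε d2)
    refine d3.congr_deriv ?_
    simp only [F']
    ring
  have hkey := hasDerivAt_integral_of_dominated_loc_of_deriv_le (μ := volume.restrict S) (F := F)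
    (F' := F') (x₀ := (0 : ℝ)) (s := Set.Icc (-1) 1) (bound := fun t => (‖g t‖ + M₁) * M₁ + M)
    (Icc_mem_nhds (by norm_num) (by norm_num))
    (Eventually.of_forall fun ε => (hFi ε).aestronglyMeasurable) (hFi 0) ?_ ?_ ?_
    (ae_of_all _ fun t ε _ => hder t ε)
  · have hloc : IsLocalMin (fun ε => ∫ t in S, F ε t) 0 := Eventually.of_forall hmin'
    rw [← hloc.hasDerivAt_eq_zero hkey.2]
    refine integral_congr_ae (ae_of_all _ fun t => ?_)
    simp [F', inner_smul_right]
  · refine AEStronglyMeasurable.add ?_ ?_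
    · simp only [zero_mul, zero_smul, add_zero]
      exact hgS.1.inner ((hφ'.smul continuous_const).aestronglyMeasurable)
    · simp only [zero_mul, zero_smul, add_zero]
      exact ((hDc.comp hUc).clm_apply (hφc.smul continuous_const)).aestronglyMeasurable
  · refine (ae_restrict_iff' measurableSet_Icc).2 (ae_of_all _ fun t ht ε hε => ?_)
    have hk := hM₁ t ht
    have hM₁0 : 0 ≤ M₁ := (norm_nonneg _).trans hk
    refine (norm_add_le _ _).trans (add_le_add ((norm_inner_le_norm _ _).trans ?_)
      (hM (ε, t) ⟨hε, ht⟩))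
    have hε' : |ε| ≤ 1 := abs_le.2 hε
    have : ‖(ε * φ' t) • k‖ ≤ M₁ := by
      rw [mul_smul, norm_smul, Real.norm_eq_abs]
      exact (mul_le_of_le_one_left (norm_nonneg _) hε').trans hk
    gcongr
    exact (norm_add_le _ _).trans (by linarith)
  · have h1 : Integrable (fun t => ‖g t‖) (volume.restrict S) :=
      (hgS.integrable (by norm_num)).norm
    exact ((h1.add (integrable_const M₁)).mul_const M₁).add (integrable_const M)

namespace TwoWell

variable {P : X → ℝ} {Fm Fp : Set X} {D : ℝ}

/-- Minimizing connections are classical solutions of `U'' = ∇P(U)`. -/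
theorem exists_hasDerivAt (h : TwoWell P Fm Fp D) (hP : ContDiff ℝ 1 P) {U g : ℝ → X}
    (hU : IsPath U g) (hc : Connects Fm Fp (D / 4) U) (hfin : pathEnergy P Set.univ U g ≠ ⊤)
    (hmin : ∀ V' g' : ℝ → X, IsPath V' g' → Connects Fm Fp (D / 4) V' →
      pathEnergy P Set.univ U g ≤ pathEnergy P Set.univ V' g') :
    ∃ q : ℝ → X, (∀ t, HasDerivAt U (q t) t) ∧ (∀ t, HasDerivAt q (gradient P (U t)) t) ∧
      g =ᵐ[volume] q := by
  have hg : MemLp g 2 volume :=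
    memLp_of_pathEnergy h.nonneg hU.locallyIntegrable.aestronglyMeasurable hfin
  have hUc := hU.continuous
  have hGc : Continuous fun t => gradient P (U t) := (continuous_gradient_of_contDiff hP).comp hUc
  -- The first variation states that the continuous function `∇P(U)` is the weak derivative of `g`;
  -- hence `g` has a `C¹` representative.
  have hw : HasWeakDeriv (1 : ℝ) g fun t => gradient P (U t) := by
    refine ⟨hU.locallyIntegrable, hGc.locallyIntegrable, fun φ hφ hφc => ?_⟩
    set φ' : ℝ → ℝ := fun t => fderiv ℝ φ t 1 with hφ'
    have hd : Continuous φ' := (hφ.continuous_fderiv (by simp)).clm_apply continuous_const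
    have hdc : HasCompactSupport φ' := hφc.fderiv_apply (𝕜 := ℝ) 1
    have hder : ∀ t, HasDerivAt φ (φ' t) t := fun t => by
      simpa [φ'] using (hφ.differentiable (by simp) t).hasDerivAt
    obtain ⟨R, hR⟩ := hφc.isCompact.isBounded.subset_closedBall 0
    have hnot : ∀ t ∉ Set.Icc (-R) R, t ∉ tsupport φ := fun t ht ht' => by
      have := hR ht'
      rw [Real.closedBall_eq_Icc, zero_sub, zero_add] at this
      exact ht this
    have h0 : ∀ t ∉ Set.Icc (-R) R, φ t = 0 := fun t ht =>
      image_eq_zero_of_notMem_tsupport (hnot t ht)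
    have h0' : ∀ t ∉ Set.Icc (-R) R, φ' t = 0 := fun t ht => by
      rw [hφ']; simp only; rw [fderiv_of_notMem_tsupport (𝕜 := ℝ) (hnot t ht)]; rfl
    have i1 : Integrable fun t => φ' t • g t :=
      hU.locallyIntegrable.integrable_smul_left_of_hasCompactSupport hd hdc
    have i2 : Integrable fun t => φ t • gradient P (U t) :=
      hGc.locallyIntegrable.integrable_smul_left_of_hasCompactSupport hφ.continuous hφc
    change ∫ t, φ' t • g t = _
    rw [eq_neg_iff_add_eq_zero, ← integral_add i1 i2]
    refine ext_inner_right ℝ fun k => ?_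
    have i12 : Integrable fun t => φ' t • g t + φ t • gradient P (U t) := i1.add i2
    rw [inner_zero_left, real_inner_comm, ← integral_inner i12]
    have hfv := firstVariation hP h.nonneg hU hg hder hd h0 h0' k hfin fun ε => by
      have hpath : IsPath (fun t => U t + (ε * φ t) • k) (fun t => g t + (ε * φ' t) • k) := by
        have h1 : IsPath φ φ' := IsPath.of_hasDerivAt hder hd
        exact hU.add ((h1.const_smul ε).smul_const k)
      refine hmin _ _ hpath ?_
      obtain ⟨tm, tp, h1, h2, h3⟩ := hc
      -- The times are pushed beyond the support of `φ`, where the perturbed path is `U` itself.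
      refine ⟨min tm (-|R| - 1), max tp (|R| + 1),
        (min_le_left _ _).trans_lt (h1.trans_le (le_max_left _ _)), fun t ht => ?_, fun t ht => ?_⟩
      · have : φ t = 0 := h0 t fun hm => by
          have h4 := ht.trans (min_le_right _ _)
          linarith [hm.1, le_abs_self R]
        simpa [this] using h2 t (ht.trans (min_le_left _ _))
      · have : φ t = 0 := h0 t fun hm => by
          have h4 := (le_max_right _ _).trans ht
          linarith [hm.2, le_abs_self R]
        simpa [this] using h3 t ((le_max_left _ _).trans ht)
    rw [setIntegral_eq_integral_of_forall_compl_eq_zero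
      (fun t ht => by rw [h0 t ht, h0' t ht]; ring)] at hfv
    rw [← hfv]
    refine integral_congr_ae (ae_of_all _ fun t => ?_)
    simp only
    rw [real_inner_comm, inner_add_left, real_inner_smul_left, real_inner_smul_left,
      inner_gradient_eq]
  obtain ⟨q, hq, he⟩ := hw.exists_isPath
  exact ⟨q, (hU.congr_ae he).hasDerivAt hq.continuous, hq.hasDerivAt hGc, he⟩

end TwoWell

/-- Equipartition of the energy. -/
theorem equipartition {P : X → ℝ} (hP : ContDiff ℝ 1 P) (hP0 : ∀ x, 0 ≤ P x) {U q : ℝ → X}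
    (hU : ∀ t, HasDerivAt U (q t) t) (hq : ∀ t, HasDerivAt q (gradient P (U t)) t)
    (hfin : pathEnergy P Set.univ U q ≠ ⊤) (t : ℝ) : (1 / 2) * ‖q t‖ ^ 2 = P (U t) := by
  have hUc : Continuous U := continuous_iff_continuousAt.2 fun t => (hU t).continuousAt
  have hqc : Continuous q := continuous_iff_continuousAt.2 fun t => (hq t).continuousAt
  set H : ℝ → ℝ := fun t => (1 / 2) * ‖q t‖ ^ 2 - P (U t) with hH
  have hd : ∀ t, HasDerivAt H 0 t := fun t => by
    have d := ((hq t).norm_sq.const_mul (1 / 2)).sub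
      (((hP.differentiable one_ne_zero _).hasFDerivAt).comp_hasDerivAt t (hU t))
    refine d.congr_deriv ?_
    rw [← inner_gradient_eq, real_inner_comm]
    ring
  have hconst : ∀ s, H s = H t := fun s =>
    is_const_of_deriv_eq_zero (fun s => (hd s).differentiableAt) (fun s => (hd s).deriv) s t
  have hint : Integrable fun t => (1 / 2) * ‖q t‖ ^ 2 + P (U t) := by
    refine ⟨((continuous_const.mul (hqc.norm.pow 2)).add
      (hP.continuous.comp hUc)).aestronglyMeasurable, ?_⟩
    rw [hasFiniteIntegral_iff_ofReal (ae_of_all _ fun t => add_nonneg (by positivity) (hP0 _))]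
    rw [pathEnergy, setLIntegral_univ] at hfin
    exact hfin.lt_top
  -- The conserved quantity is dominated by the integrable energy density, and the line has infinite
  -- measure.
  have hle : Integrable fun _ : ℝ => H t := by
    refine hint.mono' aestronglyMeasurable_const (ae_of_all _ fun s => ?_)
    rw [← hconst s, Real.norm_eq_abs, abs_le]
    have := hP0 (U s)
    have h2 := sq_nonneg ‖q s‖
    constructor <;> simp only [hH] <;> linarith
  rw [integrable_const_iff] at hle
  rcases hle with h0 | h0
  · exact sub_eq_zero.1 h0
  · have := h0.measure_univ_lt_top
    simp at this

end EulerLagrange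

end Variation

section Convergence

/-! ### Exponential convergence -/

section Exponential

variable {X : Type*} [NormedAddCommGroup X] [NormedSpace ℝ X] [CompleteSpace X]

namespace TwoWell

variable {P : X → ℝ} {Fm Fp : Set X} {D : ℝ}

/-- The energy of a minimizing connection before the time `s`. -/
theorem pathEnergy_Iic_le (h : TwoWell P Fm Fp D) {C δ : ℝ}
    (hq : ∀ e ∈ Fm ∪ Fp, ∀ x, ‖x - e‖ ≤ δ → P x ≤ C * ‖x - e‖ ^ 2) {U g : ℝ → X}
    (hU : IsPath U g) (hc : Connects Fm Fp (D / 4) U) (hfin : pathEnergy P Set.univ U g ≠ ⊤)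
    (hmin : ∀ V' g' : ℝ → X, IsPath V' g' → Connects Fm Fp (D / 4) V' →
      pathEnergy P Set.univ U g ≤ pathEnergy P Set.univ V' g')
    {s : ℝ} {e : X} (he : e ∈ Fm) (hs : ‖U s - e‖ ≤ δ) :
    pathEnergy P (Set.Iic s) U g ≤ ENNReal.ofReal ((1 / 2 + C) * ‖U s - e‖ ^ 2) := by
  obtain ⟨V, g', hV, h1, h2, h3⟩ := exists_segment_left h.nonneg (hq e (Or.inl he)) hU hs
  obtain ⟨tm, tp, h0, hm, hp⟩ := hc
  have hD := h.pos
  have hle := (hmin V g' hV ⟨min tm (s - 1), max tp s,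
    (min_le_left _ _).trans_lt (h0.trans_le (le_max_left _ _)), fun t ht => by
      rw [h2 t (ht.trans (min_le_right _ _)), Metric.infDist_zero_of_mem he]; positivity,
    fun t ht => by
      rw [h1 t ((le_max_right _ _).trans ht)]; exact hp t ((le_max_left _ _).trans ht)⟩).trans h3
  rw [← Set.Iic_union_Ioi (a := s), pathEnergy_union measurableSet_Ioi
    (Set.Iic_disjoint_Ioi le_rfl)] at hle
  exact (ENNReal.add_le_add_iff_right
    (ne_top_of_le_ne_top hfin (pathEnergy_mono (Set.subset_univ _) U g))).1 hle

/-- Exponential convergence of minimizing connections under a nondegeneracy condition. -/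
theorem exists_exp_le (h : TwoWell P Fm Fp D) (hcl : IsClosed Fm) {U q : ℝ → X}
    (hU : ∀ t, HasDerivAt U (q t) t) (hqc : Continuous q)
    (heq : ∀ t, (1 / 2) * ‖q t‖ ^ 2 = P (U t)) (hc : Connects Fm Fp (D / 4) U)
    (hfin : pathEnergy P Set.univ U q ≠ ⊤)
    (hmin : ∀ V' g' : ℝ → X, IsPath V' g' → Connects Fm Fp (D / 4) V' →
      pathEnergy P Set.univ U q ≤ pathEnergy P Set.univ V' g')
    (hnd : ∃ c > 0, ∃ ε > 0, ∀ x, Metric.infDist x Fm < ε → c * Metric.infDist x Fm ^ 2 ≤ P x) :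
    ∃ e ∈ Fm, ∃ k > 0, ∃ K > 0, ∀ t ≤ 0, ‖U t - e‖ ≤ K * Real.exp (k * t) := by
  obtain ⟨C, hC, δ, hδ, hquad⟩ := h.quad
  obtain ⟨c, hc0, ε, hε, hnd⟩ := hnd
  have hpath : IsPath U q := IsPath.of_hasDerivAt hU hqc
  have hUc := hpath.continuous
  have hPU : Continuous fun t => 2 * P (U t) := continuous_const.mul (h.continuous.comp hUc)
  have hden : ∀ t, (1 / 2) * ‖q t‖ ^ 2 + P (U t) = 2 * P (U t) := fun t => by rw [heq]; ring
  have h2P : ∀ t, 0 ≤ 2 * P (U t) := fun t => mul_nonneg zero_le_two (h.nonneg _)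
  have hint : Integrable fun t => 2 * P (U t) := by
    refine ⟨hPU.aestronglyMeasurable, ?_⟩
    rw [hasFiniteIntegral_iff_ofReal (ae_of_all _ h2P)]
    simp only [pathEnergy, setLIntegral_univ, hden] at hfin
    exact hfin.lt_top
  set T : ℝ → ℝ := fun s => ∫ t in Set.Iic s, 2 * P (U t) with hT
  have hT0 : ∀ s, 0 ≤ T s := fun s => integral_nonneg h2P
  have hTd : ∀ s, HasDerivAt T (2 * P (U s)) s := fun s => by
    have h1 : T = fun s => T 0 + ∫ t in (0 : ℝ)..s, 2 * P (U t) := funext fun s => by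
      rw [← intervalIntegral.integral_Iic_sub_Iic hint.integrableOn hint.integrableOn]
      simp only [hT]; ring
    rw [h1]
    exact (intervalIntegral.integral_hasDerivAt_right (hPU.intervalIntegrable _ _)
      (hPU.stronglyMeasurableAtFilter _ _) hPU.continuousAt).const_add _
  have hpE : ∀ s, pathEnergy P (Set.Iic s) U q = ENNReal.ofReal (T s) := fun s => by
    simp only [pathEnergy, hden]
    exact (ofReal_integral_eq_lintegral_ofReal hint.integrableOn (ae_of_all _ h2P)).symm
  have hTle : ∀ s, Metric.infDist (U s) Fm < δ → T s ≤ (1 / 2 + C) * Metric.infDist (U s) Fm ^ 2 := by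
    intro s hs
    by_contra hcon
    push Not at hcon
    -- The distance need not be attained: the assumed failure leaves room for a well `e` close
    -- enough to contradict `pathEnergy_Iic_le`.
    have h1 : Metric.infDist (U s) Fm < √(T s / (1 / 2 + C)) := by
      rw [Real.lt_sqrt Metric.infDist_nonneg, lt_div_iff₀ (by positivity)]
      linarith
    obtain ⟨e, he, hes⟩ := (Metric.infDist_lt_iff h.nonempty_left).1 (lt_min hs h1)
    rw [dist_eq_norm] at hes
    have h2 := h.pathEnergy_Iic_le hquad hpath hc hfin hmin he (hes.le.trans (min_le_left _ _))
    rw [hpE, ENNReal.ofReal_le_ofReal_iff (by positivity)] at h2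
    have h3 := (Real.lt_sqrt (norm_nonneg _)).1 (hes.trans_le (min_le_right _ _))
    rw [lt_div_iff₀ (by positivity)] at h3
    linarith
  obtain ⟨tm, tp, -, hm, -⟩ := hc
  have hlim := h.tendsto_atBot hpath hfin hm
  obtain ⟨t₁, ht₁⟩ := eventually_atBot.1 (hlim.eventually (gt_mem_nhds (lt_min hδ hε)))
  set t₀ := min t₁ 0
  -- the differential inequality for the tail of the energy
  set k : ℝ := c / (1 / 2 + C) with hk
  have hk0 : 0 < k := by positivity
  -- `T ≤ (½ + C) d²` and `c d² ≤ P(U)` give `k T ≤ P(U)`, that is, `2k T ≤ T'`.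
  have hdiff : ∀ s ≤ t₀, 2 * k * T s ≤ 2 * P (U s) := fun s hs => by
    have h1 := ht₁ s (hs.trans (min_le_left _ _))
    have h2 := hTle s (h1.trans_le (min_le_left _ _))
    have h3 := hnd _ (h1.trans_le (min_le_right _ _))
    have h4 : k * T s ≤ c * Metric.infDist (U s) Fm ^ 2 := by
      rw [hk, div_mul_eq_mul_div, div_le_iff₀ (by positivity)]
      nlinarith
    linarith
  have hexpd : ∀ (a s : ℝ), HasDerivAt (fun s => Real.exp (a * s)) (Real.exp (a * s) * a) s :=
    fun a s => by
      have := ((hasDerivAt_id s).const_mul a).exp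
      simpa using this
  set M := T t₀ * Real.exp (-(2 * k) * t₀) with hM
  have hM0 : 0 ≤ M := mul_nonneg (hT0 _) (Real.exp_nonneg _)
  have hTM : ∀ s ≤ t₀, T s ≤ M * Real.exp (2 * k * s) := fun s hs => by
    have hmono : MonotoneOn (fun s => T s * Real.exp (-(2 * k) * s)) (Set.Iic t₀) := by
      have hd := fun s => (hTd s).mul (hexpd (-(2 * k)) s)
      refine monotoneOn_of_deriv_nonneg (convex_Iic _)
        (fun s _ => (hd s).continuousAt.continuousWithinAt)
        (fun s _ => (hd s).differentiableAt.differentiableWithinAt) fun s hs => ?_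
      rw [interior_Iic] at hs
      have h0 := (hd s).deriv
      change 0 ≤ deriv (T * fun s => Real.exp (-(2 * k) * s)) s
      rw [h0]
      have h1 := hdiff s (le_of_lt hs)
      have h2 := Real.exp_pos (-(2 * k) * s)
      nlinarith
    have h1 := hmono hs (Set.mem_Iic.2 le_rfl) hs
    have h2 : Real.exp (-(2 * k) * s) * Real.exp (2 * k * s) = 1 := by
      rw [← Real.exp_add]; simp
    calc T s = (T s * Real.exp (-(2 * k) * s)) * Real.exp (2 * k * s) := by
          rw [mul_assoc, h2, mul_one]
      _ ≤ _ := by gcongr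
  -- the distance travelled
  set G : ℝ → ℝ := fun s => (1 / 2) * (T s * Real.exp (-k * s) + (M + 1 / k) * Real.exp (k * s))
  have hGd : ∀ s, HasDerivAt G ((1 / 2) * ((2 * P (U s) * Real.exp (-k * s) +
      T s * (Real.exp (-k * s) * -k)) + (M + 1 / k) * (Real.exp (k * s) * k))) s := fun s =>
    (((hTd s).mul (hexpd (-k) s)).add ((hexpd k s).const_mul _)).const_mul _
  have hG0 : ∀ s, 0 ≤ G s := fun s => by
    have := hT0 s
    simp only [G]; positivity
  have hsplit : ∀ s, Real.exp (2 * k * s) * Real.exp (-k * s) = Real.exp (k * s) := fun s => by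
    rw [← Real.exp_add]; ring_nf
  have hone : ∀ s, Real.exp (-k * s) * Real.exp (k * s) = 1 := fun s => by
    rw [← Real.exp_add]; simp
  have hGle : ∀ s ≤ t₀, G s ≤ (M + 1 / k) * Real.exp (k * s) := fun s hs => by
    have h1 := mul_le_mul_of_nonneg_right (hTM s hs) (Real.exp_nonneg (-k * s))
    rw [mul_assoc, hsplit] at h1
    have h2 : 0 ≤ 1 / k * Real.exp (k * s) := by positivity
    simp only [G]
    linarith
  -- `G` is built so that `G' ≥ ‖q‖`. By equipartition `‖q‖² = T'`, and `2‖q‖ ≤ ‖q‖² e^{-ks} +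
  -- e^{ks}`. The first term comes from `T e^{-ks}`, whose other derivative term is absorbed by `M
  -- e^{ks}`; the second comes from `e^{ks} / k`.
  have hqG : ∀ s ≤ t₀, ‖q s‖ ≤ (1 / 2) * ((2 * P (U s) * Real.exp (-k * s) +
      T s * (Real.exp (-k * s) * -k)) + (M + 1 / k) * (Real.exp (k * s) * k)) := fun s hs => by
    have h1 := mul_le_mul_of_nonneg_right (hTM s hs) (Real.exp_nonneg (-k * s))
    rw [mul_assoc, hsplit] at h1
    have h2 : (M + 1 / k) * (Real.exp (k * s) * k) = M * Real.exp (k * s) * k + Real.exp (k * s) := by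
      field_simp
    have h3 : 2 * P (U s) = ‖q s‖ ^ 2 := by rw [← heq]; ring
    have h4 : 2 * ‖q s‖ ≤ ‖q s‖ ^ 2 * Real.exp (-k * s) + Real.exp (k * s) := by
      have h5 := Real.exp_pos (k * s)
      have h6 := sq_nonneg (‖q s‖ * Real.exp (-k * s) - 1)
      have h7 := hone s
      have h8 : (‖q s‖ * Real.exp (-k * s) - 1) ^ 2 * Real.exp (k * s) =
        ‖q s‖ ^ 2 * Real.exp (-k * s) * (Real.exp (-k * s) * Real.exp (k * s)) -
          2 * ‖q s‖ * (Real.exp (-k * s) * Real.exp (k * s)) + Real.exp (k * s) := by ring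
      rw [h7] at h8
      nlinarith [mul_nonneg h6 h5.le]
    rw [h2, h3]
    nlinarith
  have hdist : ∀ a b, a ≤ b → b ≤ t₀ → ‖U b - U a‖ ≤ (M + 1 / k) * Real.exp (k * b) := by
    intro a b hab hb
    have h1 := image_norm_le_of_norm_deriv_right_le_deriv_boundary (f := fun t => U t - U a)
      (f' := q) (a := a) (b := b) (B := fun t => G t - G a)
      ((hUc.sub continuous_const).continuousOn)
      (fun x _ => ((hU x).sub_const _).hasDerivWithinAt) (by simp)
      (fun x => (hGd x).sub_const _) (fun x hx => hqG x (hx.2.le.trans hb))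
      (Set.right_mem_Icc.2 hab)
    have h2 := hGle b hb
    have h3 := hG0 a
    linarith
  -- the limit
  have hexplim : Tendsto (fun t => (M + 1 / k) * Real.exp (k * t)) atBot (𝓝 0) := by
    have := (Real.tendsto_exp_atBot.comp (tendsto_id.const_mul_atBot hk0)).const_mul (M + 1 / k)
    simpa [Function.comp_def] using this
  have hcauchy : CauchySeq fun n : ℕ => U (t₀ - n) := by
    refine Metric.cauchySeq_iff'.2 fun η hη => ?_
    have hl : Tendsto (fun n : ℕ => t₀ - (n : ℝ)) atTop atBot :=
      tendsto_atBot_add_const_left _ _ (tendsto_neg_atTop_atBot.comp tendsto_natCast_atTop_atTop)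
    obtain ⟨N, hN⟩ := ((hexplim.comp hl).eventually (gt_mem_nhds hη)).exists
    refine ⟨N, fun n hn => ?_⟩
    rw [dist_comm, dist_eq_norm]
    have hn' : (N : ℝ) ≤ n := by exact_mod_cast hn
    have h0 : (0 : ℝ) ≤ N := N.cast_nonneg
    exact (hdist (t₀ - n) (t₀ - N) (by linarith) (by linarith)).trans_lt hN
  obtain ⟨e, he⟩ := cauchySeq_tendsto_of_complete hcauchy
  have hl : Tendsto (fun n : ℕ => t₀ - (n : ℝ)) atTop atBot :=
    tendsto_atBot_add_const_left _ _ (tendsto_neg_atTop_atBot.comp tendsto_natCast_atTop_atTop)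
  have heF : e ∈ Fm := by
    rw [hcl.mem_iff_infDist_zero h.nonempty_left]
    exact tendsto_nhds_unique (((Metric.continuous_infDist_pt Fm).tendsto e).comp he) (hlim.comp hl)
  have hbound : ∀ t ≤ t₀, ‖U t - e‖ ≤ (M + 1 / k) * Real.exp (k * t) := fun t ht => by
    refine le_of_tendsto (tendsto_const_nhds.sub he).norm ?_
    filter_upwards [hl.eventually (Iic_mem_atBot t)] with n hn
    exact hdist _ _ hn ht
  obtain ⟨K₀, hK₀⟩ := (isCompact_Icc (a := t₀) (b := 0)).exists_bound_of_continuousOn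
    (hUc.sub (continuous_const (y := e))).continuousOn
  have hK₀' : 0 ≤ K₀ := (norm_nonneg _).trans (hK₀ 0 ⟨min_le_right _ _, le_rfl⟩)
  -- On `[t₀, 0]` the distance to `e` is only bounded, by `K₀`; the factor `e^{-k t₀}` compensates
  -- for `e^{kt} ≥ e^{k t₀}`.
  refine ⟨e, heF, k, hk0, (M + 1 / k) + K₀ * Real.exp (-k * t₀), by positivity, fun t ht => ?_⟩
  rcases le_total t t₀ with h1 | h1
  · refine (hbound t h1).trans ?_
    have : 0 ≤ K₀ * Real.exp (-k * t₀) := by positivity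
    exact mul_le_mul_of_nonneg_right (by linarith) (Real.exp_nonneg _)
  · have h2 : K₀ ≤ K₀ * Real.exp (-k * t₀) * Real.exp (k * t) := by
      rw [mul_assoc, ← Real.exp_add]
      refine le_mul_of_one_le_right hK₀' (Real.one_le_exp ?_)
      nlinarith
    have h3 : 0 ≤ (M + 1 / k) * Real.exp (k * t) := by positivity
    have := hK₀ t ⟨h1, ht⟩
    simp only [Pi.sub_apply] at this
    rw [add_mul]
    linarith

end TwoWell

end Exponential

end Convergence

section PlaneCurves

/-! ### Curves in `H¹(ℝ; ℝᵐ)` as functions in the plane -/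

variable {m : ℕ} {am ap : E m}

theorem MemL2loc.locallyIntegrable {Y X : Type*} [TopologicalSpace Y] [LocallyCompactSpace Y]
    [MeasureSpace Y] [IsLocallyFiniteMeasure (volume : Measure Y)]
    [NormedAddCommGroup X] {f : Y → X} (h : MemL2loc f) : LocallyIntegrable f volume := fun y => by
  obtain ⟨K, hK, hy⟩ := exists_compact_mem_nhds y
  have : IsFiniteMeasure ((volume : Measure Y).restrict K) :=
    ⟨by rw [Measure.restrict_apply_univ]; exact hK.measure_lt_top⟩
  exact ⟨K, hy, (h K hK).integrable (by norm_num)⟩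

theorem restrict_prod_univ (S : Set ℝ) : (volume : Measure (ℝ × ℝ)).restrict (S ×ˢ Set.univ) =
    ((volume : Measure ℝ).restrict S).prod volume := by
  rw [Measure.volume_eq_prod, ← Measure.prod_restrict, Measure.restrict_univ]

/-- Tonelli: the squared norms of the slices are bounded by an integrable function of `t`. -/
theorem memLp_two_of_slices {f : ℝ × ℝ → E m} (hf : Measurable f) {S : Set ℝ} {c : ℝ → ℝ}
    (hc : IntegrableOn c S) (hi : ∀ t, Integrable fun x => ‖f (t, x)‖ ^ 2)
    (hle : ∀ t, ∫ x, ‖f (t, x)‖ ^ 2 ≤ c t) :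
    MemLp f 2 (volume.restrict (S ×ˢ (Set.univ : Set ℝ))) := by
  rw [memLp_two_iff_integrable_sq_norm hf.aestronglyMeasurable]
  refine ⟨(hf.norm.pow_const 2).aestronglyMeasurable, ?_⟩
  rw [hasFiniteIntegral_iff_ofReal (ae_of_all _ fun p => sq_nonneg _), restrict_prod_univ,
    lintegral_prod _ (hf.norm.pow_const 2).ennreal_ofReal.aemeasurable]
  refine lt_of_le_of_lt (lintegral_mono fun t => ?_) hc.lintegral_lt_top
  rw [← ofReal_integral_eq_lintegral_ofReal (hi t) (ae_of_all _ fun x => sq_nonneg _)]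
  exact ENNReal.ofReal_le_ofReal (hle t)

theorem _root_.HasCompactSupport.comp_slice_snd {X : Type*} [Zero X] {φ : ℝ × ℝ → X}
    (hc : HasCompactSupport φ) (t : ℝ) : HasCompactSupport fun x => φ (t, x) :=
  HasCompactSupport.of_support_subset_isCompact (hc.isCompact.image continuous_snd)
    fun x hx => ⟨(t, x), subset_tsupport φ hx, rfl⟩

theorem _root_.HasCompactSupport.comp_slice_fst {X : Type*} [Zero X] {φ : ℝ × ℝ → X}
    (hc : HasCompactSupport φ) (x : ℝ) : HasCompactSupport fun t => φ (t, x) :=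
  HasCompactSupport.of_support_subset_isCompact (hc.isCompact.image continuous_fst)
    fun t ht => ⟨(t, x), subset_tsupport φ ht, rfl⟩

theorem slice_snd {φ : ℝ × ℝ → ℝ} (hφ : ContDiff ℝ ∞ φ) (hc : HasCompactSupport φ) (t : ℝ) :
    ContDiff ℝ ∞ (fun x => φ (t, x)) ∧ HasCompactSupport (fun x => φ (t, x)) ∧
      ∀ x, fderiv ℝ (fun x => φ (t, x)) x 1 = fderiv ℝ φ (t, x) (0, 1) := by
  refine ⟨hφ.comp (contDiff_const.prodMk contDiff_id),
    hc.comp_slice_snd t, fun x => ?_⟩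
  have h1 : HasDerivAt (fun x : ℝ => (t, x)) ((0 : ℝ), (1 : ℝ)) x :=
    (hasDerivAt_const x t).prodMk (hasDerivAt_id x)
  have h2 := ((hφ.differentiable (by simp) (t, x)).hasFDerivAt).comp_hasDerivAt x h1
  rw [fderiv_apply_one_eq_deriv]
  exact h2.deriv

theorem slice_fst {φ : ℝ × ℝ → ℝ} (hφ : ContDiff ℝ ∞ φ) (hc : HasCompactSupport φ) (x : ℝ) :
    ContDiff ℝ ∞ (fun t => φ (t, x)) ∧ HasCompactSupport (fun t => φ (t, x)) ∧
      ∀ t, fderiv ℝ (fun t => φ (t, x)) t 1 = fderiv ℝ φ (t, x) (1, 0) := by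
  refine ⟨hφ.comp (contDiff_id.prodMk contDiff_const),
    hc.comp_slice_fst x, fun t => ?_⟩
  have h1 : HasDerivAt (fun t : ℝ => (t, x)) ((1 : ℝ), (0 : ℝ)) t :=
    (hasDerivAt_id t).prodMk (hasDerivAt_const t x)
  have h2 := ((hφ.differentiable (by simp) (t, x)).hasFDerivAt).comp_hasDerivAt t h1
  rw [fderiv_apply_one_eq_deriv]
  exact h2.deriv

theorem integrable_test {X : Type*} [NormedAddCommGroup X] [NormedSpace ℝ X] {u g : ℝ × ℝ → X}
    (hu : LocallyIntegrable u volume) (hg : LocallyIntegrable g volume) {φ : ℝ × ℝ → ℝ}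
    (hφ : ContDiff ℝ ∞ φ) (hc : HasCompactSupport φ) (v : ℝ × ℝ) :
    Integrable (fun p => (fderiv ℝ φ p v) • u p) ∧ Integrable fun p => φ p • g p :=
  ⟨hu.integrable_smul_left_of_hasCompactSupport
    ((hφ.continuous_fderiv (by simp)).clm_apply continuous_const) (hc.fderiv_apply (𝕜 := ℝ) v),
    hg.integrable_smul_left_of_hasCompactSupport hφ.continuous hc⟩

/-- By Fubini, since the slices of a test function of the plane are test functions of the line. -/
theorem hasWeakDeriv_of_slices_snd {X : Type*} [NormedAddCommGroup X] [NormedSpace ℝ X]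
    {u g : ℝ × ℝ → X} (hu : LocallyIntegrable u volume) (hg : LocallyIntegrable g volume)
    (h : ∀ t, HasWeakDeriv (1 : ℝ) (fun x => u (t, x)) fun x => g (t, x)) :
    HasWeakDeriv ((0, 1) : ℝ × ℝ) u g := by
  refine ⟨hu, hg, fun φ hφ hc => ?_⟩
  obtain ⟨i1, i2⟩ := integrable_test hu hg hφ hc (0, 1)
  rw [Measure.volume_eq_prod] at i1 i2 ⊢
  rw [integral_prod _ i1, integral_prod _ i2, ← integral_neg]
  refine integral_congr_ae (ae_of_all _ fun t => ?_)
  obtain ⟨h1, h2, h3⟩ := slice_snd hφ hc t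
  have := (h t).2.2 _ h1 h2
  simpa only [h3] using this

theorem hasWeakDeriv_of_slices_fst {X : Type*} [NormedAddCommGroup X] [NormedSpace ℝ X]
    {u g : ℝ × ℝ → X} (hu : LocallyIntegrable u volume) (hg : LocallyIntegrable g volume)
    (h : ∀ x, HasWeakDeriv (1 : ℝ) (fun t => u (t, x)) fun t => g (t, x)) :
    HasWeakDeriv ((1, 0) : ℝ × ℝ) u g := by
  refine ⟨hu, hg, fun φ hφ hc => ?_⟩
  obtain ⟨i1, i2⟩ := integrable_test hu hg hφ hc (1, 0)
  rw [Measure.volume_eq_prod] at i1 i2 ⊢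
  rw [integral_prod_symm _ i1, integral_prod_symm _ i2, ← integral_neg]
  refine integral_congr_ae (ae_of_all _ fun x => ?_)
  obtain ⟨h1, h2, h3⟩ := slice_fst hφ hc x
  have := (h x).2.2 _ h1 h2
  simpa only [h3] using this

/-- The function `(t, x) ↦ [A(t)](x)`. -/
def planeRep (A : ℝ → H1 m) (p : ℝ × ℝ) : E m := rep (A p.1) p.2

/-- The derivative of `(t, x) ↦ [A(t)](x)` with respect to `x`. -/
def planeDer (A : ℝ → H1 m) (p : ℝ × ℝ) : E m := deriv (rep (A p.1)) p.2

/-- The function `(t, x) ↦ e₀(x) + [A(t)](x)`. -/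
def planeMap (am ap : E m) (A : ℝ → H1 m) (p : ℝ × ℝ) : E m := urep am ap (A p.1) p.2

/-- The derivative of `(t, x) ↦ e₀(x) + [A(t)](x)` with respect to `x`. -/
def planeMapDer (am ap : E m) (A : ℝ → H1 m) (p : ℝ × ℝ) : E m := deriv (urep am ap (A p.1)) p.2

/-- The sup norm is controlled by the `H¹` norm, so the curve varies uniformly in `x`, while each
slice is continuous. -/
theorem continuous_planeRep {A : ℝ → H1 m} (hA : Continuous A) : Continuous (planeRep A) := by
  rw [continuous_iff_continuousAt]
  rintro ⟨t, x⟩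
  rw [ContinuousAt, tendsto_iff_dist_tendsto_zero]
  have h1 : Tendsto (fun p : ℝ × ℝ => 2 * ‖A p.1 - A t‖ + dist (rep (A t) p.2) (rep (A t) x))
      (𝓝 (t, x)) (𝓝 0) := by
    have h2 : Continuous fun p : ℝ × ℝ => 2 * ‖A p.1 - A t‖ + dist (rep (A t) p.2) (rep (A t) x) :=
      (continuous_const.mul ((hA.comp continuous_fst).sub continuous_const).norm).add
        (((continuous_rep (A t)).comp continuous_snd).dist continuous_const)
    have := h2.tendsto (t, x)
    simpa using this
  refine squeeze_zero (fun p => dist_nonneg) (fun p => ?_) h1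
  refine (dist_triangle _ (rep (A t) p.2) _).trans (add_le_add ?_ le_rfl)
  have := norm_rep_le (A p.1 - A t) p.2
  rwa [rep_sub, Pi.sub_apply, ← dist_eq_norm] at this

theorem continuous_planeMap {A : ℝ → H1 m} (hA : Continuous A) : Continuous (planeMap am ap A) :=
  ((isPath_e0 am ap).continuous.comp continuous_snd).add (continuous_planeRep hA)

/-- The weak derivative of each slice is only an almost everywhere class, chosen separately for each
`t`. The pointwise `deriv` of the jointly continuous representative gives one jointly measurable
function. -/
theorem measurable_planeDer {A : ℝ → H1 m} (hA : Continuous A) : Measurable (planeDer A) :=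
  measurable_deriv_with_param (f := fun t => rep (A t)) (continuous_planeRep hA)

theorem measurable_planeMapDer {A : ℝ → H1 m} (hA : Continuous A) :
    Measurable (planeMapDer am ap A) :=
  measurable_deriv_with_param (f := fun t => urep am ap (A t)) (continuous_planeMap hA)

theorem deriv_rep_ae (h : H1 m) : deriv (rep h) =ᵐ[volume] h1Der h := by
  filter_upwards [(isPath_rep h).ae_hasDerivAt] with x hx using hx.deriv

theorem deriv_urep_ae (h : H1 m) : deriv (urep am ap h) =ᵐ[volume] uder am ap h := by
  filter_upwards [(isPath_urep am ap h).ae_hasDerivAt] with x hx using hx.deriv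

theorem integrable_deriv_rep_sq (h : H1 m) : Integrable fun x => ‖deriv (rep h) x‖ ^ 2 :=
  (integrable_der_sq h).congr (by filter_upwards [deriv_rep_ae h] with x hx; rw [hx])

theorem integral_deriv_rep_sq (h : H1 m) : ∫ x, ‖deriv (rep h) x‖ ^ 2 = ‖sndL m h‖ ^ 2 := by
  rw [← integral_der_sq]
  exact integral_congr_ae (by filter_upwards [deriv_rep_ae h] with x hx; rw [hx])

theorem integrable_deriv_urep_sq (h : H1 m) : Integrable fun x => ‖deriv (urep am ap h) x‖ ^ 2 :=
  (integrable_uder_sq am ap h).congr (by filter_upwards [deriv_urep_ae h] with x hx; rw [hx])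

theorem integral_deriv_urep_sq (h : H1 m) :
    ∫ x, ‖deriv (urep am ap h) x‖ ^ 2 = ‖uderL am ap h‖ ^ 2 := by
  rw [← integral_uder_sq]
  exact integral_congr_ae (by filter_upwards [deriv_urep_ae h] with x hx; rw [hx])

theorem continuous_uderL (am ap : E m) : Continuous (uderL am ap) :=
  continuous_const.add (sndL m).continuous

theorem memLp_planeRep {A : ℝ → H1 m} (hA : Continuous A) {S : Set ℝ}
    (hi : IntegrableOn (fun t => ‖A t‖ ^ 2) S) :
    MemLp (planeRep A) 2 (volume.restrict (S ×ˢ (Set.univ : Set ℝ))) :=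
  memLp_two_of_slices (continuous_planeRep hA).measurable hi (fun t => integrable_rep_sq (A t))
    fun t => by
      simp only [planeRep, integral_rep_sq]
      exact pow_le_pow_left₀ (norm_nonneg _) (norm_fstL_le _) 2

theorem memLp_planeDer {A : ℝ → H1 m} (hA : Continuous A) {S : Set ℝ}
    (hi : IntegrableOn (fun t => ‖A t‖ ^ 2) S) :
    MemLp (planeDer A) 2 (volume.restrict (S ×ˢ (Set.univ : Set ℝ))) :=
  memLp_two_of_slices (measurable_planeDer hA) hi (fun t => integrable_deriv_rep_sq (A t))
    fun t => by
      simp only [planeDer, integral_deriv_rep_sq]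
      exact pow_le_pow_left₀ (norm_nonneg _) (norm_sndL_le _) 2

theorem memLp_planeMapDer {A : ℝ → H1 m} (hA : Continuous A) (a b : ℝ) :
    MemLp (planeMapDer am ap A) 2 (volume.restrict (Set.Ioo a b ×ˢ (Set.univ : Set ℝ))) :=
  memLp_two_of_slices (measurable_planeMapDer hA) (c := fun t => ‖uderL am ap (A t)‖ ^ 2)
    ((((continuous_uderL am ap).comp hA).norm.pow 2).continuousOn.integrableOn_Icc.mono_set
      Set.Ioo_subset_Icc_self) (fun t => integrable_deriv_urep_sq (A t))
    fun t => by simp only [planeMapDer, integral_deriv_urep_sq, le_refl]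

theorem memL2loc_of_strips {f : ℝ × ℝ → E m}
    (h : ∀ a b : ℝ, MemLp f 2 (volume.restrict (Set.Ioo a b ×ˢ (Set.univ : Set ℝ)))) :
    MemL2loc f := fun K hK => by
  obtain ⟨R, hR⟩ := hK.isBounded.subset_ball 0
  have hsub : K ⊆ Set.Ioo (-R) R ×ˢ (Set.univ : Set ℝ) := fun p hp => ⟨?_, trivial⟩
  · exact (h (-R) R).mono_measure (Measure.restrict_mono hsub le_rfl)
  have h1 := mem_ball_zero_iff.1 (hR hp)
  exact abs_lt.1 ((norm_fst_le p).trans_lt h1)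

theorem memL2loc_planeMapDer {A : ℝ → H1 m} (hA : Continuous A) :
    MemL2loc (planeMapDer am ap A) := memL2loc_of_strips (memLp_planeMapDer hA)

theorem memL2loc_planeDer {A : ℝ → H1 m} (hA : Continuous A) : MemL2loc (planeDer A) :=
  memL2loc_of_strips fun _ _ => memLp_planeDer hA
    ((hA.norm.pow 2).continuousOn.integrableOn_Icc.mono_set Set.Ioo_subset_Icc_self)

theorem memL2loc_planeRep {A : ℝ → H1 m} (hA : Continuous A) : MemL2loc (planeRep A) :=
  memL2loc_of_continuous (continuous_planeRep hA)

/-- Evaluation at `x` is a bounded linear map, so it carries a path in `H1 m` to a path in `ℝᵐ`. -/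
theorem hasWeakDeriv_planeMap_fst {A g : ℝ → H1 m} (hA : IsPath A g) (hg : Continuous g) :
    HasWeakDeriv ((1, 0) : ℝ × ℝ) (planeMap am ap A) (planeRep g) :=
  hasWeakDeriv_of_slices_fst (continuous_planeMap hA.continuous).locallyIntegrable
    (continuous_planeRep hg).locallyIntegrable fun x =>
      ((hA.map (evalL m x)).const_add (e0 am ap x)).hasWeakDeriv

theorem hasWeakDeriv_planeMap_snd {A : ℝ → H1 m} (hA : Continuous A) :
    HasWeakDeriv ((0, 1) : ℝ × ℝ) (planeMap am ap A) (planeMapDer am ap A) :=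
  hasWeakDeriv_of_slices_snd (continuous_planeMap hA).locallyIntegrable
    (memL2loc_planeMapDer hA).locallyIntegrable fun t =>
      (isPath_urep am ap (A t)).hasWeakDeriv.congr (ae_eq_refl _) (deriv_urep_ae (A t)).symm

theorem hasWeakDeriv_planeRep_snd {A : ℝ → H1 m} (hA : Continuous A) :
    HasWeakDeriv ((0, 1) : ℝ × ℝ) (planeRep A) (planeDer A) :=
  hasWeakDeriv_of_slices_snd (continuous_planeRep hA).locallyIntegrable
    (memL2loc_planeDer hA).locallyIntegrable fun t =>
      (isPath_rep (A t)).hasWeakDeriv.congr (ae_eq_refl _) (deriv_rep_ae (A t)).symm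

end PlaneCurves

section WeakForm

/-! ### Test functions and the weak form of the equation -/

variable {m : ℕ} {α : ℝ} {W : E m → ℝ} {am ap : E m}

theorem locallyIntegrable_of_continuous {X : Type*} [NormedAddCommGroup X] {f : ℝ → X}
    (hf : Continuous f) : LocallyIntegrable f volume := hf.locallyIntegrable

theorem rep_zero : rep (0 : H1 m) = 0 := by
  have := rep_smul (m := m) 0 0
  simpa using this

/-- A compactly supported function in the plane as a curve in `H¹(ℝ; ℝᵐ)`. -/
theorem exists_h1_curve {f g : ℝ × ℝ → E m} (hf : Continuous f) (hg : Continuous g)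
    (hc : HasCompactSupport f) (hd : ∀ t x, HasDerivAt (fun x => f (t, x)) (g (t, x)) x) :
    ∃ A : ℝ → H1 m, Continuous A ∧ HasCompactSupport A ∧ (∀ t, rep (A t) = fun x => f (t, x)) ∧
      ∀ t, h1Der (A t) =ᵐ[volume] fun x => g (t, x) := by
  choose A hA1 hA2 using fun t => exists_h1_of_contDiff (hd t)
    (hg.comp (continuous_const.prodMk continuous_id)) (hc.comp_slice_snd t)
  obtain ⟨R, hR⟩ := hc.isCompact.isBounded.subset_closedBall 0
  have hout : ∀ t x, x ∉ Set.Icc (-R) R → f (t, x) = 0 ∧ g (t, x) = 0 := fun t x hx => by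
    have h1 : (t, x) ∉ tsupport f := fun hmem => hx (by
      have h2 := mem_closedBall_zero_iff.1 (hR hmem)
      exact abs_le.1 ((norm_snd_le (t, x)).trans h2))
    refine ⟨image_eq_zero_of_notMem_tsupport h1, ?_⟩
    have h3 : (fun y => f (t, y)) =ᶠ[𝓝 x] fun _ => 0 := by
      have h4 : ∀ᶠ p in 𝓝 (t, x), p ∉ tsupport f := (isClosed_tsupport f).isOpen_compl.mem_nhds h1
      have h5 : Tendsto (fun y : ℝ => (t, y)) (𝓝 x) (𝓝 (t, x)) :=
        (continuous_const.prodMk continuous_id).tendsto x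
      filter_upwards [h5.eventually h4] with y hy using image_eq_zero_of_notMem_tsupport hy
    rw [← (hd t x).deriv, h3.deriv_eq, deriv_const]
  refine ⟨A, ?_, ?_, hA1, hA2⟩
  · rw [continuous_iff_continuousAt]
    intro s
    -- All slices are supported in one compact interval, so the squared `H¹` distance is a
    -- parametric integral of a continuous function.
    have hcont : Continuous fun t => ∫ x in Set.Icc (-R) R,
        (‖f (t, x) - f (s, x)‖ ^ 2 + ‖g (t, x) - g (s, x)‖ ^ 2) := by
      refine continuous_parametric_integral_of_continuous (f := fun t x =>
        ‖f (t, x) - f (s, x)‖ ^ 2 + ‖g (t, x) - g (s, x)‖ ^ 2) ?_ isCompact_Icc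
      have h2 : Continuous fun p : ℝ × ℝ => (s, p.2) := continuous_const.prodMk continuous_snd
      exact ((hf.sub (hf.comp h2)).norm.pow 2).add ((hg.sub (hg.comp h2)).norm.pow 2)
    have heq : ∀ t, ‖A t - A s‖ ^ 2 = ∫ x in Set.Icc (-R) R,
        (‖f (t, x) - f (s, x)‖ ^ 2 + ‖g (t, x) - g (s, x)‖ ^ 2) := fun t => by
      rw [setIntegral_eq_integral_of_forall_compl_eq_zero fun x hx => by
        simp [(hout t x hx).1, (hout t x hx).2, (hout s x hx).1, (hout s x hx).2],
        norm_sq_eq_integral, ← integral_add (integrable_rep_sq _) (integrable_der_sq _)]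
      refine integral_congr_ae ?_
      filter_upwards [h1Der_sub (A t) (A s), hA2 t, hA2 s] with x h1 h2 h3
      rw [h1, Pi.sub_apply, h2, h3, rep_sub, hA1, hA1]
      rfl
    have h0 := hcont.tendsto s
    simp only [← heq, sub_self, norm_zero] at h0
    rw [ContinuousAt, tendsto_iff_norm_sub_tendsto_zero]
    have h1 := h0.sqrt
    simpa using h1
  · refine HasCompactSupport.of_support_subset_isCompact (hc.isCompact.image continuous_fst)
      fun t ht => ?_
    by_contra hcon
    refine ht (ext_rep ?_)
    rw [hA1, rep_zero]
    funext x
    refine image_eq_zero_of_notMem_tsupport fun hmem => hcon ⟨(t, x), hmem, rfl⟩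

theorem hasDerivAt_slice_fst {f : ℝ × ℝ → E m} (hf : Differentiable ℝ f) (t x : ℝ) :
    HasDerivAt (fun t => f (t, x)) (pdt f (t, x)) t :=
  ((hf (t, x)).hasFDerivAt).comp_hasDerivAt t ((hasDerivAt_id t).prodMk (hasDerivAt_const t x))

theorem hasDerivAt_slice_snd {f : ℝ × ℝ → E m} (hf : Differentiable ℝ f) (t x : ℝ) :
    HasDerivAt (fun x => f (t, x)) (pdx f (t, x)) x :=
  ((hf (t, x)).hasFDerivAt).comp_hasDerivAt x ((hasDerivAt_const x t).prodMk (hasDerivAt_id x))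

theorem contDiff_pdt {φ : ℝ × ℝ → E m} (hφ : ContDiff ℝ 2 φ) : ContDiff ℝ 1 (pdt φ) :=
  (hφ.fderiv_right (m := 1) (by norm_num)).clm_apply contDiff_const

theorem continuous_pdx {φ : ℝ × ℝ → E m} (hφ : ContDiff ℝ 1 φ) : Continuous (pdx φ) :=
  (hφ.continuous_fderiv one_ne_zero).clm_apply continuous_const

/-- A test function in the plane as a `C¹` curve in `H¹(ℝ; ℝᵐ)`. -/
theorem exists_test_curve {φ : ℝ × ℝ → E m} (hφ : ContDiff ℝ 2 φ) (hc : HasCompactSupport φ) :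
    ∃ Φ Ψ : ℝ → H1 m, IsPath Φ Ψ ∧ Continuous Ψ ∧ HasCompactSupport Φ ∧ HasCompactSupport Ψ ∧
      (∀ t, rep (Φ t) = fun x => φ (t, x)) ∧
      (∀ t, h1Der (Φ t) =ᵐ[volume] fun x => pdx φ (t, x)) ∧
      (∀ t, rep (Ψ t) = fun x => pdt φ (t, x)) ∧
      ∀ t, h1Der (Ψ t) =ᵐ[volume] fun x => pdx (pdt φ) (t, x) := by
  have hφ1 : ContDiff ℝ 1 φ := hφ.of_le (by norm_num)
  have hψ := contDiff_pdt hφ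
  have hψc : HasCompactSupport (pdt φ) := hc.fderiv_apply (𝕜 := ℝ) (1, 0)
  have hdφ := hφ1.differentiable one_ne_zero
  obtain ⟨Φ, h1, h2, h3, h4⟩ := exists_h1_curve hφ.continuous (continuous_pdx hφ1) hc
    (hasDerivAt_slice_snd hdφ)
  obtain ⟨Ψ, k1, k2, k3, k4⟩ := exists_h1_curve hψ.continuous (continuous_pdx hψ) hψc
    (hasDerivAt_slice_snd (hψ.differentiable one_ne_zero))
  have hloc := locallyIntegrable_of_continuous k1
  refine ⟨Φ, Ψ, ⟨hloc, fun a b => ext_rep (funext fun x => ?_)⟩, k1, h2, k2, h3, h4,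
    k3, k4⟩
  -- Evaluation at `x` commutes with the integral in `H1 m`, and reduces the identity to the
  -- fundamental theorem of calculus for `t ↦ φ (t, x)`.
  have e1 := (evalL m x).intervalIntegral_comp_comm (hloc.intervalIntegrable' a b)
  simp only [evalL_apply] at e1
  rw [← e1, rep_sub, Pi.sub_apply, h3, h3]
  simp only [k3]
  exact (intervalIntegral.integral_eq_sub_of_hasDerivAt
    (fun t _ => hasDerivAt_slice_fst hdφ t x)
    ((hψ.continuous.comp (continuous_id.prodMk continuous_const)).intervalIntegrable _ _)).symm

theorem MemL2loc.integrable_inner {f ψ : ℝ × ℝ → E m} (hf : MemL2loc f) (hψ : Continuous ψ)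
    (hc : HasCompactSupport ψ) : Integrable fun p => inner ℝ (f p) (ψ p) := by
  have h1 := hf _ hc.isCompact
  have h2 := memL2loc_of_continuous hψ _ hc.isCompact
  have h3 : IntegrableOn (fun p => inner ℝ (f p) (ψ p)) (tsupport ψ) :=
    (h1.norm.integrable_mul h2.norm).mono' (h1.1.inner h2.1)
      (ae_of_all _ fun p => norm_inner_le_norm _ _)
  refine (integrableOn_iff_integrable_of_support_subset fun p hp => ?_).1 h3
  by_contra hcon
  exact hp (by simp [image_eq_zero_of_notMem_tsupport hcon])

/-- For fixed `t`, the integral in `x` is `⟨U', Φ'⟩ + ⟨∇𝒲(U), Φ⟩`, where `Φ` is the curve of slices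
of `φ`: the terms in `u_t` and `u_tx` form the `H¹` inner product, and the others form the
differential of the action. -/
theorem IsDoubleWell.weakForm (hW : IsDoubleWell α W am ap) {U q : ℝ → H1 m}
    (hU : ∀ t, HasDerivAt U (q t) t)
    (hq : ∀ t, HasDerivAt q (gradient (realPot W am ap) (U t)) t) {φ : ℝ × ℝ → E m}
    (hφ : ContDiff ℝ 2 φ) (hc : HasCompactSupport φ) :
    Integrable (fun p => inner ℝ (planeDer q p) (pdx (pdt φ) p) +
      (inner ℝ (planeRep q p) (pdt φ p) + inner ℝ (planeMapDer am ap U p) (pdx φ p)) +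
        inner ℝ (gradient W (planeMap am ap U p)) (φ p)) ∧
    ∫ p, (inner ℝ (planeDer q p) (pdx (pdt φ) p) +
      (inner ℝ (planeRep q p) (pdt φ p) + inner ℝ (planeMapDer am ap U p) (pdx φ p)) +
        inner ℝ (gradient W (planeMap am ap U p)) (φ p)) = 0 := by
  have hUc : Continuous U := continuous_iff_continuousAt.2 fun t => (hU t).continuousAt
  have hqc : Continuous q := continuous_iff_continuousAt.2 fun t => (hq t).continuousAt
  have hφ1 : ContDiff ℝ 1 φ := hφ.of_le (by norm_num)
  have hψ := contDiff_pdt hφ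
  have hψc : HasCompactSupport (pdt φ) := hc.fderiv_apply (𝕜 := ℝ) (1, 0)
  have i1 := (memL2loc_planeDer hqc).integrable_inner (continuous_pdx hψ)
    (hψc.fderiv_apply (𝕜 := ℝ) (0, 1))
  have i2 := (memL2loc_planeRep hqc).integrable_inner hψ.continuous hψc
  have i3 := (memL2loc_planeMapDer (am := am) (ap := ap) hUc).integrable_inner
    (continuous_pdx hφ1) (hc.fderiv_apply (𝕜 := ℝ) (0, 1))
  have i4 := (memL2loc_of_continuous (hW.continuous_gradient.comp
    (continuous_planeMap (am := am) (ap := ap) hUc))).integrable_inner hφ.continuous hc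
  have hint := (i1.add (i2.add i3)).add i4
  refine ⟨hint, ?_⟩
  obtain ⟨Φ, Ψ, hΦ, hΨc, hΦs, hΨs, h1, h2, h3, h4⟩ := exists_test_curve hφ hc
  have hslice : ∀ t, ∫ x, (inner ℝ (planeDer q (t, x)) (pdx (pdt φ) (t, x)) +
      (inner ℝ (planeRep q (t, x)) (pdt φ (t, x)) +
        inner ℝ (planeMapDer am ap U (t, x)) (pdx φ (t, x))) +
        inner ℝ (gradient W (planeMap am ap U (t, x))) (φ (t, x))) =
      inner ℝ (q t) (Ψ t) + inner ℝ (gradient (realPot W am ap) (U t)) (Φ t) := fun t => by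
    have e1 : (fun x => (inner ℝ (h1Der (q t) x) (h1Der (Ψ t) x) : ℝ)) =ᵐ[volume]
        fun x => inner ℝ (planeDer q (t, x)) (pdx (pdt φ) (t, x)) := by
      filter_upwards [deriv_rep_ae (q t), h4 t] with x a b
      rw [← a, b]; rfl
    have e3 : (fun x => (inner ℝ (uder am ap (U t) x) (h1Der (Φ t) x) : ℝ)) =ᵐ[volume]
        fun x => inner ℝ (planeMapDer am ap U (t, x)) (pdx φ (t, x)) := by
      filter_upwards [deriv_urep_ae (am := am) (ap := ap) (U t), h2 t] with x a b
      rw [← a, b]; rfl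
    have e2 : (fun x => (inner ℝ (h1Fun (q t) x) (h1Fun (Ψ t) x) : ℝ)) =ᵐ[volume]
        fun x => inner ℝ (planeRep q (t, x)) (pdt φ (t, x)) := by
      filter_upwards [h1Fun_ae_eq_rep (q t), h1Fun_ae_eq_rep (Ψ t)] with x a b
      rw [a, b, h3]; rfl
    have e4 : ∀ x, (inner ℝ (gradient W (urep am ap (U t) x)) (rep (Φ t) x) : ℝ) =
        inner ℝ (gradient W (planeMap am ap U (t, x))) (φ (t, x)) := fun x => by
      rw [h1]; rfl
    have j1 := (L2.integrable_inner (𝕜 := ℝ) (sndL m (q t)) (sndL m (Ψ t))).congr e1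
    have j2 := (L2.integrable_inner (𝕜 := ℝ) (fstL m (q t)) (fstL m (Ψ t))).congr e2
    have j3 := (integrable_inner_uder (am := am) (ap := ap) (U t) (Φ t)).congr e3
    have j4 := hW.integrable_inner_gradient (U t) (Φ t)
    simp only [e4] at j4
    rw [integral_add (f := fun x => inner ℝ (planeDer q (t, x)) (pdx (pdt φ) (t, x)) +
      (inner ℝ (planeRep q (t, x)) (pdt φ (t, x)) +
        inner ℝ (planeMapDer am ap U (t, x)) (pdx φ (t, x)))) (j1.add (j2.add j3)) j4,
      integral_add (g := fun x => inner ℝ (planeRep q (t, x)) (pdt φ (t, x)) +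
        inner ℝ (planeMapDer am ap U (t, x)) (pdx φ (t, x))) j1 (j2.add j3),
      integral_add j2 j3, ← integral_congr_ae e1,
      ← integral_congr_ae e2, ← integral_congr_ae e3, h1_inner_eq, inner_gradient_eq,
      (hW.hasFDerivAt_realPot (U t)).fderiv, hW.dAction_eq_integral]
    simp only [e4]
    ring
  rw [Measure.volume_eq_prod] at hint ⊢
  refine (integral_prod _ hint).trans ?_
  refine (integral_congr_ae (ae_of_all _ hslice)).trans ?_
  have hΦd := fun t => hΦ.hasDerivAt hΨc t
  refine integral_eq_zero_of_hasDerivAt_of_integrable (f := fun t => inner ℝ (q t) (Φ t))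
    (fun t => (hq t).inner ℝ (hΦd t)) ?_ ?_
  · have hGc := (continuous_gradient_of_contDiff hW.contDiff_realPot).comp hUc
    refine ((hqc.inner hΨc).integrable_of_hasCompactSupport ?_).add
      ((hGc.inner hΦ.continuous).integrable_of_hasCompactSupport ?_)
    · exact hΨs.mono fun t ht h0 => ht (by simp [h0])
    · exact hΦs.mono fun t ht h0 => ht (by simp [h0])
  · exact (hqc.inner hΦ.continuous).integrable_of_hasCompactSupport
      (hΦs.mono fun t ht h0 => ht (by simp [h0]))

end WeakForm

section PlaneMinimality

/-! ### Minimality in the plane -/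

variable {m : ℕ} {α : ℝ} {W : E m → ℝ} {am ap : E m}

/-- The energy density of the curve `e₀ + A` with derivative `g`. -/
def planeDensity (W : E m → ℝ) (am ap : E m) (A g : ℝ → H1 m) (p : ℝ × ℝ) : ℝ≥0∞ :=
  ENNReal.ofReal ((1 / 2) * (‖planeDer g p‖ ^ 2 + ‖planeRep g p‖ ^ 2 + ‖planeMapDer am ap A p‖ ^ 2)
    + W (planeMap am ap A p))

theorem energy_planeMap {A g : ℝ → H1 m} (hA : IsPath A g) (hg : Continuous g) (Ω : Set (ℝ × ℝ)) :
    energy W Ω (planeMap am ap A) = ∫⁻ p in Ω, planeDensity W am ap A g p := by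
  have h1 := (hasWeakDeriv_planeMap_fst (am := am) (ap := ap) hA hg).weakDeriv_ae_eq
  have h2 := (hasWeakDeriv_planeMap_snd (am := am) (ap := ap) hA.continuous).weakDeriv_ae_eq
  have h3 := (hasWeakDeriv_planeRep_snd hg).weakDeriv_ae_eq
  rw [← weakDeriv_congr h1] at h3
  refine lintegral_congr_ae (ae_restrict_of_ae ?_)
  filter_upwards [h1, h2, h3] with p e1 e2 e3
  rw [e1, e2, e3, planeDensity]

/-- The slice energy is `½‖g‖²` plus the action, and the action exceeds `𝒲` by `J_min`. On a strip
of finite width this contributes the same finite constant to both energies compared. -/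
theorem IsDoubleWell.lintegral_slice (hW : IsDoubleWell α W am ap) (A g : ℝ → H1 m) (t : ℝ) :
    ∫⁻ x, planeDensity W am ap A g (t, x) =
      ENNReal.ofReal ((1 / 2) * ‖g t‖ ^ 2 + realPot W am ap (A t)) + minAction W am ap := by
  have i1 := integrable_deriv_rep_sq (g t)
  have i2 := integrable_rep_sq (g t)
  have i3 := integrable_deriv_urep_sq (am := am) (ap := ap) (A t)
  have i4 := hW.integrable_potential (A t)
  have i12 : Integrable fun x => ‖deriv (rep (g t)) x‖ ^ 2 + ‖rep (g t) x‖ ^ 2 := i1.add i2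
  have i123 : Integrable fun x => (1 / 2) * (‖deriv (rep (g t)) x‖ ^ 2 + ‖rep (g t) x‖ ^ 2 +
      ‖deriv (urep am ap (A t)) x‖ ^ 2) := (i12.add i3).const_mul (1 / 2)
  have i5 : Integrable fun x => (1 / 2) * (‖deriv (rep (g t)) x‖ ^ 2 + ‖rep (g t) x‖ ^ 2 +
      ‖deriv (urep am ap (A t)) x‖ ^ 2) + W (urep am ap (A t) x) := i123.add i4
  have e : ∫ x, ((1 / 2) * (‖deriv (rep (g t)) x‖ ^ 2 + ‖rep (g t) x‖ ^ 2 +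
      ‖deriv (urep am ap (A t)) x‖ ^ 2) + W (urep am ap (A t) x)) =
      (1 / 2) * ‖g t‖ ^ 2 + realPot W am ap (A t) + (minAction W am ap).toReal := by
    rw [integral_add i123 i4, integral_const_mul,
      integral_add i12 i3, integral_add i1 i2, integral_deriv_rep_sq, integral_rep_sq,
      integral_deriv_urep_sq, hW.realPot_eq, norm_sq_eq_fstL]
    simp only [realAction]
    ring
  calc ∫⁻ x, planeDensity W am ap A g (t, x) = ENNReal.ofReal (∫ x, ((1 / 2) *
        (‖deriv (rep (g t)) x‖ ^ 2 + ‖rep (g t) x‖ ^ 2 + ‖deriv (urep am ap (A t)) x‖ ^ 2) +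
          W (urep am ap (A t) x))) :=
        (ofReal_integral_eq_lintegral_ofReal i5 (ae_of_all _ fun x => by
          have := hW.nonneg (urep am ap (A t) x); positivity)).symm
    _ = _ := by
        rw [e, ENNReal.ofReal_add (add_nonneg (by positivity) (realPot_nonneg _))
          ENNReal.toReal_nonneg, ENNReal.ofReal_toReal hW.minAction_ne_top]

theorem IsDoubleWell.measurable_planeDensity (hW : IsDoubleWell α W am ap) {A g : ℝ → H1 m}
    (hA : Continuous A) (hg : Continuous g) : Measurable (planeDensity W am ap A g) :=
  ((((measurable_planeDer hg).norm.pow_const 2).add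
    ((continuous_planeRep hg).measurable.norm.pow_const 2)).add
      ((measurable_planeMapDer hA).norm.pow_const 2)).const_mul _ |>.add
    (hW.continuous.comp (continuous_planeMap hA)).measurable |>.ennreal_ofReal

theorem IsDoubleWell.lintegral_planeDensity (hW : IsDoubleWell α W am ap) {A g : ℝ → H1 m}
    (hA : Continuous A) (hg : Continuous g) (S : Set ℝ) :
    ∫⁻ p in S ×ˢ Set.univ, planeDensity W am ap A g p =
      pathEnergy (realPot W am ap) S A g + minAction W am ap * volume S := by
  rw [restrict_prod_univ, lintegral_prod _ (hW.measurable_planeDensity hA hg).aemeasurable]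
  simp only [hW.lintegral_slice]
  rw [lintegral_add_right _ measurable_const, setLIntegral_const]
  rfl

/-- `φ` is a compactly supported perturbation of the curve `U`. Minimality of `U` is first localized
to a compact set of times, hence to a strip, and then to the support of `φ`, outside of which the
two densities agree. -/
theorem IsDoubleWell.energy_le_energy_add (hW : IsDoubleWell α W am ap) {U q : ℝ → H1 m}
    (hU : IsPath U q) (hq : Continuous q) (hfin : pathEnergy (realPot W am ap) Set.univ U q ≠ ⊤)
    (hmin : ∀ Φ Ψ : ℝ → H1 m, IsPath Φ Ψ → HasCompactSupport Φ →
      pathEnergy (realPot W am ap) Set.univ U q ≤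
        pathEnergy (realPot W am ap) Set.univ (U + Φ) (q + Ψ))
    {φ : ℝ × ℝ → E m} (hφ : ContDiff ℝ 2 φ) (hc : HasCompactSupport φ) :
    energy W (tsupport φ) (planeMap am ap U) ≠ ⊤ ∧ energy W (tsupport φ) (planeMap am ap U) ≤
      energy W (tsupport φ) (fun p => planeMap am ap U p + φ p) := by
  obtain ⟨Φ, Ψ, hΦ, hΨc, hΦs, hΨs, h1, -, h3, -⟩ := exists_test_curve hφ hc
  have hUc := hU.continuous
  have hadd : (fun p => planeMap am ap U p + φ p) = planeMap am ap (U + Φ) := by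
    funext ⟨t, x⟩
    simp only [planeMap, urep, Pi.add_apply, rep_add, h1, add_assoc]
  have hV := hU.add hΦ
  rw [hadd, energy_planeMap hU hq, energy_planeMap hV (hq.add hΨc)]
  set S : Set ℝ := tsupport Φ ∪ tsupport Ψ ∪ Prod.fst '' tsupport φ with hS
  have hSc : IsCompact S := (hΦs.isCompact.union hΨs.isCompact).union
    (hc.isCompact.image continuous_fst)
  have hle : pathEnergy (realPot W am ap) S U q ≤
      pathEnergy (realPot W am ap) S (U + Φ) (q + Ψ) :=
    pathEnergy_le_of_le hSc.measurableSet hfin (hmin Φ Ψ hΦ hΦs)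
      (fun t ht => by
        have : Φ t = 0 := image_eq_zero_of_notMem_tsupport fun h => ht (Or.inl (Or.inl h))
        simp [this])
      (fun t ht => by
        have : Ψ t = 0 := image_eq_zero_of_notMem_tsupport fun h => ht (Or.inl (Or.inr h))
        simp [this])
  set Z : Set (ℝ × ℝ) := S ×ˢ Set.univ
  set K := tsupport φ
  have hKZ : K ⊆ Z := fun p hp => ⟨Or.inr ⟨p, hp, rfl⟩, trivial⟩
  have hKm : MeasurableSet K := (isClosed_tsupport φ).measurableSet
  have hZm : MeasurableSet Z := hSc.measurableSet.prod MeasurableSet.univ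
  have hZle : ∫⁻ p in Z, planeDensity W am ap U q p ≤
      ∫⁻ p in Z, planeDensity W am ap (U + Φ) (q + Ψ) p := by
    rw [hW.lintegral_planeDensity hUc hq, hW.lintegral_planeDensity hV.continuous (hq.add hΨc)]
    exact add_le_add hle le_rfl
  have hZfin : ∫⁻ p in Z, planeDensity W am ap U q p ≠ ⊤ := by
    rw [hW.lintegral_planeDensity hUc hq]
    exact ENNReal.add_ne_top.2 ⟨ne_top_of_le_ne_top hfin (pathEnergy_mono (Set.subset_univ _) _ _),
      ENNReal.mul_ne_top hW.minAction_ne_top hSc.measure_lt_top.ne⟩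
  refine ⟨ne_top_of_le_ne_top hZfin (lintegral_mono_set hKZ), ?_⟩
  have hsplit : ∀ f : ℝ × ℝ → ℝ≥0∞, ∫⁻ p in Z, f p = (∫⁻ p in K, f p) + ∫⁻ p in Z \ K, f p :=
    fun f => by
      rw [← lintegral_union (hZm.diff hKm) Set.disjoint_sdiff_right, Set.union_sdiff_cancel hKZ]
  -- Off the support, `φ` vanishes in a whole neighbourhood in `x`, so the pointwise derivatives of
  -- the slices coincide as well.
  have hout : ∫⁻ p in Z \ K, planeDensity W am ap U q p =
      ∫⁻ p in Z \ K, planeDensity W am ap (U + Φ) (q + Ψ) p := by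
    refine setLIntegral_congr_fun (hZm.diff hKm) fun p hp => ?_
    obtain ⟨t, x⟩ := p
    have hev : ∀ᶠ y in 𝓝 x, (t, y) ∉ K :=
      ((continuous_const.prodMk continuous_id).tendsto x).eventually
        ((isClosed_tsupport φ).isOpen_compl.mem_nhds hp.2)
    have hΦ0 : rep ((U + Φ) t) =ᶠ[𝓝 x] rep (U t) := by
      filter_upwards [hev] with y hy
      rw [Pi.add_apply, rep_add, Pi.add_apply, h1]
      simp only [image_eq_zero_of_notMem_tsupport hy, add_zero]
    have hΨ0 : rep ((q + Ψ) t) =ᶠ[𝓝 x] rep (q t) := by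
      filter_upwards [hev] with y hy
      rw [Pi.add_apply, rep_add, Pi.add_apply, h3]
      simp only [pdt, fderiv_of_notMem_tsupport (𝕜 := ℝ) hy, zero_apply,
        add_zero]
    have hu0 : urep am ap ((U + Φ) t) =ᶠ[𝓝 x] urep am ap (U t) := by
      filter_upwards [hΦ0] with y hy
      rw [urep, urep, hy]
    simp only [planeDensity, planeDer, planeRep, planeMapDer, planeMap]
    rw [hΨ0.deriv_eq, hΨ0.eq_of_nhds, hu0.deriv_eq, hu0.eq_of_nhds]
  rw [hsplit, hsplit, ← hout] at hZle
  exact (ENNReal.add_le_add_iff_right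
    (ne_top_of_le_ne_top hZfin (lintegral_mono_set Set.sdiff_subset))).1 hZle

/-! ### Uniform limits -/

/-- A finite net of the trajectory suffices: each of its finitely many points has the limit `a`, and
the `H¹` distance to the net controls the sup distance. -/
theorem tendstoUniformlyOn_of_totallyBounded {U : ℝ → H1 m} {S : Set ℝ} {l : Filter ℝ} {a : E m}
    (h : TotallyBounded (U '' S)) (hl : ∀ k, Tendsto (urep am ap k) l (𝓝 a)) :
    TendstoUniformlyOn (fun x t => planeMap am ap U (t, x)) (fun _ => a) l S := by
  rw [Metric.tendstoUniformlyOn_iff]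
  intro ε hε
  obtain ⟨s, hs, hcov⟩ := Metric.totallyBounded_iff.1 h (ε / 4) (by positivity)
  have h1 : ∀ᶠ x in l, ∀ k ∈ s, dist (urep am ap k x) a < ε / 2 :=
    (eventually_all_finite hs).2 fun k _ => (Metric.tendsto_nhds.1 (hl k)) _ (half_pos hε)
  filter_upwards [h1] with x hx t ht
  obtain ⟨k, hk, hkt⟩ := Set.mem_iUnion₂.1 (hcov ⟨t, ht, rfl⟩)
  rw [Metric.mem_ball, dist_eq_norm] at hkt
  have h2 := norm_rep_le (U t - k) x
  have h3 : dist (urep am ap (U t) x) (urep am ap k x) ≤ 2 * ‖U t - k‖ := by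
    rw [dist_eq_norm, urep, urep, add_sub_add_left_eq_sub]
    rwa [rep_sub] at h2
  have h4 := dist_triangle_left a (urep am ap (U t) x) (urep am ap k x)
  have h5 := hx k hk
  rw [dist_comm] at h3
  change dist a (urep am ap (U t) x) < ε
  linarith [dist_comm (urep am ap k x) (urep am ap (U t) x)]

theorem totallyBounded_range {X : Type*} [NormedAddCommGroup X] {U : ℝ → X} (hU : Continuous U)
    {a b : X} (ha : Tendsto U atBot (𝓝 a)) (hb : Tendsto U atTop (𝓝 b)) :
    TotallyBounded (Set.range U) := by
  rw [Metric.totallyBounded_iff]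
  intro ε hε
  obtain ⟨s, hs⟩ := eventually_atBot.1 (Metric.tendsto_nhds.1 ha ε hε)
  obtain ⟨t, ht⟩ := eventually_atTop.1 (Metric.tendsto_nhds.1 hb ε hε)
  obtain ⟨S, hS, hcov⟩ := Metric.totallyBounded_iff.1
    ((isCompact_Icc (a := s) (b := t)).image hU).totallyBounded ε hε
  refine ⟨insert a (insert b S), (hS.insert b).insert a, ?_⟩
  rintro _ ⟨r, rfl⟩
  rw [Set.mem_iUnion₂]
  rcases le_total r s with h | h
  · exact ⟨a, Set.mem_insert _ _, hs r h⟩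
  rcases le_total t r with h' | h'
  · exact ⟨b, Set.mem_insert_of_mem _ (Set.mem_insert _ _), ht r h'⟩
  · obtain ⟨k, hk, hkr⟩ := Set.mem_iUnion₂.1 (hcov ⟨r, ⟨h, h'⟩, rfl⟩)
    exact ⟨k, Set.mem_insert_of_mem _ (Set.mem_insert_of_mem _ hk), hkr⟩

/-! ### The action of curves and the nondegeneracy condition -/

theorem IsDoubleWell.hAction_eq (hW : IsDoubleWell α W am ap) {V g : ℝ → H1 m} (hV : IsPath V g) :
    hAction W am ap V = pathEnergy (realPot W am ap) Set.univ V g := by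
  rw [pathEnergy, setLIntegral_univ, hAction]
  refine lintegral_congr_ae ?_
  filter_upwards [hV.hasWeakDeriv.weakDeriv_ae_eq] with t ht
  rw [ht, ENNReal.ofReal_add (by positivity) (realPot_nonneg _), hW.ofReal_realPot]

/-- A limit of points of `Fm` is a zero of the continuous potential, and the separation excludes it
from `Fp`. -/
theorem isClosed_left (hW : IsDoubleWell α W am ap) {Fm Fp : Set (H1 m)} {D : ℝ}
    (hF : minHet W am ap = Fm ∪ Fp) (hP : TwoWell (realPot W am ap) Fm Fp D) : IsClosed Fm := by
  refine isClosed_of_closure_subset fun x hx => ?_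
  have h0 : IsClosed (minHet W am ap) := by
    have : minHet W am ap = realPot W am ap ⁻¹' {0} := Set.ext fun h => hW.mem_minHet_iff
    rw [this]; exact isClosed_singleton.preimage hP.continuous
  have h1 : x ∈ Fm ∪ Fp := by
    rw [← hF]
    exact closure_minimal (hF ▸ Set.subset_union_left) h0 hx
  rcases h1 with h1 | h1
  · exact h1
  · have h2 := hP.le_infDist_add x
    rw [Metric.infDist_zero_of_mem h1, (Metric.mem_closure_iff_infDist_zero hP.nonempty_left).1 hx]
      at h2
    linarith [hP.pos]

/-- Within `D / 2` of `Fm` the distances to `Fm` and to all minimal heteroclinics coincide. The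
points at distance zero, which the liminf ignores, satisfy the bound trivially. -/
theorem exists_quadratic_lower (hW : IsDoubleWell α W am ap) {Fm Fp : Set (H1 m)} {D : ℝ}
    (hF : minHet W am ap = Fm ∪ Fp) (hP : TwoWell (realPot W am ap) Fm Fp D)
    (hN : IsNondegenerate W am ap) :
    ∃ c > 0, ∃ ε > 0, ∀ h, Metric.infDist h Fm < ε →
      c * Metric.infDist h Fm ^ 2 ≤ realPot W am ap h := by
  obtain ⟨c, hc0, hc⟩ := exists_between hN
  have hctop : c ≠ ⊤ := (hc.trans_le le_top).ne
  obtain ⟨S, hS, hSc⟩ := mem_comap.1 (eventually_lt_of_lt_liminf hc)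
  obtain ⟨ε, hε, hεS⟩ := mem_nhdsGT_iff_exists_Ioo_subset.1 hS
  have hD := hP.pos
  have hε' : (0 : ℝ) < ε := hε
  refine ⟨c.toReal, ENNReal.toReal_pos hc0.ne' hctop, min ε (D / 2), lt_min hε' (half_pos hD),
    fun h hh => ?_⟩
  have hne : (Fm ∪ Fp).Nonempty := hP.nonempty_left.mono Set.subset_union_left
  have h1 : Metric.infDist h (minHet W am ap) = Metric.infDist h Fm := by
    rw [hF]
    refine le_antisymm (Metric.infDist_le_infDist_of_subset Set.subset_union_left hP.nonempty_left)
      ((Metric.le_infDist hne).2 ?_)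
    rintro y (hy | hy)
    · exact Metric.infDist_le_dist_of_mem hy
    · have h2 := hP.le_infDist_add h
      have h3 := Metric.infDist_le_dist_of_mem (x := h) hy
      have h4 := hh.trans_le (min_le_right _ _)
      linarith
  rcases (Metric.infDist_nonneg (x := h) (s := Fm)).eq_or_lt with h0 | h0
  · rw [← h0]; simpa using realPot_nonneg h
  have h2 := hSc (show Metric.infDist h (minHet W am ap) ∈ S from by
    rw [h1]; exact hεS ⟨h0, hh.trans_le (min_le_left _ _)⟩)
  simp only [Set.mem_ofPred_eq] at h2
  rw [h1] at h2
  have h3 : ENNReal.ofReal (Metric.infDist h Fm ^ 2) ≠ 0 := by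
    rw [Ne, ENNReal.ofReal_eq_zero, not_le]; exact pow_pos h0 2
  have h4 := (ENNReal.le_div_iff_mul_le (Or.inl h3) (Or.inl ENNReal.ofReal_ne_top)).1 h2.le
  rw [← hW.ofReal_realPot, ← ENNReal.ofReal_toReal hctop, ← ENNReal.ofReal_mul ENNReal.toReal_nonneg]
    at h4
  exact (ENNReal.ofReal_le_ofReal_iff (realPot_nonneg h)).1 h4

end PlaneMinimality

section Connections

/-! ### Minimizing connections in `e₀ + H¹` -/

variable {m : ℕ} {α : ℝ} {W : E m → ℝ} {am ap : E m}

/-- The isometries required by `exists_minimizer` are the translations in `x`, which bring every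
minimal heteroclinic into a fixed ball. -/
theorem IsDoubleWell.exists_connection (hW : IsDoubleWell α W am ap) {Fm Fp : Set (H1 m)} {D : ℝ}
    (hF : minHet W am ap = Fm ∪ Fp) (hP : TwoWell (realPot W am ap) Fm Fp D) :
    ∃ U q : ℝ → H1 m, (∀ t, HasDerivAt U (q t) t) ∧
      (∀ t, HasDerivAt q (gradient (realPot W am ap) (U t)) t) ∧ Connects Fm Fp (D / 4) U ∧
      pathEnergy (realPot W am ap) Set.univ U q ≠ ⊤ ∧
      ∀ V g : ℝ → H1 m, IsPath V g → Connects Fm Fp (D / 4) V →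
        pathEnergy (realPot W am ap) Set.univ U q ≤ pathEnergy (realPot W am ap) Set.univ V g := by
  have hF' : minHet W am ap = Fp ∪ Fm := by rw [hF, Set.union_comm]
  obtain ⟨B, hB⟩ := hW.exists_norm_minHet
  obtain ⟨U, g, hU, hc, hfin, hmin⟩ := hP.exists_minimizer
    (fun x y h ε hε => hW.eventually_realPot h hε)
    (fun e he B hB => hW.exists_subseq_minHet hF hP he hB)
    (fun e he B hB => hW.exists_subseq_minHet hF' hP.symm he hB)
    ⟨B, fun e he => by
      obtain ⟨a, ha⟩ := hB e (hP.zero (Or.inl he))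
      exact ⟨e0Shift am ap a, shiftL m a, fun x => hW.realPot_translate a x,
        fun x => hW.infDist_translate hF hP a x, fun x => hW.infDist_translate hF' hP.symm a x, ha⟩⟩
  obtain ⟨q, h1, h2, h3⟩ := hP.exists_hasDerivAt hW.contDiff_realPot hU hc hfin hmin
  have he : pathEnergy (realPot W am ap) Set.univ U g =
      pathEnergy (realPot W am ap) Set.univ U q := by
    rw [pathEnergy, pathEnergy, setLIntegral_univ, setLIntegral_univ]
    exact lintegral_congr_ae (by filter_upwards [h3] with t ht; rw [ht])
  rw [he] at hfin hmin
  exact ⟨U, q, h1, h2, hc, hfin, hmin⟩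

theorem mem_constrainedClass {Fm Fp : Set (H1 m)} {V g : ℝ → H1 m} (hV : IsPath V g)
    (hg : MemLp g 2 volume) (hc : Connects Fm Fp (setDist Fm Fp / 4) V) :
    V ∈ constrainedClass Fm Fp :=
  ⟨hV.continuous, ⟨memL2loc_of_continuous hV.continuous, g, hV.hasWeakDeriv,
    memL2loc_of_memLp hg⟩, hc⟩

/-- The two-sided exponential convergence of a minimizing connection. -/
theorem IsDoubleWell.exists_exp_le (hW : IsDoubleWell α W am ap) {Fm Fp : Set (H1 m)} {D : ℝ}
    (hF : minHet W am ap = Fm ∪ Fp) (hP : TwoWell (realPot W am ap) Fm Fp D) {U q : ℝ → H1 m}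
    (hU : ∀ t, HasDerivAt U (q t) t) (hqc : Continuous q)
    (heq : ∀ t, (1 / 2) * ‖q t‖ ^ 2 = realPot W am ap (U t)) (hc : Connects Fm Fp (D / 4) U)
    (hfin : pathEnergy (realPot W am ap) Set.univ U q ≠ ⊤)
    (hmin : ∀ V g : ℝ → H1 m, IsPath V g → Connects Fm Fp (D / 4) V →
      pathEnergy (realPot W am ap) Set.univ U q ≤ pathEnergy (realPot W am ap) Set.univ V g)
    (hN : IsNondegenerate W am ap) :
    ∃ em ∈ Fm, ∃ ep ∈ Fp, ∃ k > 0, ∃ K > 0,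
      (∀ t ≥ 0, ‖U t - ep‖ ≤ K * Real.exp (-k * t)) ∧
      (∀ t ≤ 0, ‖U t - em‖ ≤ K * Real.exp (k * t)) := by
  have hF' : minHet W am ap = Fp ∪ Fm := by rw [hF, Set.union_comm]
  obtain ⟨em, hem, k, hk, K, hK, hl⟩ := hP.exists_exp_le (isClosed_left hW hF hP) hU hqc heq hc
    hfin hmin (exists_quadratic_lower hW hF hP hN)
  -- The behaviour at `+∞` is that of the time-reversed curve at `-∞`, with the roles of the two
  -- families exchanged.
  obtain ⟨ep, hep, k', hk', K', hK', hr⟩ := hP.symm.exists_exp_le (isClosed_left hW hF' hP.symm)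
    (U := fun t => U (-t)) (q := fun t => -q (-t))
    (fun t => by
      have := (hU (-t)).scomp t (hasDerivAt_neg t)
      simpa [Function.comp_def] using this)
    (hqc.comp continuous_neg).neg (fun t => by rw [norm_neg]; exact heq (-t)) hc.comp_neg
    (by rwa [pathEnergy_comp_neg])
    (fun V g hV hc' => by
      rw [pathEnergy_comp_neg, ← pathEnergy_comp_neg _ V]
      exact hmin _ _ hV.comp_neg hc'.comp_neg)
    (exists_quadratic_lower hW hF' hP.symm hN)
  refine ⟨em, hem, ep, hep, min k k', lt_min hk hk', max K K', lt_max_of_lt_left hK,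
    fun t ht => ?_, fun t ht => ?_⟩
  · have h1 := hr (-t) (by linarith)
    rw [neg_neg] at h1
    refine h1.trans (mul_le_mul (le_max_right _ _) (Real.exp_le_exp.2 ?_) (Real.exp_nonneg _)
      (hK.le.trans (le_max_left _ _)))
    nlinarith [min_le_right k k']
  · refine (hl t ht).trans (mul_le_mul (le_max_left _ _) (Real.exp_le_exp.2 ?_)
      (Real.exp_nonneg _) (hK.le.trans (le_max_left _ _)))
    nlinarith [min_le_left k k']

theorem tendsto_of_norm_le_exp {X : Type*} [NormedAddCommGroup X] {U : ℝ → X} {e : X} {k K : ℝ}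
    (hk : 0 < k) (h : ∀ t ≥ 0, ‖U t - e‖ ≤ K * Real.exp (-k * t)) : Tendsto U atTop (𝓝 e) := by
  rw [tendsto_iff_norm_sub_tendsto_zero]
  have h1 : Tendsto (fun t => K * Real.exp (-k * t)) atTop (𝓝 0) := by
    have h2 : Tendsto (fun t : ℝ => -k * t) atTop atBot :=
      tendsto_id.const_mul_atTop_of_neg (neg_neg_of_pos hk)
    simpa using (Real.tendsto_exp_atBot.comp h2).const_mul K
  exact squeeze_zero' (Eventually.of_forall fun t => norm_nonneg _)
    ((eventually_ge_atTop 0).mono h) h1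

end Connections

end DoubleLayer

end

/-! ### The theorem: the minimizing connection read in the plane. -/

theorem mainTheorem3 {m : ℕ} (hm : 2 ≤ m) (α : ℝ) (hα : α ∈ Set.Ioo (0 : ℝ) 1)
    (W : DoubleLayer.E m → ℝ) (am ap : DoubleLayer.E m) (hW : IsDoubleWell α W am ap)
    (Fm Fp : Set (H1 m)) (hF : minHet W am ap = Fm ∪ Fp)
    (hFm : Fm.Nonempty) (hFp : Fp.Nonempty) (hd : 0 < setDist Fm Fp) :
    ∃ U ∈ constrainedClass Fm Fp,
      -- `U` is a minimizer
      hAction W am ap U ≠ ⊤ ∧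
      (∀ V ∈ constrainedClass Fm Fp, hAction W am ap U ≤ hAction W am ap V) ∧
      -- the effective potential is finite and `C¹`; `U` is a classical solution
      (∀ h : H1 m, minAction W am ap ≤ action W (affineMap am ap h) ∧
        action W (affineMap am ap h) ≠ ⊤) ∧
      ContDiff ℝ 1 (fun h : H1 m => (effPot W am ap h).toReal) ∧
      ContDiff ℝ 2 U ∧
      (∀ t : ℝ, deriv (deriv U) t =
        gradient (fun h : H1 m => (effPot W am ap h).toReal) (U t)) ∧
      -- `u(t, x) = [U(t)](x)`, with `u(t, ·)` continuous, and the weak derivatives of `u`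
      ∃ u ut ux utx : ℝ × ℝ → DoubleLayer.E m,
        (∀ t : ℝ, (Continuous fun x : ℝ => u (t, x)) ∧
          (fun x : ℝ => u (t, x)) =ᵐ[volume] affineMap am ap (U t)) ∧
        (∀ t : ℝ, (fun x : ℝ => ut (t, x)) =ᵐ[volume] h1Fun (deriv U t) ∧
          (fun x : ℝ => ux (t, x)) =ᵐ[volume] weakDeriv (1 : ℝ) (affineMap am ap (U t)) ∧
          (fun x : ℝ => utx (t, x)) =ᵐ[volume] h1Der (deriv U t)) ∧
        HasWeakDeriv ((1, 0) : ℝ × ℝ) u ut ∧ HasWeakDeriv ((0, 1) : ℝ × ℝ) u ux ∧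
        HasWeakDeriv ((0, 1) : ℝ × ℝ) ut utx ∧
        MemL2loc u ∧ MemL2loc ut ∧ MemL2loc ux ∧
        MemLp ut 2 volume ∧ MemLp utx 2 volume ∧
        (∀ a b : ℝ, MemLp ux 2 (volume.restrict (Set.Ioo a b ×ˢ (Set.univ : Set ℝ)))) ∧
        -- weak form of the fourth-order system
        (∀ φ : ℝ × ℝ → DoubleLayer.E m, ContDiff ℝ 2 φ → HasCompactSupport φ →
          Integrable (fun p => inner ℝ (utx p) (pdx (pdt φ) p) + (inner ℝ (ut p) (pdt φ p)
            + inner ℝ (ux p) (pdx φ p)) + inner ℝ (gradient W (u p)) (φ p)) ∧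
          ∫ p, (inner ℝ (utx p) (pdx (pdt φ) p) + (inner ℝ (ut p) (pdt φ p)
            + inner ℝ (ux p) (pdx φ p)) + inner ℝ (gradient W (u p)) (φ p)) = 0) ∧
        -- boundary conditions
        Tendsto (fun t => Metric.infDist (U t) Fm) atBot (𝓝 0) ∧
        Tendsto (fun t => Metric.infDist (U t) Fp) atTop (𝓝 0) ∧
        (∀ T : ℝ, TendstoUniformlyOn (fun x t => u (t, x)) (fun _ => am) atBot (Set.Icc (-T) T) ∧
          TendstoUniformlyOn (fun x t => u (t, x)) (fun _ => ap) atTop (Set.Icc (-T) T)) ∧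
        -- equipartition, in its two forms
        (∀ t : ℝ, (1 / 2) * ‖deriv U t‖ ^ 2 = (effPot W am ap (U t)).toReal) ∧
        (∀ t : ℝ, Integrable (fun x => ‖ut (t, x)‖ ^ 2 + ‖utx (t, x)‖ ^ 2) ∧
          Integrable (fun x => (1 / 2) * ‖ux (t, x)‖ ^ 2 + W (u (t, x))) ∧
          (1 / 2) * ∫ x, (‖ut (t, x)‖ ^ 2 + ‖utx (t, x)‖ ^ 2) =
            (∫ x, ((1 / 2) * ‖ux (t, x)‖ ^ 2 + W (u (t, x)))) - (minAction W am ap).toReal) ∧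
        -- minimality
        (∀ φ : ℝ × ℝ → DoubleLayer.E m, ContDiff ℝ 2 φ → HasCompactSupport φ →
          energy W (tsupport φ) u ≠ ⊤ ∧
          energy W (tsupport φ) u ≤ energy W (tsupport φ) (fun p => u p + φ p)) ∧
        -- exponential convergence under the nondegeneracy condition
        (IsNondegenerate W am ap →
          (∃ em ∈ Fm, ∃ ep ∈ Fp, ∃ k > 0, ∃ K > 0,
            (∀ t ≥ 0, ‖U t - ep‖ ≤ K * Real.exp (-k * t)) ∧
            (∀ t ≤ 0, ‖U t - em‖ ≤ K * Real.exp (k * t))) ∧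
          TendstoUniformly (fun x t => u (t, x)) (fun _ => am) atBot ∧
          TendstoUniformly (fun x t => u (t, x)) (fun _ => ap) atTop) := by
  have hP := hW.twoWell_realPot hF hFm hFp hd
  obtain ⟨U, q, hU, hq, hc, hfin, hmin⟩ := hW.exists_connection hF hP
  have hqc : Continuous q := continuous_iff_continuousAt.2 fun t => (hq t).continuousAt
  have hpath : IsPath U q := IsPath.of_hasDerivAt hU hqc
  have hUc := hpath.continuous
  have hdU : deriv U = q := funext fun t => (hU t).deriv
  have hdq : deriv q = fun t => gradient (realPot W am ap) (U t) := funext fun t => (hq t).deriv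
  have hGc : Continuous (deriv q) := by
    rw [hdq]; exact (continuous_gradient_of_contDiff hW.contDiff_realPot).comp hUc
  have hqL : MemLp q 2 volume :=
    memLp_of_pathEnergy realPot_nonneg hpath.locallyIntegrable.aestronglyMeasurable hfin
  have hq2 : IntegrableOn (fun t => ‖q t‖ ^ 2) Set.univ :=
    ((memLp_two_iff_integrable_sq_norm hqL.1).1 hqL).integrableOn
  have heq := equipartition hW.contDiff_realPot realPot_nonneg hU hq hfin
  obtain ⟨tm, tp, htm, hm1, hp1⟩ := hc
  have hc : Connects Fm Fp (setDist Fm Fp / 4) U := ⟨tm, tp, htm, hm1, hp1⟩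
  refine ⟨U, mem_constrainedClass hpath hqL hc, ?_, fun V hV => ?_, fun h =>
    ⟨minAction_le W am ap h, hW.action_ne_top h⟩, hW.contDiff_realPot, ?_, fun t => ?_,
    planeMap am ap U, planeRep q, planeMapDer am ap U, planeDer q, fun t => ⟨?_, ?_⟩,
    fun t => ⟨?_, ?_, ?_⟩, hasWeakDeriv_planeMap_fst hpath hqc, hasWeakDeriv_planeMap_snd hUc,
    hasWeakDeriv_planeRep_snd hqc, memL2loc_of_continuous (continuous_planeMap hUc),
    memL2loc_planeRep hqc, memL2loc_planeMapDer hUc, ?_, ?_, memLp_planeMapDer hUc,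
    fun φ hφ hφc => hW.weakForm hU hq hφ hφc, hP.tendsto_atBot hpath hfin hm1,
    hP.tendsto_atTop hpath hfin hp1, fun T => ⟨?_, ?_⟩, fun t => ?_, fun t => ⟨?_, ?_, ?_⟩,
    fun φ hφ hφc => ?_, fun hN => ?_⟩
  · rw [hW.hAction_eq hpath]; exact hfin
  -- A continuous `H¹_loc` competitor is an absolutely continuous path, so the minimality among
  -- paths applies to it.
  · obtain ⟨hVc, ⟨-, g, hg, -⟩, hVconn⟩ := hV
    have hVp := hg.isPath hVc
    rw [hW.hAction_eq hpath, hW.hAction_eq hVp]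
    exact hmin V g hVp hVconn
  · have h1 : ContDiff ℝ 1 q :=
      contDiff_one_iff_deriv.2 ⟨fun t => (hq t).differentiableAt, hGc⟩
    rw [show (2 : WithTop ℕ∞) = 1 + 1 by norm_num, contDiff_succ_iff_deriv, hdU]
    exact ⟨fun t => (hU t).differentiableAt, by simp, h1⟩
  · rw [hdU, hdq]; rfl
  · exact continuous_urep am ap (U t)
  · exact (affineMap_ae_eq am ap (U t)).symm
  · rw [hdU]; exact (h1Fun_ae_eq_rep (q t)).symm
  · exact (deriv_urep_ae (U t)).trans (weakDeriv_affineMap am ap (U t)).symm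
  · rw [hdU]; exact deriv_rep_ae (q t)
  · simpa [Set.univ_prod_univ] using memLp_planeRep hqc hq2
  · simpa [Set.univ_prod_univ] using memLp_planeDer hqc hq2
  · exact tendstoUniformlyOn_of_totallyBounded (isCompact_Icc.image hUc).totallyBounded
      (tendsto_urep_atBot am ap)
  · exact tendstoUniformlyOn_of_totallyBounded (isCompact_Icc.image hUc).totallyBounded
      (tendsto_urep_atTop am ap)
  · rw [hdU]; exact heq t
  · exact (integrable_rep_sq (q t)).add (integrable_deriv_rep_sq (q t))
  · exact ((integrable_deriv_urep_sq (U t)).const_mul (1 / 2)).add (hW.integrable_potential (U t))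
  · have h1 : ∫ x, (‖planeRep q (t, x)‖ ^ 2 + ‖planeDer q (t, x)‖ ^ 2) = ‖q t‖ ^ 2 := by
      rw [norm_sq_eq_fstL, ← integral_rep_sq, ← integral_deriv_rep_sq]
      exact integral_add (integrable_rep_sq (q t)) (integrable_deriv_rep_sq (q t))
    have h2 : ∫ x, ((1 / 2) * ‖planeMapDer am ap U (t, x)‖ ^ 2 + W (planeMap am ap U (t, x))) =
        realAction W am ap (U t) := by
      rw [realAction, ← integral_deriv_urep_sq, ← integral_const_mul]
      exact integral_add ((integrable_deriv_urep_sq (U t)).const_mul (1 / 2))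
        (hW.integrable_potential (U t))
    rw [h1, h2, heq t, hW.realPot_eq]
  · refine hW.energy_le_energy_add hpath hqc hfin (fun Φ Ψ hΦ hΦc => ?_) hφ hφc
    refine hmin _ _ (hpath.add hΦ) ?_
    -- A compactly supported perturbation leaves the curve unchanged for large `|t|`, so it remains
    -- in the constrained class.
    obtain ⟨R, hR⟩ := hΦc.isCompact.isBounded.subset_closedBall 0
    have h0 : ∀ t, R < |t| → Φ t = 0 := fun t ht => image_eq_zero_of_notMem_tsupport fun hmem =>
      absurd (mem_closedBall_zero_iff.1 (hR hmem)) (not_le.2 ht)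
    refine ⟨min tm (-|R| - 1), max tp (|R| + 1),
      (min_le_left _ _).trans_lt (htm.trans_le (le_max_left _ _)), fun t ht => ?_, fun t ht => ?_⟩
    · have h2 := ht.trans (min_le_right _ _)
      rw [Pi.add_apply, h0 t (by linarith [neg_le_abs t, le_abs_self R]), add_zero]
      exact hm1 t (ht.trans (min_le_left _ _))
    · have h2 := (le_max_right _ _).trans ht
      rw [Pi.add_apply, h0 t (by linarith [le_abs_self t, le_abs_self R]), add_zero]
      exact hp1 t ((le_max_left _ _).trans ht)
  · obtain ⟨em, hem, ep, hep, k, hk, K, hK, hr, hl⟩ :=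
      hW.exists_exp_le hF hP hU hqc heq hc hfin hmin hN
    have htop : Tendsto U atTop (𝓝 ep) := tendsto_of_norm_le_exp hk hr
    have hbot : Tendsto U atBot (𝓝 em) := by
      have h1 : Tendsto (fun t => U (-t)) atTop (𝓝 em) :=
        tendsto_of_norm_le_exp hk fun t ht => by
          have := hl (-t) (by linarith)
          rwa [mul_neg, ← neg_mul] at this
      simpa [Function.comp_def] using h1.comp tendsto_neg_atBot_atTop
    -- With limits at both ends the whole trajectory is totally bounded, and the convergence in `x`
    -- becomes uniform over all `t`.
    have htb : TotallyBounded (U '' Set.univ) := by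
      rw [Set.image_univ]; exact totallyBounded_range hUc hbot htop
    refine ⟨⟨em, hem, ep, hep, k, hk, K, hK, hr, hl⟩, ?_, ?_⟩
    · exact tendstoUniformlyOn_univ.1
        (tendstoUniformlyOn_of_totallyBounded htb (tendsto_urep_atBot am ap))
    · exact tendstoUniformlyOn_univ.1
        (tendstoUniformlyOn_of_totallyBounded htb (tendsto_urep_atTop am ap))
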